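/- Let $A,B,C\in\mathbb R$ and $n,\bar n,m,\bar m,p,\bar p\in\mathbb Z$, and put $a=A+n$, $b=B+m$, $c=C+p$, $\bar a=A+\bar n$, $\bar b=B+\bar m$, $\bar c=C+\bar p$ (all real; the bar on an exponent is not complex conjugation). For $z\in\mathbb C$ let $$\mathcal G_1(z,\bar z)=\int_{\mathbb C} w^{a}\bar w^{\bar a}(w-1)^{b}(\bar w-1)^{\bar b}(w-z)^{c}(\bar w-\bar z)^{\bar c}\,d^2w ,\qquad d^2w=dx\,dy,\quad w=x+iy,$$ where $u^{A+n}\bar u^{A+\bar n}$ means the single-valued function $|u|^{2A}u^{n}\bar u^{\bar n}$, and similarly for $B$ and $C$. Put $$\mathcal I(a,b,c;z)=\begin{pmatrix}\int_1^{\infty}w^a(w-1)^b(w-z)^c\,dw\\[2pt] \int_0^z w^a(1-w)^b(z-w)^c\,dw\end{pmatrix},\qquad \mathcal J(a,b,c;z)=\begin{pmatrix}\int_{-\infty}^0(-w)^a(1-w)^b(z-w)^c\,dw\\[2pt] \int_z^1 w^a(1-w)^b(w-z)^c\,dw\end{pmatrix},$$ with principal powers and straight paths (so that every base is positive when $0<z<1$),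 and, with $\varepsilon_k:=(-1)^{k}$, $$G_1=\frac{1}{\sin\pi(A+C)}\begin{pmatrix}\sin\pi(A+B+C)\,\sin\pi B&0\\0&\varepsilon_{m-\bar m+p-\bar p}\,\sin\pi C\,\sin\pi A\end{pmatrix},$$ $$\hat G_1=\frac{1}{\sin\pi(B+C)}\begin{pmatrix}\varepsilon_{n-\bar n+m-\bar m+p-\bar p}\,\sin\pi(A+B+C)\,\sin\pi A&0\\0&\varepsilon_{m-\bar m}\,\sin\pi C\,\sin\pi B\end{pmatrix}.$$ **(i) Holomorphic factorisation.** Suppose that $a,b,c,\bar a,\bar b,\bar c>-1$, $a+b+c<-1$ and $\bar a+\bar b+\bar c<-1$ (convergence of all the integrals). Then the integral $\mathcal G_1(z,\bar z)$ converges absolutely for all $z\in\mathbb C\setminus\{0,1\}$. If $\sin\pi(A+C)\neq0$, then for all $z\in\mathbb C\setminus((-\infty,0]\cup[1,\infty))$ $$\mathcal G_1(z,\bar z)=\mathcal I(\bar a,\bar b,\bar c;\bar z)^T\,G_1\,\mathcal I(a,b,c;z),$$ and if $\sin\pi(B+C)\ne0$, then for all such $z$ $$\mathcal G_1(z,\bar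 z)=\mathcal J(\bar a,\bar b,\bar c;\bar z)^T\,\hat G_1\,\mathcal J(a,b,c;z).$$ Both formulas hold for all $z\in\mathbb C\setminus\{0,1\}$, including the cuts, if $\mathcal I(\bar a,\bar b,\bar c;\bar z)$ and $\mathcal J(\bar a,\bar b,\bar c;\bar z)$ are written as the complex conjugates of $\mathcal I(\bar a,\bar b,\bar c;z)$ and $\mathcal J(\bar a,\bar b,\bar c;z)$. **(ii) Evaluation at $z=1$.** Suppose that $a,\bar a>-1$, $a+b+c<-1$, $\bar a+\bar b+\bar c<-1$, $b+c+\bar b+\bar c>-2$ and $\sin\pi(B+C)\neq0$. Let $N=(n,m+p)$, $\bar N=(\bar n,\bar m+\bar p)$, and let $$A_4(2,1,3,4;N)=\int_{-\infty}^0(-w)^{A+n}(1-w)^{B+C+m+p}\,dw,$$ $$M_4(N,\bar N)=\int_{\mathbb C}|w|^{2A}|1-w|^{2(B+C)}\,w^{n}\bar w^{\bar n}(1-w)^{m+p}(1-\bar w)^{\bar m+\bar p}\,d^2w$$ be the colour-ordered four-point open-string amplitude and the four-point closed-string partial amplitude; $A_4(2,1,3,4;\bar N)$ is defined in the same way with $\bar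 n,\bar m,\bar p$. Then $\mathcal G_1(1,1)$ converges absolutely, $\mathcal J(a,b,c;1)=(A_4(2,1,3,4;N),0)^T$, $\mathcal J(\bar a,\bar b,\bar c;1)=(A_4(2,1,3,4;\bar N),0)^T$, $$\mathcal G_1(1,1)=\varepsilon_{n-\bar n+m-\bar m+p-\bar p}\,\frac{\sin(\pi A)\,\sin(\pi(A+B+C))}{\sin(\pi(B+C))}\,A_4(2,1,3,4;N)\,A_4(2,1,3,4;\bar N),$$ $M_4(N,\bar N)=\varepsilon_{m-\bar m+p-\bar p}\,\mathcal G_1(1,1)$, and hence $$M_4(N,\bar N)=\varepsilon_{n-\bar n}\,\frac{\sin(\pi A)\,\sin(\pi(A+B+C))}{\sin(\pi(B+C))}\,A_4(2,1,3,4;N)\,A_4(2,1,3,4;\bar N).$$ When $N=\bar N$ the product of open-string amplitudes is $|A_4(2,1,3,4;N)|^2$ and all signs $\varepsilon$ in (ii) are $+1$. -/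

import Mathlib

open Real MeasureTheory Matrix
open scoped ComplexConjugate

noncomputable section

namespace StringCorrelator

/-- The single-valued product `w ^ (A + k) * conj w ^ (A + k')` of a holomorphic and an
antiholomorphic power whose exponents differ by an integer: `|w| ^ (2 A) * w ^ k * conj w ^ k'`. -/
def powPair (A : ℝ) (k k' : ℤ) (w : ℂ) : ℂ :=
  ((‖w‖ ^ (2 * A) : ℝ) : ℂ) * w ^ k * (conj w) ^ k'

/-- The integrand of the correlator, for exponents `a = A + n`, `b = B + m`, `c = C + p` and
`ā = A + n'`, `b̄ = B + m'`, `c̄ = C + p'`. -/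
def correlatorIntegrand (A B C : ℝ) (n n' m m' p p' : ℤ) (z w : ℂ) : ℂ :=
  powPair A n n' w * powPair B m m' (w - 1) * powPair C p p' (w - z)

/-- The correlator, an integral over the plane for the Lebesgue measure `dx dy`, `w = x + i y`. -/
def correlator (A B C : ℝ) (n n' m m' p p' : ℤ) (z : ℂ) : ℂ :=
  ∫ w : ℂ, correlatorIntegrand A B C n n' m m' p p' z w

/-- `∫ f(w) dw` along the straight segment from `u` to `v`. -/
def segmentIntegral (f : ℂ → ℂ) (u v : ℂ) : ℂ :=
  (v - u) * ∫ t in (0 : ℝ)..1, f (u + (t : ℂ) * (v - u))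

/-- The Aomoto-Gel'fand integrals `∫_1^∞ w^a (w-1)^b (w-z)^c dw` and
`∫_0^z w^a (1-w)^b (z-w)^c dw`. All powers are principal; for `0 < z < 1` all bases are positive. -/
def vecI (a b c : ℝ) (z : ℂ) : Fin 2 → ℂ :=
  ![∫ w in Set.Ioi (1 : ℝ), (w : ℂ) ^ (a : ℂ) * ((w : ℂ) - 1) ^ (b : ℂ) * ((w : ℂ) - z) ^ (c : ℂ),
    segmentIntegral (fun w => w ^ (a : ℂ) * (1 - w) ^ (b : ℂ) * (z - w) ^ (c : ℂ)) 0 z]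

/-- The Aomoto-Gel'fand integrals `∫_{-∞}^0 (-w)^a (1-w)^b (z-w)^c dw` and
`∫_z^1 w^a (1-w)^b (w-z)^c dw`. All powers are principal; for `0 < z < 1` all bases are positive. -/
def vecJ (a b c : ℝ) (z : ℂ) : Fin 2 → ℂ :=
  ![∫ w in Set.Iio (0 : ℝ), (-(w : ℂ)) ^ (a : ℂ) * (1 - (w : ℂ)) ^ (b : ℂ) * (z - (w : ℂ)) ^ (c : ℂ),
    segmentIntegral (fun w => w ^ (a : ℂ) * (1 - w) ^ (b : ℂ) * (w - z) ^ (c : ℂ)) z 1]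

/-- The domain `ℂ ∖ ((-∞, 0] ∪ [1, ∞))`, on which the entries of `vecI` and `vecJ` are
holomorphic. -/
def cutPlane : Set ℂ := {z | z.im ≠ 0 ∨ (0 < z.re ∧ z.re < 1)}

/-- The sign `(-1)^k`. -/
def parity (k : ℤ) : ℝ := (-1) ^ k

/-- The coefficient matrix in the `I` basis; `m, m', p, p'` are the integer shifts of
`b, b̄, c, c̄`. -/
def matG (A B C : ℝ) (m m' p p' : ℤ) : Matrix (Fin 2) (Fin 2) ℝ :=
  (1 / sin (π * (A + C))) •
    !![sin (π * (A + B + C)) * sin (π * B), 0;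
       0, parity (m - m' + (p - p')) * (sin (π * C) * sin (π * A))]

/-- The coefficient matrix in the `J` basis. -/
def matGhat (A B C : ℝ) (n n' m m' p p' : ℤ) : Matrix (Fin 2) (Fin 2) ℝ :=
  (1 / sin (π * (B + C))) •
    !![parity (n - n' + (m - m') + (p - p')) * (sin (π * (A + B + C)) * sin (π * A)), 0;
       0, parity (m - m') * (sin (π * C) * sin (π * B))]

/-- The bilinear form `uᵀ M v`. -/
def bilin (u : Fin 2 → ℂ) (M : Matrix (Fin 2) (Fin 2) ℝ) (v : Fin 2 → ℂ) : ℂ :=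
  u ⬝ᵥ (M.map (fun x : ℝ => (x : ℂ)) *ᵥ v)

/-- The four Aomoto-Gel'fand integrals with exponents `a, b, c` converge. -/
def Convergent (a b c : ℝ) : Prop := -1 < a ∧ -1 < b ∧ -1 < c ∧ a + b + c < -1

/-- The four-point closed-string partial amplitude, as a function of the kinematic invariants
`s12, s23` and the integer exponents. -/
def closedAmplitude (s12 s23 : ℝ) (n12 n12' n23 n23' : ℤ) : ℂ :=
  ∫ w : ℂ, ((‖w‖ ^ s12 * ‖1 - w‖ ^ s23 : ℝ) : ℂ) *
    (w ^ n12 * (conj w) ^ n12' * (1 - w) ^ n23 * (1 - conj w) ^ n23')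

/-- The colour-ordered four-point open-string amplitude `A₄(2,1,3,4)`, in the units in which the
open-string exponents are half of the closed-string exponents. -/
def openAmplitude2134 (s12 s23 : ℝ) (n12 n23 : ℤ) : ℝ :=
  ∫ w in Set.Iio (0 : ℝ), (-w) ^ (s12 / 2 + n12) * (1 - w) ^ (s23 / 2 + n23)

end StringCorrelator

end

open StringCorrelator

open StringCorrelator

namespace StringCorrelator

open Filter Topology Set

/-! The substitution `w = -exp ζ` turns the plane, up to a null set, into the strip `|Im ζ| < π`.
Including the Jacobian, the integrand becomes a constant times `conj k * h`, where `h` and `k` are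
the multivalued form `logIntegrand` with the unbarred and the barred exponents. Both are holomorphic
once the strip is cut along the line `Im ζ = arg (-z)`, the image of the ray from `0` through `z`.
If `K` is the primitive of `k` that vanishes at `w = 0`, Stokes' theorem for `conj K * h` turns the
area integral into integrals over the edges of the two substrips. This is Riemann's bilinear
relation (`strip_bilinear`).

The edges pair up as the two sides of the ray through `1` and of the ray through `z`. On the two
sides of a ray the forms are one common function times conjugate phases, which change at the branch
point. Barred and unbarred exponents differ by integers, so nearly everything cancels across the
ray. What survives is a sine times the conjugate of the integral of `k` from `0` to the branch point
times the integral of `h` from there to infinity (`jump_integral`, `integral_conj_mul_logIntegrand`,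
`correlator_eq_rays`).

Cauchy's theorem in each substrip gives two linear relations between the integrals over `(0,1)`,
`(1,∞)`, `(0,z)`, `(z,∞)` (`contour_relations`). They express the first and the last through the two
that make up `vecI`, at the price of the denominator `sin π(A+C)`. After substitution the mixed
products cancel, so the coefficient matrix is diagonal.

This works when the two rays are distinct, that is for `z` off `[0,∞)`. On the positive axis the
formula follows by letting `z` approach from below: the correlator is continuous
(`continuousAt_correlator`), and the principal powers are continuous from the closed upper
half-plane. The `J` basis is the `I` basis after the reflection `w ↦ 1 - w`.

At `z = 1` the factors with exponents `B` and `C` merge. After the reflection the integral is a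
correlator whose third factor has exponent zero and sits at the spectator point `-1`. There `sin πC
= 0`, only one product of ray integrals remains, and the first contour relation evaluates it
(`correlator_neg_one`). -/

lemma _root_.Set.Finite.eventually_notMem_atBot {T : Set ℝ} (hT : T.Finite) :
    ∀ᶠ x in atBot, x ∉ T := by
  obtain ⟨m, hm⟩ := hT.bddBelow
  exact (eventually_lt_atBot m).mono fun x hx hxT => (hm hxT).not_gt hx

lemma _root_.Set.Finite.eventually_notMem_atTop {T : Set ℝ} (hT : T.Finite) :
    ∀ᶠ x in atTop, x ∉ T := by
  obtain ⟨m, hm⟩ := hT.bddAbove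
  exact (eventually_gt_atTop m).mono fun x hx hxT => (hm hxT).not_gt hx

/-! ### Holomorphic functions on horizontal strips: Cauchy, Stokes and the bilinear relation -/

lemma hasDerivAt_horizontal {g : ℂ → ℂ} {g' : ℂ} {x y : ℝ}
    (h : HasDerivAt g g' (x + y * Complex.I)) :
    HasDerivAt (fun s : ℝ => g (s + y * Complex.I)) g' x := by
  have h1 : HasDerivAt (fun s : ℝ => (s : ℂ) + y * Complex.I) 1 x :=
    (Complex.ofRealCLM.hasDerivAt.add_const _)
  simpa [Function.comp_def] using h.scomp x h1

lemma mem_strip {α β x y : ℝ} (hy : y ∈ Ioo α β) :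
    (x : ℂ) + y * Complex.I ∈ Complex.im ⁻¹' Ioo α β := by simpa using hy

lemma isOpen_strip (α β : ℝ) : IsOpen (Complex.im ⁻¹' Ioo α β) :=
  isOpen_Ioo.preimage Complex.continuous_im

lemma convex_strip (α β : ℝ) : Convex ℝ (Complex.im ⁻¹' Ioo α β) :=
  (convex_Ioo α β).linear_preimage Complex.imLm

lemma continuous_horizontal {α β y : ℝ} {k : ℂ → ℂ}
    (hk : DifferentiableOn ℂ k (Complex.im ⁻¹' Ioo α β)) (hy : y ∈ Ioo α β) :
    Continuous fun s : ℝ => k (s + y * Complex.I) :=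
  hk.continuousOn.comp_continuous (by fun_prop) fun _ => mem_strip hy

lemma integrable_horizontal {α β y : ℝ} {k : ℂ → ℂ} {κ : ℝ → ℝ} {T : Set ℝ} (hT : T.Finite)
    (hk : DifferentiableOn ℂ k (Complex.im ⁻¹' Ioo α β))
    (hb : ∀ x ∉ T, ∀ y ∈ Ioo α β, ‖k (x + y * Complex.I)‖ ≤ κ x)
    (hκ : Integrable κ) (hy : y ∈ Ioo α β) :
    Integrable fun s : ℝ => k (s + y * Complex.I) :=
  hκ.mono' (continuous_horizontal hk hy).aestronglyMeasurable
    (hT.countable.ae_notMem volume |>.mono fun x hx => hb x hx y hy)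

/-- A holomorphic function on a strip that is dominated by an integrable function of the real part
has the primitive `∫_{-∞}^x`. -/
lemma exists_primitive_strip {α β : ℝ} {k : ℂ → ℂ} {κ : ℝ → ℝ} {T : Set ℝ} (hT : T.Finite)
    (hk : DifferentiableOn ℂ k (Complex.im ⁻¹' Ioo α β))
    (hb : ∀ x ∉ T, ∀ y ∈ Ioo α β, ‖k (x + y * Complex.I)‖ ≤ κ x)
    (hκ : Integrable κ) (hκ0 : Tendsto κ atBot (𝓝 0)) :
    ∃ K : ℂ → ℂ, (∀ ζ ∈ Complex.im ⁻¹' Ioo α β, HasDerivAt K (k ζ) ζ) ∧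
      ∀ x : ℝ, ∀ y ∈ Ioo α β,
        K (x + y * Complex.I) = ∫ s in Iic x, k (s + y * Complex.I) := by
  rcases (Ioo α β).eq_empty_or_nonempty with he | ⟨y₀, hy₀⟩
  · exact ⟨0, by simp [he], by simp [he]⟩
  obtain ⟨g, hg⟩ := (convex_strip α β).exists_forall_hasDerivWithinAt (𝕜 := ℂ) hk
  have hg' : ∀ ζ ∈ Complex.im ⁻¹' Ioo α β, HasDerivAt g (k ζ) ζ := fun ζ hζ =>
    (hg ζ hζ).hasDerivAt ((isOpen_strip α β).mem_nhds hζ)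
  have hlim := tendsto_limUnder_of_hasDerivAt_of_integrableOn_Iic (a := 0)
    (fun x _ => hasDerivAt_horizontal (hg' _ (mem_strip hy₀)))
    (integrable_horizontal hT hk hb hκ hy₀).integrableOn
  set m := limUnder atBot fun s : ℝ => g (s + y₀ * Complex.I)
  -- The limit at `-∞` is the same on every line: two points with abscissa `s` are joined by a
  -- vertical segment on which the derivative is at most `κ s`.
  have hlim' : ∀ y ∈ Ioo α β, Tendsto (fun s : ℝ => g (s + y * Complex.I)) atBot (𝓝 m) := by
    intro y hy
    have hd : Tendsto (fun s : ℝ => g (s + y * Complex.I) - g (s + y₀ * Complex.I))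
        atBot (𝓝 0) := by
      refine squeeze_zero_norm' (a := fun s => κ s * |y - y₀|) (hT.eventually_notMem_atBot.mono fun s hs => ?_)
        (by simpa using hκ0.mul_const |y - y₀|)
      have hseg : ∀ ζ ∈ segment ℝ ((s : ℂ) + y₀ * Complex.I) (s + y * Complex.I),
          HasDerivWithinAt g (k ζ) (segment ℝ ((s : ℂ) + y₀ * Complex.I) (s + y * Complex.I)) ζ ∧
            ‖k ζ‖ ≤ κ s := by
        intro ζ hζ
        have hζS := (convex_strip α β).segment_subset (mem_strip hy₀) (mem_strip hy) hζ
        refine ⟨(hg' ζ hζS).hasDerivWithinAt, ?_⟩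
        have hre : ζ.re = s := by
          obtain ⟨p, q, -, -, hpq, rfl⟩ := hζ
          simp only [Complex.add_re, Complex.smul_re, Complex.ofReal_re, Complex.mul_re,
            Complex.I_re, Complex.I_im, Complex.ofReal_im, smul_eq_mul]
          linear_combination s * hpq
        have := hb ζ.re (hre ▸ hs) ζ.im hζS
        rwa [Complex.re_add_im, hre] at this
      have := (convex_segment _ _).norm_image_sub_le_of_norm_hasDerivWithin_le
        (fun ζ hζ => (hseg ζ hζ).1) (fun ζ hζ => (hseg ζ hζ).2)
        (left_mem_segment ℝ _ _) (right_mem_segment ℝ ((s : ℂ) + y₀ * Complex.I) _)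
      refine this.trans_eq ?_
      congr 1
      rw [add_sub_add_left_eq_sub, ← sub_mul, ← Complex.ofReal_sub, norm_mul, Complex.norm_I,
        mul_one, Complex.norm_real, Real.norm_eq_abs]
    simpa using hd.add hlim
  refine ⟨fun ζ => g ζ - m, fun ζ hζ => (hg' ζ hζ).sub_const m, fun x y hy => ?_⟩
  rw [integral_Iic_of_hasDerivAt_of_tendsto'
    (fun x _ => hasDerivAt_horizontal (hg' _ (mem_strip hy)))
    (integrable_horizontal hT hk hb hκ hy).integrableOn (hlim' y hy)]

/-- Integrals of a holomorphic function along horizontal lines agree. -/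
lemma integral_horizontal_eq {α β : ℝ} {k : ℂ → ℂ} {κ : ℝ → ℝ} {T : Set ℝ} (hT : T.Finite)
    (hk : DifferentiableOn ℂ k (Complex.im ⁻¹' Ioo α β))
    (hb : ∀ x ∉ T, ∀ y ∈ Ioo α β, ‖k (x + y * Complex.I)‖ ≤ κ x)
    (hκ : Integrable κ) (hκ0 : Tendsto κ atBot (𝓝 0)) (hκ1 : Tendsto κ atTop (𝓝 0))
    {y₁ y₂ : ℝ} (h₁ : y₁ ∈ Ioo α β) (h₂ : y₂ ∈ Ioo α β) :
    ∫ s : ℝ, k (s + y₁ * Complex.I) = ∫ s : ℝ, k (s + y₂ * Complex.I) := by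
  have hsub : uIcc y₁ y₂ ⊆ Ioo α β := ordConnected_Ioo.uIcc_subset h₁ h₂
  have hrect (R : ℝ) := Complex.integral_boundary_rect_eq_zero_of_differentiableOn k
    ⟨-R, y₁⟩ ⟨R, y₂⟩ (hk.mono fun ζ hζ => hsub hζ.2)
  have hvert : ∀ l : Filter ℝ, (∀ᶠ x in l, x ∉ T) → Tendsto κ l (𝓝 0) →
      Tendsto (fun x : ℝ => ∫ y in y₁..y₂, k (x + y * Complex.I)) l (𝓝 0) := by
    intro l hlT hl
    refine squeeze_zero_norm' (a := fun x => κ x * |y₂ - y₁|) ((hlT.mono fun x hx => ?_))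
      (by simpa using hl.mul_const |y₂ - y₁|)
    exact intervalIntegral.norm_integral_le_of_norm_le_const fun y hy =>
      hb x hx y (hsub (uIoc_subset_uIcc hy))
  have hhor : ∀ y ∈ Ioo α β, Tendsto (fun R : ℝ => ∫ x in -R..R, k (x + y * Complex.I)) atTop
      (𝓝 (∫ x : ℝ, k (x + y * Complex.I))) := fun y hy =>
    intervalIntegral_tendsto_integral (integrable_horizontal hT hk hb hκ hy)
      tendsto_neg_atTop_atBot tendsto_id
  have hlim := (((hhor y₁ h₁).sub (hhor y₂ h₂)).add
    ((hvert atTop hT.eventually_notMem_atTop hκ1).const_smul Complex.I)).sub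
    (((hvert atBot hT.eventually_notMem_atBot hκ0).comp tendsto_neg_atTop_atBot).const_smul Complex.I)
  have hzero := tendsto_nhds_unique hlim
    (tendsto_const_nhds.congr fun R => by simpa using (hrect R).symm)
  simpa [sub_eq_zero] using hzero

/-- Horizontal integrals of a dominated function converge to the integral of the boundary value. -/
lemma tendsto_integral_horizontal {α β : ℝ} {l : Filter ℝ} [l.IsCountablyGenerated]
    {k : ℂ → ℂ} {κ : ℝ → ℝ} {T : Set ℝ} (hT : T.Finite) {k₀ : ℝ → ℂ}
    (hk : DifferentiableOn ℂ k (Complex.im ⁻¹' Ioo α β))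
    (hb : ∀ x ∉ T, ∀ y ∈ Ioo α β, ‖k (x + y * Complex.I)‖ ≤ κ x)
    (hl : ∀ᶠ y in l, y ∈ Ioo α β) {V : Set ℝ} (hκ : IntegrableOn κ V)
    (hk₀ : ∀ᵐ x : ℝ, Tendsto (fun y : ℝ => k (x + y * Complex.I)) l (𝓝 (k₀ x))) :
    Tendsto (fun y : ℝ => ∫ x in V, k (x + y * Complex.I)) l (𝓝 (∫ x in V, k₀ x)) := by
  refine tendsto_integral_filter_of_dominated_convergence κ ?_ ?_ hκ (ae_restrict_of_ae hk₀)
  · exact hl.mono fun y hy => (continuous_horizontal hk hy).aestronglyMeasurable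
  · exact hl.mono fun y hy => ae_restrict_of_ae
      (hT.countable.ae_notMem volume |>.mono fun x hx => hb x hx y hy)

/-- Integrals of the two boundary values of a holomorphic function on a strip agree. -/
lemma integral_boundary_eq {α β : ℝ} (hαβ : α < β) {k : ℂ → ℂ} {κ : ℝ → ℝ} {T : Set ℝ} (hT : T.Finite) {kα kβ : ℝ → ℂ}
    (hk : DifferentiableOn ℂ k (Complex.im ⁻¹' Ioo α β))
    (hb : ∀ x ∉ T, ∀ y ∈ Ioo α β, ‖k (x + y * Complex.I)‖ ≤ κ x)
    (hκ : Integrable κ) (hκ0 : Tendsto κ atBot (𝓝 0)) (hκ1 : Tendsto κ atTop (𝓝 0))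
    (hkα : ∀ᵐ x : ℝ, Tendsto (fun y : ℝ => k (x + y * Complex.I)) (𝓝[>] α) (𝓝 (kα x)))
    (hkβ : ∀ᵐ x : ℝ, Tendsto (fun y : ℝ => k (x + y * Complex.I)) (𝓝[<] β) (𝓝 (kβ x))) :
    ∫ x, kα x = ∫ x, kβ x := by
  obtain ⟨y₀, hy₀⟩ := exists_between hαβ
  have hα : ∀ᶠ y in 𝓝[>] α, y ∈ Ioo α β := Ioo_mem_nhdsGT hαβ
  have hβ : ∀ᶠ y in 𝓝[<] β, y ∈ Ioo α β := Ioo_mem_nhdsLT hαβ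
  have key : ∀ l : Filter ℝ, l.NeBot → l.IsCountablyGenerated → (∀ᶠ y in l, y ∈ Ioo α β) →
      ∀ k₀ : ℝ → ℂ, (∀ᵐ x : ℝ, Tendsto (fun y : ℝ => k (x + y * Complex.I)) l (𝓝 (k₀ x))) →
      ∫ x, k₀ x = ∫ x : ℝ, k (x + y₀ * Complex.I) := by
    intro l _ _ hl k₀ hk₀
    have h1 := tendsto_integral_horizontal hT hk hb hl hκ.integrableOn (V := univ) hk₀
    simp only [Measure.restrict_univ] at h1
    refine tendsto_nhds_unique h1 (tendsto_const_nhds.congr' ?_)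
    exact hl.mono fun y hy => integral_horizontal_eq hT hk hb hκ hκ0 hκ1 hy₀ hy
  rw [key _ inferInstance inferInstance hα kα hkα, key _ inferInstance inferInstance hβ kβ hkβ]

/-- Stokes' theorem for `conj k * h` on a horizontal substrip. -/
lemma stokes_substrip {α β : ℝ} {h k : ℂ → ℂ} {κ Φ : ℝ → ℝ} {T : Set ℝ}
    (hk : DifferentiableOn ℂ k (Complex.im ⁻¹' Ioo α β))
    (hh : DifferentiableOn ℂ h (Complex.im ⁻¹' Ioo α β))
    (hT : T.Finite)
    (hb : ∀ x ∉ T, ∀ y ∈ Ioo α β, ‖k (x + y * Complex.I)‖ ≤ κ x)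
    (hκ : Integrable κ) (hκ0 : Tendsto κ atBot (𝓝 0))
    (hΦb : ∀ x ∉ T, ∀ y ∈ Ioo α β,
      ‖∫ s in Iic x, k (s + y * Complex.I)‖ * ‖h (x + y * Complex.I)‖ ≤ Φ x)
    (hΦ : Integrable Φ) (hΦ0 : Tendsto Φ atBot (𝓝 0)) (hΦ1 : Tendsto Φ atTop (𝓝 0))
    (hint : Integrable (fun q : ℝ × ℝ =>
      conj (k (q.1 + q.2 * Complex.I)) * h (q.1 + q.2 * Complex.I))
      (volume.prod (volume.restrict (Ioo α β))))
    {y₁ y₂ : ℝ} (h₁ : y₁ ∈ Ioo α β) (h₂ : y₂ ∈ Ioo α β) (h₁₂ : y₁ ≤ y₂) :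
    (∫ x : ℝ, conj (∫ s in Iic x, k (s + y₁ * Complex.I)) * h (x + y₁ * Complex.I)) -
      (∫ x : ℝ, conj (∫ s in Iic x, k (s + y₂ * Complex.I)) * h (x + y₂ * Complex.I)) =
    2 * Complex.I * ∫ y in y₁..y₂, ∫ x : ℝ,
      conj (k (x + y * Complex.I)) * h (x + y * Complex.I) := by
  obtain ⟨K, hK, hKint⟩ := exists_primitive_strip hT hk hb hκ hκ0
  have hsub : uIcc y₁ y₂ ⊆ Ioo α β := ordConnected_Ioo.uIcc_subset h₁ h₂
  have hS := isOpen_strip α β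
  set f : ℂ → ℂ := fun ζ => conj (K ζ) * h ζ with hf
  set F : ℂ → ℂ := fun ζ => conj (k ζ) * h ζ with hF
  set f' : ℂ → ℂ →L[ℝ] ℂ := fun ζ =>
    conj (K ζ) • ((ContinuousLinearMap.toSpanSingleton ℂ (deriv h ζ)).restrictScalars ℝ) +
      h ζ • ((Complex.conjCLE : ℂ →L[ℝ] ℂ).comp
        ((ContinuousLinearMap.toSpanSingleton ℂ (k ζ)).restrictScalars ℝ)) with hf'
  have hKc : ContinuousOn K (Complex.im ⁻¹' Ioo α β) := fun ζ hζ =>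
    (hK ζ hζ).continuousAt.continuousWithinAt
  have hfc : ContinuousOn f (Complex.im ⁻¹' Ioo α β) :=
    (Complex.continuous_conj.comp_continuousOn hKc).mul hh.continuousOn
  have hFc : ContinuousOn F (Complex.im ⁻¹' Ioo α β) :=
    (Complex.continuous_conj.comp_continuousOn hk.continuousOn).mul hh.continuousOn
  have hder : ∀ ζ ∈ Complex.im ⁻¹' Ioo α β, HasFDerivAt f (f' ζ) ζ := by
    intro ζ hζ
    have e1 : HasFDerivAt (fun ζ => conj (K ζ)) ((Complex.conjCLE : ℂ →L[ℝ] ℂ).comp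
        ((ContinuousLinearMap.toSpanSingleton ℂ (k ζ)).restrictScalars ℝ)) ζ :=
      (Complex.conjCLE : ℂ →L[ℝ] ℂ).hasFDerivAt.comp ζ
        ((hK ζ hζ).hasFDerivAt.restrictScalars ℝ)
    have e2 := (hh.differentiableAt (hS.mem_nhds hζ)).hasDerivAt.hasFDerivAt.restrictScalars ℝ
    exact e1.mul e2
  -- The operator is `2i` times the Cauchy-Riemann derivative: it kills the holomorphic factor `h`,
  -- and `conj K` contributes `conj k` twice.
  have hdiv : ∀ ζ, Complex.I • f' ζ 1 - f' ζ Complex.I = 2 * Complex.I * F ζ := by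
    intro ζ
    simp only [hf', hF, _root_.add_apply, _root_.smul_apply,
      ContinuousLinearMap.coe_restrictScalars', ContinuousLinearMap.toSpanSingleton_apply,
      ContinuousLinearMap.comp_apply, ContinuousLinearEquiv.coe_coe, Complex.conjCLE_apply,
      smul_eq_mul, map_mul, Complex.conj_I, one_mul]
    ring
  have hrect (R : ℝ) := Complex.integral_boundary_rect_of_continuousOn_of_hasFDerivAt_real f f'
    ⟨-R, y₁⟩ ⟨R, y₂⟩ (hfc.mono fun ζ hζ => hsub hζ.2)
    (fun ζ hζ => hder ζ (hsub (Ioo_subset_Icc_self hζ.2)))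
    (by
      simp only [hdiv]
      refine ContinuousOn.integrableOn_compact (isCompact_uIcc.reProdIm isCompact_uIcc) ?_
      exact continuousOn_const.mul (hFc.mono fun ζ hζ => hsub hζ.2))
  simp only [hdiv] at hrect
  have hfΦ : ∀ x ∉ T, ∀ y ∈ Ioo α β, ‖f (x + y * Complex.I)‖ ≤ Φ x := by
    intro x hx y hy
    rw [hf]
    simpa [hKint x y hy] using hΦb x hx y hy
  have hfcont : ∀ y ∈ Ioo α β, Continuous fun x : ℝ => f (x + y * Complex.I) := fun y hy =>
    hfc.comp_continuous (by fun_prop) fun _ => mem_strip hy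
  have hvert : ∀ l : Filter ℝ, (∀ᶠ x in l, x ∉ T) → Tendsto Φ l (𝓝 0) →
      Tendsto (fun x : ℝ => ∫ y in y₁..y₂, f (x + y * Complex.I)) l (𝓝 0) := by
    intro l hlT hl
    refine squeeze_zero_norm' (a := fun x => Φ x * |y₂ - y₁|) ((hlT.mono fun x hx => ?_))
      (by simpa using hl.mul_const |y₂ - y₁|)
    exact intervalIntegral.norm_integral_le_of_norm_le_const fun y hy =>
      hfΦ x hx y (hsub (uIoc_subset_uIcc hy))
  have hhor : ∀ y ∈ Ioo α β, Tendsto (fun R : ℝ => ∫ x in -R..R, f (x + y * Complex.I)) atTop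
      (𝓝 (∫ x : ℝ, f (x + y * Complex.I))) := fun y hy =>
    intervalIntegral_tendsto_integral
      (hΦ.mono' (hfcont y hy).aestronglyMeasurable 
        (hT.countable.ae_notMem volume |>.mono fun x hx => hfΦ x hx y hy))
      tendsto_neg_atTop_atBot tendsto_id
  have hint' : Integrable (fun q : ℝ × ℝ => F (q.1 + q.2 * Complex.I))
      (volume.prod (volume.restrict (Ioc y₁ y₂))) := by
    refine hint.mono_measure (Measure.prod_mono le_rfl (Measure.restrict_mono ?_ le_rfl))
    exact fun y hy => ⟨h₁.1.trans hy.1, hy.2.trans_lt h₂.2⟩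
  have harea : Tendsto (fun R : ℝ => ∫ x in -R..R, ∫ y in y₁..y₂,
      2 * Complex.I * F (x + y * Complex.I)) atTop
      (𝓝 (2 * Complex.I * ∫ y in y₁..y₂, ∫ x : ℝ, F (x + y * Complex.I))) := by
    have hswap : ∫ y in y₁..y₂, ∫ x : ℝ, F (x + y * Complex.I) =
        ∫ x : ℝ, ∫ y in y₁..y₂, F (x + y * Complex.I) := by
      simp only [intervalIntegral.integral_of_le h₁₂]
      exact (integral_integral_swap hint').symm
    have : Integrable fun x : ℝ => ∫ y in y₁..y₂, F (x + y * Complex.I) := by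
      simp only [intervalIntegral.integral_of_le h₁₂]
      exact hint'.integral_prod_left
    rw [hswap]
    simp only [intervalIntegral.integral_const_mul]
    exact (intervalIntegral_tendsto_integral this tendsto_neg_atTop_atBot tendsto_id).const_mul _
  have hlim := (((hhor y₁ h₁).sub (hhor y₂ h₂)).add
    ((hvert atTop hT.eventually_notMem_atTop hΦ1).const_smul Complex.I)).sub
    (((hvert atBot hT.eventually_notMem_atBot hΦ0).comp tendsto_neg_atTop_atBot).const_smul Complex.I)
  have hfin := tendsto_nhds_unique hlim
    (harea.congr fun R => by simpa using (hrect R).symm)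
  simp only [smul_zero, add_zero, sub_zero] at hfin
  rw [← hfin]
  congr 1 <;> refine integral_congr_ae (Eventually.of_forall fun x => ?_)
  · simp only [hf, hKint x y₁ h₁]
  · simp only [hf, hKint x y₂ h₂]

/-- Riemann's bilinear relation on a strip. -/
lemma strip_bilinear {α β : ℝ} (hαβ : α < β) {h k : ℂ → ℂ} {κ Φ : ℝ → ℝ} {T : Set ℝ} {hα hβ kα kβ : ℝ → ℂ}
    (hk : DifferentiableOn ℂ k (Complex.im ⁻¹' Ioo α β))
    (hh : DifferentiableOn ℂ h (Complex.im ⁻¹' Ioo α β))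
    (hT : T.Finite)
    (hb : ∀ x ∉ T, ∀ y ∈ Ioo α β, ‖k (x + y * Complex.I)‖ ≤ κ x)
    (hκ : Integrable κ) (hκ0 : Tendsto κ atBot (𝓝 0))
    (hΦb : ∀ x ∉ T, ∀ y ∈ Ioo α β,
      ‖∫ s in Iic x, k (s + y * Complex.I)‖ * ‖h (x + y * Complex.I)‖ ≤ Φ x)
    (hΦ : Integrable Φ) (hΦ0 : Tendsto Φ atBot (𝓝 0)) (hΦ1 : Tendsto Φ atTop (𝓝 0))
    (hint : Integrable (fun q : ℝ × ℝ =>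
      conj (k (q.1 + q.2 * Complex.I)) * h (q.1 + q.2 * Complex.I))
      (volume.prod (volume.restrict (Ioo α β))))
    (hkα : ∀ᵐ x : ℝ, Tendsto (fun y : ℝ => k (x + y * Complex.I)) (𝓝[>] α) (𝓝 (kα x)))
    (hkβ : ∀ᵐ x : ℝ, Tendsto (fun y : ℝ => k (x + y * Complex.I)) (𝓝[<] β) (𝓝 (kβ x)))
    (hhα : ∀ᵐ x : ℝ, Tendsto (fun y : ℝ => h (x + y * Complex.I)) (𝓝[>] α) (𝓝 (hα x)))
    (hhβ : ∀ᵐ x : ℝ, Tendsto (fun y : ℝ => h (x + y * Complex.I)) (𝓝[<] β) (𝓝 (hβ x))) :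
    (∫ x : ℝ, conj (∫ s in Iic x, kα s) * hα x) - (∫ x : ℝ, conj (∫ s in Iic x, kβ s) * hβ x) =
    2 * Complex.I * ∫ y in Ioo α β, ∫ x : ℝ,
      conj (k (x + y * Complex.I)) * h (x + y * Complex.I) := by
  set F : ℝ → ℂ := fun y => ∫ x : ℝ, conj (k (x + y * Complex.I)) * h (x + y * Complex.I) with hF
  have hFint : IntegrableOn F (Ioo α β) := hint.integral_prod_right
  have hEα : ∀ᶠ y in 𝓝[>] α, y ∈ Ioo α β := Ioo_mem_nhdsGT hαβ
  have hEβ : ∀ᶠ y in 𝓝[<] β, y ∈ Ioo α β := Ioo_mem_nhdsLT hαβ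
  obtain ⟨K, hK, hKint⟩ := exists_primitive_strip hT hk hb hκ hκ0
  have hE : ∀ l : Filter ℝ, l.NeBot → l.IsCountablyGenerated → (∀ᶠ y in l, y ∈ Ioo α β) →
      ∀ k₀ h₀ : ℝ → ℂ,
      (∀ᵐ x : ℝ, Tendsto (fun y : ℝ => k (x + y * Complex.I)) l (𝓝 (k₀ x))) →
      (∀ᵐ x : ℝ, Tendsto (fun y : ℝ => h (x + y * Complex.I)) l (𝓝 (h₀ x))) →
      Tendsto (fun y : ℝ => ∫ x : ℝ,
        conj (∫ s in Iic x, k (s + y * Complex.I)) * h (x + y * Complex.I)) l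
        (𝓝 (∫ x : ℝ, conj (∫ s in Iic x, k₀ s) * h₀ x)) := by
    intro l _ _ hl k₀ h₀ hk₀ hh₀
    refine tendsto_integral_filter_of_dominated_convergence Φ ?_ ?_ hΦ ?_
    · refine hl.mono fun y hy => ?_
      have hKc : ContinuousOn K (Complex.im ⁻¹' Ioo α β) := fun ζ hζ =>
        (hK ζ hζ).continuousAt.continuousWithinAt
      have : Continuous fun x : ℝ => conj (K (x + y * Complex.I)) * h (x + y * Complex.I) :=
        (Complex.continuous_conj.comp (hKc.comp_continuous (by fun_prop) fun _ => mem_strip hy)).mul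
          (continuous_horizontal hh hy)
      refine this.aestronglyMeasurable.congr (Eventually.of_forall fun x => ?_)
      simp only [hKint x y hy]
    · refine hl.mono fun y hy => hT.countable.ae_notMem volume |>.mono fun x hx => ?_
      simpa using hΦb x hx y hy
    · filter_upwards [hh₀] with x hx
      refine Tendsto.mul ?_ hx
      exact (Complex.continuous_conj.tendsto _).comp
        (tendsto_integral_horizontal hT hk hb hl hκ.integrableOn hk₀)
  have hFi : ∀ y₁ y₂, y₁ ∈ Icc α β → y₂ ∈ Icc α β → IntervalIntegrable F volume y₁ y₂ := by
    intro y₁ y₂ h₁ h₂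
    have : IntervalIntegrable F volume α β := by
      rw [intervalIntegrable_iff_integrableOn_Ioo_of_le hαβ.le]; exact hFint
    refine this.mono_set ?_
    rw [uIcc_of_le hαβ.le]
    exact ordConnected_Icc.uIcc_subset h₁ h₂
  have hcont : ContinuousOn (fun y => ∫ t in α..y, F t) (Icc α β) := by
    have : IntegrableOn F (Icc α β) := (integrableOn_Icc_iff_integrableOn_Ioo (by finiteness) (by finiteness)).2 hFint
    exact intervalIntegral.continuousOn_primitive_interval (by rwa [uIcc_of_le hαβ.le]) |>.mono
      (by rw [uIcc_of_le hαβ.le])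
  set P : ℝ → ℂ := fun y => ∫ t in α..y, F t with hP
  have hPα : Tendsto P (𝓝[>] α) (𝓝 (P α)) :=
    ((hcont α (left_mem_Icc.2 hαβ.le)).mono Ioo_subset_Icc_self).mono_left
      (by rw [nhdsWithin_Ioo_eq_nhdsGT hαβ])
  have hPβ : Tendsto P (𝓝[<] β) (𝓝 (P β)) :=
    ((hcont β (right_mem_Icc.2 hαβ.le)).mono Ioo_subset_Icc_self).mono_left
      (by rw [nhdsWithin_Ioo_eq_nhdsLT hαβ])
  set E : ℝ → ℂ := fun y => ∫ x : ℝ,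
        conj (∫ s in Iic x, k (s + y * Complex.I)) * h (x + y * Complex.I) with hEdef
  have hsub : ∀ y₁ ∈ Ioo α β, ∀ y₂ ∈ Ioo α β, y₁ ≤ y₂ →
      E y₁ - E y₂ = 2 * Complex.I * (P y₂ - P y₁) := by
    intro y₁ h₁ y₂ h₂ h₁₂
    have := stokes_substrip hk hh hT hb hκ hκ0 hΦb hΦ hΦ0 hΦ1 hint h₁ h₂ h₁₂
    rw [hEdef, this, hP]
    simp only
    rw [intervalIntegral.integral_interval_sub_left
      (hFi _ _ (left_mem_Icc.2 hαβ.le) (Ioo_subset_Icc_self h₂))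
      (hFi _ _ (left_mem_Icc.2 hαβ.le) (Ioo_subset_Icc_self h₁))]
  -- Stokes on substrips makes `E + 2i P` constant in `y`. Comparing its limits at the two edges
  -- gives the claim, without any regularity of `k` or `h` on the edges beyond pointwise limits.
  have hconst : ∃ c, ∀ y ∈ Ioo α β, E y + 2 * Complex.I * P y = c := by
    obtain ⟨y₀, hy₀⟩ := exists_between hαβ
    refine ⟨E y₀ + 2 * Complex.I * P y₀, fun y hy => ?_⟩
    rcases le_total y y₀ with hle | hle
    · linear_combination hsub y hy y₀ hy₀ hle
    · linear_combination -hsub y₀ hy₀ y hy hle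
  obtain ⟨c, hc⟩ := hconst
  have hlimit : ∀ l : Filter ℝ, l.NeBot → l.IsCountablyGenerated → (∀ᶠ y in l, y ∈ Ioo α β) →
      ∀ k₀ h₀ : ℝ → ℂ,
      (∀ᵐ x : ℝ, Tendsto (fun y : ℝ => k (x + y * Complex.I)) l (𝓝 (k₀ x))) →
      (∀ᵐ x : ℝ, Tendsto (fun y : ℝ => h (x + y * Complex.I)) l (𝓝 (h₀ x))) →
      ∀ p, Tendsto P l (𝓝 p) →
      (∫ x : ℝ, conj (∫ s in Iic x, k₀ s) * h₀ x) + 2 * Complex.I * p = c := by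
    intro l hl₁ hl₂ hl k₀ h₀ hk₀ hh₀ p hp
    refine tendsto_nhds_unique ((hE l hl₁ hl₂ hl k₀ h₀ hk₀ hh₀).add (hp.const_mul _)) ?_
    exact tendsto_const_nhds.congr' (hl.mono fun y hy => (hc y hy).symm)
  have e1 := hlimit _ inferInstance inferInstance hEα kα hα hkα hhα _ hPα
  have e2 := hlimit _ inferInstance inferInstance hEβ kβ hβ hkβ hhβ _ hPβ
  have e3 : P α = 0 := intervalIntegral.integral_same
  have e4 : P β = ∫ y in Ioo α β, F y := by
    rw [hP]; simp only
    rw [intervalIntegral.integral_of_le hαβ.le, integral_Ioc_eq_integral_Ioo]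
  rw [← e4]
  rw [e3] at e1
  linear_combination e1 - e2

/-! ### Majorants for products of powers -/

/-- The function `t ^ s`, cut off at `t = ρ`. -/
noncomputable def near (ρ s t : ℝ) : ℝ := if t < ρ then t ^ s else 0

lemma near_nonneg {ρ s t : ℝ} (ht : 0 ≤ t) : 0 ≤ near ρ s t := by
  unfold near; split_ifs <;> positivity

lemma measurable_near (ρ s : ℝ) : Measurable (near ρ s) :=
  Measurable.ite measurableSet_Iio (by fun_prop) measurable_const

/-- A power with exponent at most `0` is antitone, so after capping the exponent a distance may be
replaced by a smaller one. For positive `s` the power is at most `1` because `ρ ≤ 1`. -/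
lemma near_le_near {ρ s t t' : ℝ} (hρ : ρ ≤ 1) (ht' : 0 < t') (h : t' ≤ t) :
    near ρ s t ≤ near ρ (min s 0) t' := by
  unfold near
  split_ifs with h1 h2 h2
  · rcases le_total s 0 with hs | hs
    · rw [min_eq_left hs]
      exact rpow_le_rpow_of_nonpos ht' h hs
    · rw [min_eq_right hs, rpow_zero]
      exact rpow_le_one (ht'.le.trans h) (h1.le.trans hρ) hs
  · exact absurd (h.trans_lt h1) h2
  · positivity
  · rfl

lemma rpow_le_add_rpow {l L x s : ℝ} (hl : 0 < l) (h1 : l ≤ x) (h2 : x ≤ L) :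
    x ^ s ≤ l ^ s + L ^ s := by
  have hL : 0 < L := hl.trans_le (h1.trans h2)
  rcases le_total s 0 with hs | hs
  · exact (rpow_le_rpow_of_nonpos hl h1 hs).trans (le_add_of_nonneg_right (by positivity))
  · exact (rpow_le_rpow (hl.le.trans h1) h2 hs).trans (le_add_of_nonneg_left (by positivity))

/-- The ratio `‖w - z‖ / (1 + ‖w‖)` lies between `ρ / (ρ + 1 + R)` and `1 + R`. The sum of the two
powers covers both signs of `s`, and the constant is uniform in `z`. -/
lemma rpow_norm_sub_le_of_le {ρ R : ℝ} (hρ : 0 < ρ) (hR : 0 ≤ R) (s : ℝ) :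
    ∃ C > 0, ∀ z w : ℂ, ‖z‖ ≤ R → ρ ≤ ‖w - z‖ → ‖w - z‖ ^ s ≤ C * (1 + ‖w‖) ^ s := by
  refine ⟨(ρ / (ρ + 1 + R)) ^ s + (1 + R) ^ s, by positivity, fun z w hz hw => ?_⟩
  have hN : 0 < 1 + ‖w‖ := by positivity
  have h1 : 1 + ‖w‖ ≤ 1 + R + ‖w - z‖ := by
    have := norm_le_norm_add_norm_sub' w z
    linarith
  have h2 : ‖w - z‖ ≤ (1 + R) * (1 + ‖w‖) := by
    have := norm_sub_le w z
    nlinarith [norm_nonneg w]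
  have e : ‖w - z‖ ^ s = (‖w - z‖ / (1 + ‖w‖)) ^ s * (1 + ‖w‖) ^ s := by
    rw [← mul_rpow (by positivity) hN.le, div_mul_cancel₀ _ hN.ne']
  rw [e]
  gcongr
  refine rpow_le_add_rpow (by positivity) ?_ ?_
  · rw [div_le_div_iff₀ (by positivity) hN]
    nlinarith
  · rwa [div_le_iff₀ hN]

lemma rpow_norm_sub_le_near {ρ R : ℝ} (hρ : 0 < ρ) (hR : 0 ≤ R) (s : ℝ) :
    ∃ C > 0, ∀ z w : ℂ, ‖z‖ ≤ R →
      ‖w - z‖ ^ s ≤ C * ((1 + ‖w‖) ^ s * (1 + near ρ s ‖w - z‖)) := by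
  obtain ⟨C, hC, h⟩ := rpow_norm_sub_le_of_le hρ hR s
  refine ⟨C + (1 + (1 + R + ρ) ^ (-s)), by positivity, fun z w hz => ?_⟩
  have hN : 0 < 1 + ‖w‖ := by positivity
  have hn := near_nonneg (ρ := ρ) (s := s) (norm_nonneg (w - z))
  rcases le_or_gt ρ ‖w - z‖ with hw | hw
  · calc ‖w - z‖ ^ s ≤ C * (1 + ‖w‖) ^ s := h z w hz hw
      _ ≤ (C + (1 + (1 + R + ρ) ^ (-s))) * ((1 + ‖w‖) ^ s * (1 + near ρ s ‖w - z‖)) := by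
        refine mul_le_mul (le_add_of_nonneg_right (by positivity)) ?_ (by positivity)
          (by positivity)
        exact le_mul_of_one_le_right (by positivity) (by linarith)
  · have h1 : 1 + ‖w‖ ≤ 1 + R + ρ := by
      have := norm_le_norm_add_norm_sub' w z
      linarith
    have h2 : 1 ≤ (C + (1 + (1 + R + ρ) ^ (-s))) * (1 + ‖w‖) ^ s := by
      have h3 : (1 + ‖w‖) ^ (-s) ≤ 1 + (1 + R + ρ) ^ (-s) := by
        simpa using rpow_le_add_rpow (s := -s) one_pos (le_add_of_nonneg_right (norm_nonneg w)) h1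
      calc 1 = (1 + ‖w‖) ^ (-s) * (1 + ‖w‖) ^ s := by
            rw [← rpow_add hN, neg_add_cancel, rpow_zero]
        _ ≤ _ := by gcongr; linarith
    have h4 : ‖w - z‖ ^ s ≤ 1 + near ρ s ‖w - z‖ := by
      rw [near, if_pos hw]; linarith
    rw [← mul_assoc]
    exact h4.trans (le_mul_of_one_le_left (by positivity) h2)

/-- A majorant of `|w| ^ a * |w - 1| ^ b * |w - z| ^ c`. -/
noncomputable def weight (ρ a b c : ℝ) (z w : ℂ) : ℝ :=
  (1 + ‖w‖) ^ (a + b + c) * (1 + near ρ a ‖w‖ + near ρ b ‖w - 1‖ + near ρ c ‖w - z‖)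

/-- The discs of radius `ρ` about `0`, `1` and `z` are disjoint, so at most one cut-off power is
nonzero and the product has no cross terms. -/
lemma prod_one_add_near_le {ρ a b c : ℝ} {z : ℂ} (h1 : 2 * ρ ≤ 1) (h2 : 2 * ρ ≤ ‖z‖)
    (h3 : 2 * ρ ≤ ‖z - 1‖) (w : ℂ) :
    (1 + near ρ a ‖w‖) * (1 + near ρ b ‖w - 1‖) * (1 + near ρ c ‖w - z‖) =
      1 + near ρ a ‖w‖ + near ρ b ‖w - 1‖ + near ρ c ‖w - z‖ := by
  have d1 : ¬ (‖w‖ < ρ ∧ ‖w - 1‖ < ρ) := fun h => by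
    have := norm_sub_le w (w - 1)
    simp only [sub_sub_cancel, norm_one] at this
    linarith
  have d2 : ¬ (‖w‖ < ρ ∧ ‖w - z‖ < ρ) := fun h => by
    have := norm_sub_le w (w - z)
    simp only [sub_sub_cancel] at this
    linarith
  have d3 : ¬ (‖w - 1‖ < ρ ∧ ‖w - z‖ < ρ) := fun h => by
    have := norm_sub_le (w - 1) (w - z)
    simp only [sub_sub_sub_cancel_left] at this
    linarith
  unfold near
  split_ifs <;> first | (exfalso; tauto) | ring

lemma exists_norm_prod_le_weight {ρ : ℝ} {z : ℂ} (hρ : 0 < ρ) (h1 : 2 * ρ ≤ 1) (h2 : 2 * ρ ≤ ‖z‖)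
    (h3 : 2 * ρ ≤ ‖z - 1‖) (a b c : ℝ) :
    ∃ C > 0, ∀ w : ℂ, ‖w‖ ^ a * ‖w - 1‖ ^ b * ‖w - z‖ ^ c ≤ C * weight ρ a b c z w := by
  obtain ⟨C₀, hC₀, H₀⟩ := rpow_norm_sub_le_near hρ le_rfl a
  obtain ⟨C₁, hC₁, H₁⟩ := rpow_norm_sub_le_near hρ zero_le_one b
  obtain ⟨C₂, hC₂, H₂⟩ := rpow_norm_sub_le_near hρ (norm_nonneg z) c
  refine ⟨C₀ * C₁ * C₂, by positivity, fun w => ?_⟩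
  have e0 := H₀ 0 w (by simp)
  have e1 := H₁ 1 w (by simp)
  have e2 := H₂ z w le_rfl
  rw [sub_zero] at e0
  have hN : 0 < 1 + ‖w‖ := by positivity
  have n0 := near_nonneg (ρ := ρ) (s := a) (norm_nonneg w)
  have n1 := near_nonneg (ρ := ρ) (s := b) (norm_nonneg (w - 1))
  have n2 := near_nonneg (ρ := ρ) (s := c) (norm_nonneg (w - z))
  calc ‖w‖ ^ a * ‖w - 1‖ ^ b * ‖w - z‖ ^ c
      ≤ (C₀ * ((1 + ‖w‖) ^ a * (1 + near ρ a ‖w‖))) * (C₁ * ((1 + ‖w‖) ^ b *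
        (1 + near ρ b ‖w - 1‖))) * (C₂ * ((1 + ‖w‖) ^ c * (1 + near ρ c ‖w - z‖))) := by
        gcongr
    _ = C₀ * C₁ * C₂ * weight ρ a b c z w := by
        rw [weight, ← prod_one_add_near_le h1 h2 h3, rpow_add hN, rpow_add hN]
        ring

lemma integrable_near {E : Type*} [NormedAddCommGroup E] [NormedSpace ℝ E] [FiniteDimensional ℝ E]
    [MeasurableSpace E] [BorelSpace E] (μ : Measure E) [μ.IsAddHaarMeasure]
    (hd : 1 ≤ Module.finrank ℝ E) {s : ℝ} (hs : -(Module.finrank ℝ E : ℝ) < s) (ρ : ℝ) (p : E) :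
    Integrable (fun x => near ρ s ‖x - p‖) μ := by
  have h : IntegrableOn (fun x : E => ‖x‖ ^ s) (Metric.ball 0 ρ) μ :=
    integrableOn_ball_of_norm_le_rpow hd (C := 1) (α := -s) (by linarith)
      (Eventually.of_forall fun x => by
        rw [neg_neg, one_mul, Real.norm_of_nonneg (by positivity)])
      (by fun_prop : Measurable fun x : E => ‖x‖ ^ s).aestronglyMeasurable
  have h' : Integrable (fun x : E => near ρ s ‖x‖) μ := by
    rw [← integrable_indicator_iff measurableSet_ball] at h
    refine h.congr (Eventually.of_forall fun x => ?_)
    by_cases hx : ‖x‖ < ρ <;> simp [near, indicator, hx]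
  exact h'.comp_sub_right p

lemma rpow_mul_le_self {N M x : ℝ} (hN : 1 ≤ N) (hM : M ≤ 0) (hx : 0 ≤ x) : N ^ M * x ≤ x :=
  mul_le_of_le_one_left hx (rpow_le_one_of_one_le_of_nonpos hN hM)

lemma measurable_weight (ρ a b c : ℝ) (z : ℂ) : Measurable (weight ρ a b c z) := by
  have := measurable_near ρ
  unfold weight
  fun_prop

lemma integrable_weight {a b c : ℝ} (ha : -2 < a) (hb : -2 < b) (hc : -2 < c)
    (habc : a + b + c < -2) (ρ : ℝ) (z : ℂ) : Integrable (weight ρ a b c z) := by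
  have hf : (Module.finrank ℝ ℂ : ℝ) = 2 := by rw [Complex.finrank_real_complex]; norm_num
  have hd : 1 ≤ Module.finrank ℝ ℂ := by rw [Complex.finrank_real_complex]; norm_num
  have i0 := integrable_near (volume : Measure ℂ) hd (s := a) (by linarith) ρ 0
  have i1 := integrable_near (volume : Measure ℂ) hd (s := b) (by linarith) ρ 1
  have i2 := integrable_near (volume : Measure ℂ) hd (s := c) (by linarith) ρ z
  have i3 := integrable_one_add_norm (E := ℂ) (μ := volume) (r := -(a + b + c)) (by linarith)
  rw [neg_neg] at i3
  refine (((i3.add i0).add i1).add i2).mono' (measurable_weight ρ a b c z).aestronglyMeasurable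
    (Eventually.of_forall fun w => ?_)
  have n0 := near_nonneg (ρ := ρ) (s := a) (norm_nonneg w)
  have n1 := near_nonneg (ρ := ρ) (s := b) (norm_nonneg (w - 1))
  have n2 := near_nonneg (ρ := ρ) (s := c) (norm_nonneg (w - z))
  have hN : 1 ≤ 1 + ‖w‖ := le_add_of_nonneg_right (norm_nonneg w)
  have hM : a + b + c ≤ 0 := by linarith
  rw [Real.norm_of_nonneg (by unfold weight; positivity), weight]
  simp only [Pi.add_apply, sub_zero, mul_add, mul_one]
  gcongr <;> exact rpow_mul_le_self hN hM ‹_›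

/-- A majorant of `weight` that depends only on the absolute value of the variable. -/
noncomputable def radial (ρ R a b c r : ℝ) : ℝ :=
  (1 + r) ^ (a + b + c) *
    (1 + near ρ a r + near ρ (min b 0) |r - 1| + near ρ (min c 0) |r - R|)

lemma radial_nonneg {ρ R a b c r : ℝ} (hr : 0 ≤ r) : 0 ≤ radial ρ R a b c r := by
  have n0 := near_nonneg (ρ := ρ) (s := a) hr
  have n1 := near_nonneg (ρ := ρ) (s := min b 0) (abs_nonneg (r - 1))
  have n2 := near_nonneg (ρ := ρ) (s := min c 0) (abs_nonneg (r - R))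
  unfold radial
  positivity

/-- By the reverse triangle inequality the distance to a branch point is at least the distance of
the moduli. The excluded circles pass through the branch points; on them the latter distance is `0`,
and a negative real power of `0` is `0` by convention. -/
lemma weight_le_radial {ρ a b c : ℝ} {z w : ℂ} (hρ : ρ ≤ 1) (h1 : ‖w‖ ≠ 1) (hz : ‖w‖ ≠ ‖z‖) :
    weight ρ a b c z w ≤ radial ρ ‖z‖ a b c ‖w‖ := by
  unfold weight radial
  have e1 : near ρ b ‖w - 1‖ ≤ near ρ (min b 0) |‖w‖ - 1| :=
    near_le_near hρ (abs_pos.2 (sub_ne_zero.2 h1)) (by simpa using abs_norm_sub_norm_le w 1)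
  have e2 : near ρ c ‖w - z‖ ≤ near ρ (min c 0) |‖w‖ - ‖z‖| :=
    near_le_near hρ (abs_pos.2 (sub_ne_zero.2 hz)) (abs_norm_sub_norm_le w z)
  gcongr

lemma measurable_radial (ρ R a b c : ℝ) : Measurable (radial ρ R a b c) := by
  have := measurable_near ρ
  unfold radial
  fun_prop

/-- The factor `min 1 (r ^ σ)` raises the exponent at the origin from `a` to `a + σ`. It allows `a ≤
-1`, which is needed for the evaluation at `z = 1`. -/
lemma integrableOn_radial {a b c σ : ℝ} (ha : -1 < a + σ) (hb : -1 < b)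
    (hc : -1 < c) (habc : a + b + c < -1) (ρ R : ℝ) :
    IntegrableOn (fun r => min 1 (r ^ σ) * radial ρ R a b c r) (Ioi 0) := by
  have hf : (Module.finrank ℝ ℝ : ℝ) = 1 := by simp
  have hd : 1 ≤ Module.finrank ℝ ℝ := by simp
  have i0 := integrable_near (volume : Measure ℝ) hd (s := a + σ) (by linarith) ρ 0
  have i1 := integrable_near (volume : Measure ℝ) hd (s := min b 0)
    (by rw [hf]; exact lt_min hb (by norm_num)) ρ 1
  have i2 := integrable_near (volume : Measure ℝ) hd (s := min c 0)
    (by rw [hf]; exact lt_min hc (by norm_num)) ρ R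
  have i3 : IntegrableOn (fun r : ℝ => (1 + r) ^ (a + b + c)) (Ioi 0) := by
    simpa [add_comm] using integrableOn_add_rpow_Ioi_of_lt habc (m := 1) (c := 0) (by norm_num)
  refine (((i3.add i0.integrableOn).add i1.integrableOn).add i2.integrableOn).mono'
    (Measurable.aestronglyMeasurable (by have := measurable_radial ρ R a b c; fun_prop)) ?_
  filter_upwards [ae_restrict_mem measurableSet_Ioi] with r hr
  have hr : 0 < r := hr
  have n0 := near_nonneg (ρ := ρ) (s := a) hr.le
  have n1 := near_nonneg (ρ := ρ) (s := min b 0) (abs_nonneg (r - 1))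
  have n2 := near_nonneg (ρ := ρ) (s := min c 0) (abs_nonneg (r - R))
  have hN : 1 ≤ 1 + r := le_add_of_nonneg_right hr.le
  have hM : a + b + c ≤ 0 := by linarith
  have hm : 0 ≤ min 1 (r ^ σ) := le_min zero_le_one (by positivity)
  have hm1 : min 1 (r ^ σ) ≤ 1 := min_le_left _ _
  have e0 : min 1 (r ^ σ) * near ρ a r ≤ near ρ (a + σ) r := by
    unfold near
    split_ifs
    · rw [add_comm, rpow_add hr]
      gcongr
      exact min_le_right _ _
    · simp
  have f := fun {x : ℝ} (hx : 0 ≤ x) => rpow_mul_le_self hN hM hx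
  rw [Real.norm_of_nonneg (mul_nonneg hm (radial_nonneg hr.le)), radial]
  simp only [Pi.add_apply, sub_zero, Real.norm_eq_abs, abs_of_pos hr]
  have g0 : (1 + r) ^ (a + b + c) * (min 1 (r ^ σ) * near ρ a r) ≤ near ρ (a + σ) r :=
    (f (by positivity)).trans e0
  have g1 := (f (mul_nonneg hm n1)).trans (mul_le_of_le_one_left n1 hm1)
  have g2 := (f (mul_nonneg hm n2)).trans (mul_le_of_le_one_left n2 hm1)
  have g3 : min 1 (r ^ σ) * (1 + r) ^ (a + b + c) ≤ (1 + r) ^ (a + b + c) :=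
    mul_le_of_le_one_left (by positivity) hm1
  calc _ = min 1 (r ^ σ) * (1 + r) ^ (a + b + c) +
        (1 + r) ^ (a + b + c) * (min 1 (r ^ σ) * near ρ a r) +
        (1 + r) ^ (a + b + c) * (min 1 (r ^ σ) * near ρ (min b 0) |r - 1|) +
        (1 + r) ^ (a + b + c) * (min 1 (r ^ σ) * near ρ (min c 0) |r - R|) := by ring
    _ ≤ _ := by gcongr

lemma integrable_comp_exp_iff {E : Type*} [NormedAddCommGroup E] [NormedSpace ℝ E] (g : ℝ → E) :
    Integrable (fun x => rexp x • g (rexp x)) ↔ IntegrableOn g (Ioi 0) := by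
  have := integrableOn_image_iff_integrableOn_abs_deriv_smul MeasurableSet.univ
    (fun x _ => (Real.hasDerivAt_exp x).hasDerivWithinAt)
    (fun x _ y _ hxy => exp_injective hxy) g
  rw [image_univ, Real.range_exp, integrableOn_univ] at this
  simpa [abs_of_pos (exp_pos _)] using this.symm

/-- For large `r` all cut-off powers vanish and `r ^ (1 + a + b + c)` is a bound. Pointwise decay,
not only integrability, is what removes the vertical sides of the rectangles. -/
lemma tendsto_radial_atTop {a b c σ : ℝ} (habc : a + b + c < -1) (ρ R : ℝ) :
    Tendsto (fun x => rexp x * (min 1 (rexp x ^ σ) * radial ρ R a b c (rexp x))) atTop (𝓝 0) := by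
  have hlim : Tendsto (fun x => rexp x ^ (1 + (a + b + c))) atTop (𝓝 0) := by
    simp only [← exp_mul]
    exact tendsto_exp_atBot.comp (tendsto_id.atTop_mul_const_of_neg (by linarith))
  refine squeeze_zero' (Eventually.of_forall fun x => ?_) ?_ hlim
  · exact mul_nonneg (exp_pos x).le (mul_nonneg (le_min zero_le_one (by positivity))
      (radial_nonneg (exp_pos x).le))
  · filter_upwards [tendsto_exp_atTop.eventually_ge_atTop (|ρ| + 1 + |R|)] with x hx
    have hr := exp_pos x
    set r := rexp x
    have hρ := le_abs_self ρ
    have hR := le_abs_self R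
    have k1 : near ρ a r = 0 := if_neg (by linarith [abs_nonneg R])
    have k2 : near ρ (min b 0) |r - 1| = 0 :=
      if_neg (by linarith [abs_nonneg R, le_abs_self (r - 1)])
    have k3 : near ρ (min c 0) |r - R| = 0 := if_neg (by linarith [le_abs_self (r - R)])
    rw [radial, k1, k2, k3, rpow_add hr, rpow_one]
    simp only [add_zero, mul_one]
    gcongr
    calc min 1 (r ^ σ) * (1 + r) ^ (a + b + c) ≤ 1 * (1 + r) ^ (a + b + c) := by
          gcongr; exact min_le_left _ _
      _ = (1 + r) ^ (a + b + c) := one_mul _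
      _ ≤ r ^ (a + b + c) := rpow_le_rpow_of_nonpos hr (by linarith) (by linarith)

lemma tendsto_radial_atBot {a b c σ ρ R : ℝ} (hσ : 0 ≤ σ) (ha : -1 < a + σ)
    (habc : a + b + c < -1) (hρ : 0 < ρ) (h1 : 2 * ρ ≤ 1) (h2 : 2 * ρ ≤ R) :
    Tendsto (fun x => rexp x * (min 1 (rexp x ^ σ) * radial ρ R a b c (rexp x))) atBot (𝓝 0) := by
  have hlim : ∀ t : ℝ, 0 < t → Tendsto (fun x => rexp x ^ t) atBot (𝓝 0) := by
    intro t ht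
    simp only [← exp_mul]
    exact tendsto_exp_atBot.comp (tendsto_id.atBot_mul_const ht)
  have hlim2 : Tendsto (fun x => rexp x ^ (1 + σ) + rexp x ^ (1 + σ + a)) atBot (𝓝 0) := by
    simpa using (hlim (1 + σ) (by linarith)).add (hlim (1 + σ + a) (by linarith))
  refine squeeze_zero' (Eventually.of_forall fun x => ?_) ?_ hlim2
  · exact mul_nonneg (exp_pos x).le (mul_nonneg (le_min zero_le_one (by positivity))
      (radial_nonneg (exp_pos x).le))
  · filter_upwards [tendsto_exp_atBot.eventually (Iio_mem_nhds hρ)] with x hx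
    have hr := exp_pos x
    have hx : rexp x < ρ := hx
    set r := rexp x
    have k1 : near ρ a r = r ^ a := if_pos hx
    have k2 : near ρ (min b 0) |r - 1| = 0 := if_neg (by linarith [neg_le_abs (r - 1)])
    have k3 : near ρ (min c 0) |r - R| = 0 := if_neg (by linarith [neg_le_abs (r - R)])
    rw [radial, k1, k2, k3, rpow_add hr _ a, rpow_add hr, rpow_one]
    simp only [add_zero]
    calc r * (min 1 (r ^ σ) * ((1 + r) ^ (a + b + c) * (1 + r ^ a)))
        ≤ r * (r ^ σ * (1 + r ^ a)) := by
          gcongr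
          · exact min_le_right _ _
          · exact rpow_mul_le_self (by linarith) (by linarith) (by positivity)
      _ = r * r ^ σ + r * r ^ σ * r ^ a := by ring

lemma exists_radius {z : ℂ} (h0 : z ≠ 0) (h1 : z ≠ 1) :
    ∃ ρ > 0, 2 * ρ ≤ 1 ∧ 2 * ρ ≤ ‖z‖ ∧ 2 * ρ ≤ ‖z - 1‖ := by
  refine ⟨min 1 (min ‖z‖ ‖z - 1‖) / 2, ?_, ?_, ?_, ?_⟩
  · have := norm_pos_iff.2 h0
    have := norm_pos_iff.2 (sub_ne_zero.2 h1)
    positivity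
  all_goals rw [mul_div_cancel₀ _ two_ne_zero]
  · exact min_le_left _ _
  · exact (min_le_right _ _).trans (min_le_left _ _)
  · exact (min_le_right _ _).trans (min_le_right _ _)

/-! ### The exponential coordinate -/

lemma det_mul_left (w : ℂ) :
    ((ContinuousLinearMap.toSpanSingleton ℂ w).restrictScalars ℝ : ℂ →L[ℝ] ℂ).det = ‖w‖ ^ 2 := by
  simp [ContinuousLinearMap.det, LinearMap.det_restrictScalars, Algebra.norm_complex_apply,
    Complex.normSq_eq_norm_sq]

lemma ae_im_ne_zero : ∀ᵐ w : ℂ, w.im ≠ 0 := by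
  have h : volume ((LinearMap.ker Complex.imLm : Submodule ℝ ℂ) : Set ℂ) = 0 := by
    refine Measure.addHaar_submodule _ _ fun h => ?_
    have : Complex.I ∈ LinearMap.ker Complex.imLm := h ▸ Submodule.mem_top
    simp at this
  rw [ae_iff]
  convert h using 2
  ext w
  simp

/-- The exponential maps the strip bijectively onto the slit plane, whose complement is a null set,
with Jacobian `‖exp ζ‖ ^ 2`. -/
lemma exp_change_of_variables {f : ℂ → ℂ} (hf : Integrable f) :
    Integrable (fun q : ℝ × ℝ => ((rexp q.1 ^ 2 : ℝ) : ℂ) * f (Complex.exp (q.1 + q.2 * Complex.I)))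
      (volume.prod (volume.restrict (Ioo (-π) π))) ∧
    ∫ w, f w = ∫ y in Ioo (-π) π, ∫ x : ℝ,
      ((rexp x ^ 2 : ℝ) : ℂ) * f (Complex.exp (x + y * Complex.I)) := by
  set S : Set ℂ := Complex.im ⁻¹' Ioo (-π) π with hS
  have hs : MeasurableSet S := measurableSet_Ioo.preimage Complex.measurable_im
  have hder : ∀ ζ ∈ S, HasFDerivWithinAt Complex.exp
      ((ContinuousLinearMap.toSpanSingleton ℂ (Complex.exp ζ)).restrictScalars ℝ) S ζ := fun ζ _ =>
    ((Complex.hasDerivAt_exp ζ).hasFDerivAt.restrictScalars ℝ).hasFDerivWithinAt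
  have hinj : InjOn Complex.exp S := Complex.expOpenPartialHomeomorph.injOn
  have himage : Complex.exp '' S = Complex.slitPlane :=
    Complex.expOpenPartialHomeomorph.image_source_eq_target
  have hae : (Complex.slitPlane : Set ℂ) =ᵐ[volume] univ := by
    rw [eventuallyEq_univ]
    exact ae_im_ne_zero.mono fun w hw => Or.inr hw
  have hi := integrableOn_image_iff_integrableOn_abs_det_fderiv_smul volume hs hder hinj f
  have he := integral_image_eq_integral_abs_det_fderiv_smul volume hs hder hinj f
  rw [himage] at hi he
  rw [setIntegral_congr_set hae, setIntegral_univ] at he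
  have hi' := hi.1 hf.integrableOn
  simp only [det_mul_left, abs_pow, abs_norm] at hi' he
  set g : ℂ → ℂ := fun ζ => ‖Complex.exp ζ‖ ^ 2 • f (Complex.exp ζ) with hg
  have hmp := Complex.volume_preserving_equiv_real_prod
  have hpre : S = Complex.measurableEquivRealProd ⁻¹' (univ ×ˢ Ioo (-π) π) := by
    ext ζ; simp [hS, Complex.measurableEquivRealProd_apply]
  have hrestr : MeasurePreserving Complex.measurableEquivRealProd (volume.restrict S)
      (volume.prod (volume.restrict (Ioo (-π) π))) := by
    have := hmp.restrict_preimage (s := univ ×ˢ Ioo (-π) π)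
      (MeasurableSet.univ.prod measurableSet_Ioo)
    rw [← hpre, Measure.volume_eq_prod, ← Measure.prod_restrict, Measure.restrict_univ] at this
    exact this
  set G : ℝ × ℝ → ℂ := fun q =>
    ((rexp q.1 ^ 2 : ℝ) : ℂ) * f (Complex.exp (q.1 + q.2 * Complex.I)) with hG
  have hGg : ∀ ζ, G (Complex.measurableEquivRealProd ζ) = g ζ := by
    intro ζ
    simp only [hG, hg, Complex.measurableEquivRealProd_apply, Complex.re_add_im,
      Complex.norm_exp, Complex.real_smul]
  have hme := Complex.measurableEquivRealProd.measurableEmbedding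
  have hGi : Integrable G (volume.prod (volume.restrict (Ioo (-π) π))) := by
    rw [← hrestr.integrable_comp_emb hme]
    exact hi'.congr (Eventually.of_forall fun ζ => (hGg ζ).symm)
  refine ⟨hGi, ?_⟩
  rw [he]
  have := hrestr.integral_comp hme G
  simp only [hGg] at this
  rw [this, integral_prod_symm _ hGi]

/-! ### Single-valued powers and convergence of the correlator -/

/-- Since `w ^ A * conj (w ^ A)` is the modulus factor, the integer powers can be absorbed into the
two principal powers. This splits the integrand into a holomorphic and an antiholomorphic factor. -/
lemma powPair_eq_cpow {A : ℝ} {k k' : ℤ} {w : ℂ} (hw : w ≠ 0) :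
    powPair A k k' w =
      w ^ (((A + k : ℝ)) : ℂ) * conj (w ^ (((A + k' : ℝ)) : ℂ)) := by
  have e : w ^ (A : ℂ) * conj (w ^ (A : ℂ)) = ((‖w‖ ^ (2 * A) : ℝ) : ℂ) := by
    rw [Complex.mul_conj', Complex.norm_cpow_real, two_mul, rpow_add (norm_pos_iff.2 hw)]
    push_cast
    ring
  rw [powPair, Complex.ofReal_add, Complex.ofReal_add, Complex.cpow_add _ _ hw,
    Complex.cpow_add _ _ hw, map_mul, ← e]
  simp only [Complex.ofReal_intCast, Complex.cpow_intCast, map_zpow₀]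
  ring

lemma powPair_mul (A : ℝ) (k k' : ℤ) (v w : ℂ) :
    powPair A k k' (v * w) = powPair A k k' v * powPair A k k' w := by
  simp only [powPair, norm_mul, map_mul, mul_zpow, mul_rpow (norm_nonneg v) (norm_nonneg w),
    Complex.ofReal_mul]
  ring

lemma powPair_neg_one (A : ℝ) (k k' : ℤ) : powPair A k k' (-1) = (-1) ^ (k - k') := by
  simp only [powPair, norm_neg, norm_one, one_rpow, Complex.ofReal_one, one_mul, map_neg, map_one]
  rw [zpow_sub₀ (by norm_num), div_eq_mul_inv, ← _root_.inv_zpow]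
  norm_num

lemma powPair_neg (A : ℝ) (k k' : ℤ) (w : ℂ) :
    powPair A k k' (-w) = (-1) ^ (k - k') * powPair A k k' w := by
  rw [← powPair_neg_one A, ← powPair_mul, neg_one_mul]

lemma powPair_exp (A : ℝ) (k k' : ℤ) (ζ : ℂ) :
    powPair A k k' (Complex.exp ζ) =
      Complex.exp ((A + k : ℝ) * ζ) * conj (Complex.exp ((A + k' : ℝ) * ζ)) := by
  rw [powPair, ← Complex.exp_conj, ← Complex.exp_conj, Complex.norm_exp, ← exp_mul,
    Complex.ofReal_exp, ← Complex.exp_int_mul, ← Complex.exp_int_mul, ← Complex.exp_add,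
    ← Complex.exp_add, ← Complex.exp_add]
  congr 1
  have : ((ζ.re * (2 * A) : ℝ) : ℂ) = A * (ζ + conj ζ) := by
    rw [Complex.add_conj]; push_cast; ring
  rw [this]
  simp only [map_mul, Complex.conj_ofReal]
  push_cast
  ring

lemma norm_powPair {A : ℝ} {k k' : ℤ} {w : ℂ} (hw : w ≠ 0) :
    ‖powPair A k k' w‖ = ‖w‖ ^ ((A + k) + (A + k')) := by
  rw [powPair_eq_cpow hw, norm_mul, RCLike.norm_conj, Complex.norm_cpow_real,
    Complex.norm_cpow_real, ← rpow_add (norm_pos_iff.2 hw)]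

lemma measurable_powPair (A : ℝ) (k k' : ℤ) : Measurable (powPair A k k') := by
  unfold powPair
  have : Measurable fun w : ℂ => conj w := Complex.continuous_conj.measurable
  exact ((Complex.measurable_ofReal.comp (by fun_prop)).mul (measurable_id.pow_const k)).mul
    (this.pow_const k')

lemma measurable_correlatorIntegrand (A B C : ℝ) (n n' m m' p p' : ℤ) (z : ℂ) :
    Measurable (correlatorIntegrand A B C n n' m m' p p' z) := by
  unfold correlatorIntegrand
  exact ((measurable_powPair _ _ _).mul ((measurable_powPair _ _ _).comp (by fun_prop))).mul
    ((measurable_powPair _ _ _).comp (by fun_prop))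

lemma integrable_correlatorIntegrand {A B C : ℝ} {n n' m m' p p' : ℤ} {z : ℂ} (h0 : z ≠ 0)
    (h1 : z ≠ 1) (ha : -2 < (A + n) + (A + n')) (hb : -2 < (B + m) + (B + m'))
    (hc : -2 < (C + p) + (C + p'))
    (habc : (A + n) + (A + n') + ((B + m) + (B + m')) + ((C + p) + (C + p')) < -2) :
    Integrable (correlatorIntegrand A B C n n' m m' p p' z) := by
  obtain ⟨ρ, hρ, h2, h3, h4⟩ := exists_radius h0 h1
  obtain ⟨K, -, hK⟩ := exists_norm_prod_le_weight hρ h2 h3 h4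
    ((A + n) + (A + n')) ((B + m) + (B + m')) ((C + p) + (C + p'))
  refine ((integrable_weight ha hb hc habc ρ z).const_mul K).mono'
    (measurable_correlatorIntegrand ..).aestronglyMeasurable ?_
  filter_upwards [compl_mem_ae_iff.2 (measure_singleton (μ := (volume : Measure ℂ)) 0),
    compl_mem_ae_iff.2 (measure_singleton (μ := (volume : Measure ℂ)) 1),
    compl_mem_ae_iff.2 (measure_singleton (μ := (volume : Measure ℂ)) z)] with w hw0 hw1 hwz
  rw [correlatorIntegrand, norm_mul, norm_mul, norm_powPair hw0, norm_powPair (sub_ne_zero.2 hw1),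
    norm_powPair (sub_ne_zero.2 hwz)]
  exact hK w

/-! ### The multivalued form in the logarithmic coordinate -/

/-- The multivalued integrand `ω ^ a * (1 + ω) ^ b * (1 + ω / z) ^ c dω` in the coordinate
`ω = exp ζ`. -/
noncomputable def logIntegrand (a b c : ℝ) (z ζ : ℂ) : ℂ :=
  Complex.exp ((a + 1 : ℝ) * ζ) * (1 + Complex.exp ζ) ^ (b : ℂ) *
    (1 + Complex.exp ζ / z) ^ (c : ℂ)

lemma one_add_exp_mem_slitPlane {ζ : ℂ} (h : ζ.im ∈ Ioo (-π) π) :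
    1 + Complex.exp ζ ∈ Complex.slitPlane := by
  rcases eq_or_ne ζ.im 0 with h0 | h0
  · left
    rw [Complex.add_re, Complex.one_re, Complex.exp_re, h0, Real.cos_zero, mul_one]
    positivity
  · right
    rw [Complex.add_im, Complex.one_im, zero_add, Complex.exp_im]
    refine mul_ne_zero (Real.exp_pos _).ne' ?_
    rcases h0.lt_or_gt with h1 | h1
    · exact (Real.sin_neg_of_neg_of_neg_pi_lt h1 h.1).ne
    · exact (Real.sin_pos_of_pos_of_lt_pi h1 h.2).ne'

lemma exp_sub_log_neg {z : ℂ} (hz : z ≠ 0) (ζ : ℂ) :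
    Complex.exp (ζ - Complex.log (-z)) = -(Complex.exp ζ / z) := by
  rw [Complex.exp_sub, Complex.exp_log (neg_ne_zero.2 hz), div_neg]

lemma exp_div_eq_add {z : ℂ} (hz : z ≠ 0) (ζ : ℂ) :
    Complex.exp ζ / z = Complex.exp (ζ - Complex.log (-z) + π * Complex.I) := by
  rw [Complex.exp_add, Complex.exp_pi_mul_I, exp_sub_log_neg hz]; ring

lemma exp_div_eq_sub {z : ℂ} (hz : z ≠ 0) (ζ : ℂ) :
    Complex.exp ζ / z = Complex.exp (ζ - Complex.log (-z) - π * Complex.I) := by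
  rw [Complex.exp_sub, Complex.exp_pi_mul_I, exp_sub_log_neg hz]; ring

/-- Translation by `-log (-z)` followed by `+πi` below the line `Im ζ = arg (-z)`, or `-πi` above
it, moves `ζ` into the basic strip and reduces the claim to `1 + exp`. -/
lemma one_add_exp_div_mem_slitPlane {z ζ : ℂ} (hz : z ≠ 0)
    (h : ζ.im ∈ Ioo (-π) (-z).arg ∨ ζ.im ∈ Ioo (-z).arg π) (hψ : (-z).arg < π) :
    1 + Complex.exp ζ / z ∈ Complex.slitPlane := by
  have hψ' := Complex.neg_pi_lt_arg (-z)
  rcases h with h | h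
  · rw [exp_div_eq_add hz]
    refine one_add_exp_mem_slitPlane ?_
    simp only [Complex.add_im, Complex.sub_im, Complex.log_im, Complex.mul_im, Complex.ofReal_re,
      Complex.I_im, Complex.ofReal_im, Complex.I_re, mul_one, mul_zero, add_zero]
    constructor <;> linarith [h.1, h.2]
  · rw [exp_div_eq_sub hz]
    refine one_add_exp_mem_slitPlane ?_
    simp only [Complex.sub_im, Complex.log_im, Complex.mul_im, Complex.ofReal_re,
      Complex.I_im, Complex.ofReal_im, Complex.I_re, mul_one, mul_zero, add_zero]
    constructor <;> linarith [h.1, h.2]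

lemma differentiableAt_logIntegrand {a b c : ℝ} {z ζ : ℂ}
    (h1 : 1 + Complex.exp ζ ∈ Complex.slitPlane) (h2 : 1 + Complex.exp ζ / z ∈ Complex.slitPlane) :
    DifferentiableAt ℂ (logIntegrand a b c z) ζ := by
  unfold logIntegrand
  have d1 : DifferentiableAt ℂ (fun ζ => 1 + Complex.exp ζ) ζ := by fun_prop
  have d2 : DifferentiableAt ℂ (fun ζ => 1 + Complex.exp ζ / z) ζ := by fun_prop
  exact (DifferentiableAt.mul (by fun_prop) (d1.cpow_const h1)).mul (d2.cpow_const h2)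

lemma norm_logIntegrand {a b c : ℝ} {z : ℂ} (hz : z ≠ 0) (ζ : ℂ) :
    ‖logIntegrand a b c z ζ‖ = rexp ζ.re * (‖-Complex.exp ζ‖ ^ a * ‖-Complex.exp ζ - 1‖ ^ b *
      ‖-Complex.exp ζ - z‖ ^ c) * ‖z‖ ^ (-c) := by
  have e1 : -Complex.exp ζ - 1 = -(1 + Complex.exp ζ) := by ring
  have e2 : 1 + Complex.exp ζ / z = -(-Complex.exp ζ - z) / z := by field_simp; ring
  rw [logIntegrand, norm_mul, norm_mul, Complex.norm_cpow_real, Complex.norm_cpow_real,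
    Complex.norm_exp, e1, norm_neg, norm_neg, e2, norm_div, norm_neg,
    div_rpow (norm_nonneg _) (norm_nonneg _), rpow_neg (norm_nonneg _), Complex.norm_exp,
    ← exp_mul, Complex.re_ofReal_mul, add_mul, add_comm, one_mul, Real.exp_add, mul_comm a]
  ring

/-- The majorant of `logIntegrand` on horizontal lines, damped by `min 1 (exp (σ x))`. -/
noncomputable def logBound (ρ R a b c σ x : ℝ) : ℝ :=
  rexp x * (min 1 (rexp x ^ σ) * radial ρ R a b c (rexp x))

lemma integrable_logBound {a b c σ : ℝ} (ha : -1 < a + σ) (hb : -1 < b)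
    (hc : -1 < c) (habc : a + b + c < -1) (ρ R : ℝ) : Integrable (logBound ρ R a b c σ) :=
  (integrable_comp_exp_iff _).2 (integrableOn_radial ha hb hc habc ρ R)

lemma tendsto_logBound_atTop {a b c : ℝ} (habc : a + b + c < -1) (ρ R σ : ℝ) :
    Tendsto (logBound ρ R a b c σ) atTop (𝓝 0) :=
  tendsto_radial_atTop habc ρ R

lemma tendsto_logBound_atBot {a b c σ ρ R : ℝ} (hσ : 0 ≤ σ) (ha : -1 < a + σ)
    (habc : a + b + c < -1) (hρ : 0 < ρ) (h1 : 2 * ρ ≤ 1) (h2 : 2 * ρ ≤ R) :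
    Tendsto (logBound ρ R a b c σ) atBot (𝓝 0) :=
  tendsto_radial_atBot hσ ha habc hρ h1 h2

lemma min_mul_logBound_zero (ρ R a b c σ x : ℝ) :
    min 1 (rexp x ^ σ) * logBound ρ R a b c 0 x = logBound ρ R a b c σ x := by
  simp only [logBound, rpow_zero, min_self]
  ring

lemma exists_norm_logIntegrand_le {ρ : ℝ} {z : ℂ} (hρ : 0 < ρ) (h1 : 2 * ρ ≤ 1)
    (h2 : 2 * ρ ≤ ‖z‖) (h3 : 2 * ρ ≤ ‖z - 1‖) (a b c : ℝ) :
    ∃ C > 0, ∀ x ∉ ({0, Real.log ‖z‖} : Set ℝ), ∀ y : ℝ,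
      ‖logIntegrand a b c z (x + y * Complex.I)‖ ≤ C * logBound ρ ‖z‖ a b c 0 x := by
  have hz : 0 < ‖z‖ := by linarith
  obtain ⟨C, hC, H⟩ := exists_norm_prod_le_weight hρ h1 h2 h3 a b c
  refine ⟨C * ‖z‖ ^ (-c), by positivity, fun x hx y => ?_⟩
  simp only [mem_insert_iff, mem_singleton_iff, not_or] at hx
  have hre : ((x : ℂ) + y * Complex.I).re = x := by simp
  have hn : ‖-Complex.exp ((x : ℂ) + y * Complex.I)‖ = rexp x := by
    rw [norm_neg, Complex.norm_exp, hre]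
  rw [norm_logIntegrand (norm_pos_iff.1 hz), hre]
  have hw := (H (-Complex.exp ((x : ℂ) + y * Complex.I))).trans
    (mul_le_mul_of_nonneg_left (weight_le_radial (by linarith)
      (by rw [hn]; exact fun h => hx.1 (by simpa using h))
      (by rw [hn]; exact fun h => hx.2 (by rw [← h, Real.log_exp]))) hC.le)
  rw [hn] at hw ⊢
  calc _ ≤ rexp x * (C * radial ρ ‖z‖ a b c (rexp x)) * ‖z‖ ^ (-c) := by gcongr
    _ = _ := by simp only [logBound, rpow_zero, min_self]; ring

/-! ### Boundary values and jumps on the cuts -/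

/-- The modulus of `(1 - exp x) ^ s`, with the phase `p` beyond the branch point `x = 0`. -/
noncomputable def edge (s : ℝ) (p : ℂ) (x : ℝ) : ℂ :=
  (if x < 0 then 1 else p) * ((|1 - rexp x| ^ s : ℝ) : ℂ)

lemma one_add_exp_line (x y : ℝ) : 1 + Complex.exp (x + y * Complex.I) =
    ⟨1 + rexp x * Real.cos y, rexp x * Real.sin y⟩ := by
  apply Complex.ext <;> simp [Complex.exp_re, Complex.exp_im]

lemma tendsto_one_add_exp {θ : ℝ} (hθ : Real.cos θ = -1) (x : ℝ) (l : Filter ℝ) (hl : l ≤ 𝓝 θ) :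
    Tendsto (fun y : ℝ => 1 + Complex.exp (x + y * Complex.I)) l (𝓝 ((1 - rexp x : ℝ) : ℂ)) := by
  have h : Continuous fun y : ℝ => 1 + Complex.exp (x + y * Complex.I) := by fun_prop
  have h2 := (h.tendsto θ).mono_left hl
  have hs : Real.sin θ = 0 := by
    have := Real.sin_sq_add_cos_sq θ
    rw [hθ] at this
    exact pow_eq_zero_iff two_ne_zero |>.1 (by linarith)
  rw [one_add_exp_line, hθ, hs] at h2
  convert h2 using 2
  apply Complex.ext
  · rw [Complex.ofReal_re]; ring
  · rw [Complex.ofReal_im]; ring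

lemma tendsto_cpow_edge_of_neg {θ : ℝ} (hθ : Real.cos θ = -1) {x : ℝ} (hx : x < 0) (s : ℝ) (p : ℂ)
    (l : Filter ℝ) (hl : l ≤ 𝓝 θ) :
    Tendsto (fun y : ℝ => (1 + Complex.exp (x + y * Complex.I)) ^ (s : ℂ)) l (𝓝 (edge s p x)) := by
  have h1 : 0 < 1 - rexp x := by simpa using hx
  have : edge s p x = ((1 - rexp x : ℝ) : ℂ) ^ (s : ℂ) := by
    rw [edge, if_pos hx, one_mul, abs_of_pos h1, Complex.ofReal_cpow h1.le]
  rw [this]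
  exact (tendsto_one_add_exp hθ x l hl).cpow tendsto_const_nhds
    (Complex.ofReal_mem_slitPlane.2 h1)

lemma cpow_edge_of_pos {x : ℝ} (hx : 0 < x) (s : ℝ) (t : ℂ) :
    Complex.exp ((Real.log ‖((1 - rexp x : ℝ) : ℂ)‖ + t) * s) =
      edge s (Complex.exp (t * s)) x := by
  have h1 : 0 < |1 - rexp x| := abs_pos.2 (sub_ne_zero.2 (Real.one_lt_exp_iff.2 hx).ne)
  rw [edge, if_neg hx.not_gt, add_mul, Complex.exp_add, mul_comm, Complex.norm_real,
    Real.norm_eq_abs, Real.rpow_def_of_pos h1]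
  push_cast
  rfl

/-- Beyond the branch point, `1 + exp (x + iy)` reaches the negative axis from above as `y`
increases to `π`, so its logarithm tends to `log |1 - exp x| + πi`. -/
lemma tendsto_cpow_edge_pi {x : ℝ} (hx : x ≠ 0) (s : ℝ) :
    Tendsto (fun y : ℝ => (1 + Complex.exp (x + y * Complex.I)) ^ (s : ℂ)) (𝓝[<] π)
      (𝓝 (edge s (Complex.exp (π * Complex.I * s)) x)) := by
  rcases hx.lt_or_gt with hx | hx
  · exact tendsto_cpow_edge_of_neg Real.cos_pi hx s _ _ nhdsWithin_le_nhds
  · have hre : (((1 - rexp x : ℝ) : ℂ)).re < 0 := by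
      rw [Complex.ofReal_re]; linarith [Real.one_lt_exp_iff.2 hx]
    have him : (((1 - rexp x : ℝ) : ℂ)).im = 0 := Complex.ofReal_im _
    have h1 : Tendsto (fun y : ℝ => 1 + Complex.exp (x + y * Complex.I)) (𝓝[<] π)
        (𝓝[{z : ℂ | 0 ≤ z.im}] ((1 - rexp x : ℝ) : ℂ)) := by
      refine tendsto_nhdsWithin_iff.2
        ⟨tendsto_one_add_exp Real.cos_pi x _ nhdsWithin_le_nhds, ?_⟩
      filter_upwards [Ioo_mem_nhdsLT Real.pi_pos] with y hy
      rw [one_add_exp_line]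
      exact mul_nonneg (exp_pos x).le (Real.sin_pos_of_pos_of_lt_pi hy.1 hy.2).le
    have h2 := (Complex.tendsto_log_nhdsWithin_im_nonneg_of_re_neg_of_im_zero hre him).comp h1
    rw [← cpow_edge_of_pos hx]
    refine ((Complex.continuous_exp.tendsto _).comp (h2.mul_const (s : ℂ))).congr' ?_
    filter_upwards [Ioo_mem_nhdsLT Real.pi_pos] with y hy
    rw [Complex.cpow_def_of_ne_zero]
    · rfl
    · exact Complex.slitPlane_ne_zero (one_add_exp_mem_slitPlane
        (by simpa using ⟨by linarith [hy.1, Real.pi_pos], hy.2⟩))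

/-- Here the negative axis is reached from below, where the logarithm tends to `log |1 - exp x| -
πi`; the phase is the conjugate of the one at `π`. -/
lemma tendsto_cpow_edge_neg_pi {x : ℝ} (hx : x ≠ 0) (s : ℝ) :
    Tendsto (fun y : ℝ => (1 + Complex.exp (x + y * Complex.I)) ^ (s : ℂ)) (𝓝[>] (-π))
      (𝓝 (edge s (Complex.exp (-(π * Complex.I) * s)) x)) := by
  have hcos : Real.cos (-π) = -1 := by rw [Real.cos_neg, Real.cos_pi]
  have hπ : -π < 0 := by linarith [Real.pi_pos]
  rcases hx.lt_or_gt with hx | hx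
  · exact tendsto_cpow_edge_of_neg hcos hx s _ _ nhdsWithin_le_nhds
  · have hre : (((1 - rexp x : ℝ) : ℂ)).re < 0 := by
      rw [Complex.ofReal_re]; linarith [Real.one_lt_exp_iff.2 hx]
    have him : (((1 - rexp x : ℝ) : ℂ)).im = 0 := Complex.ofReal_im _
    have h1 : Tendsto (fun y : ℝ => 1 + Complex.exp (x + y * Complex.I)) (𝓝[>] (-π))
        (𝓝[{z : ℂ | z.im < 0}] ((1 - rexp x : ℝ) : ℂ)) := by
      refine tendsto_nhdsWithin_iff.2 ⟨tendsto_one_add_exp hcos x _ nhdsWithin_le_nhds, ?_⟩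
      filter_upwards [Ioo_mem_nhdsGT hπ] with y hy
      rw [one_add_exp_line]
      exact mul_neg_of_pos_of_neg (exp_pos x) (Real.sin_neg_of_neg_of_neg_pi_lt hy.2 hy.1)
    have h2 := (Complex.tendsto_log_nhdsWithin_im_neg_of_re_neg_of_im_zero hre him).comp h1
    rw [← cpow_edge_of_pos hx, ← sub_eq_add_neg]
    refine ((Complex.continuous_exp.tendsto _).comp (h2.mul_const (s : ℂ))).congr' ?_
    filter_upwards [Ioo_mem_nhdsGT hπ] with y hy
    rw [Complex.cpow_def_of_ne_zero]
    · rfl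
    · exact Complex.slitPlane_ne_zero (one_add_exp_mem_slitPlane
        (by simpa using ⟨hy.1, by linarith [hy.2, Real.pi_pos]⟩))

/-- The function `k` with the phase `u` before `l` and the phase `v` after `l`. -/
noncomputable def twist (l : ℝ) (u v : ℂ) (k : ℝ → ℂ) (x : ℝ) : ℂ := (if x < l then u else v) * k x

lemma norm_twist {l : ℝ} {u v : ℂ} (hu : ‖u‖ = 1) (hv : ‖v‖ = 1) (k : ℝ → ℂ) (x : ℝ) :
    ‖twist l u v k x‖ = ‖k x‖ := by
  unfold twist; split_ifs <;> simp [hu, hv]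

lemma measurable_twist {l : ℝ} {u v : ℂ} {k : ℝ → ℂ} (hk : Measurable k) :
    Measurable (twist l u v k) :=
  (Measurable.ite measurableSet_Iio measurable_const measurable_const).mul hk

lemma setIntegral_twist_of_subset_Iic {l : ℝ} {u v : ℂ} {k : ℝ → ℂ} {x : ℝ} (hx : x ≤ l) :
    ∫ s in Iic x, twist l u v k s = u * ∫ s in Iic x, k s := by
  rw [← integral_const_mul, integral_Iic_eq_integral_Iio, integral_Iic_eq_integral_Iio]
  refine setIntegral_congr_fun measurableSet_Iio fun s hs => ?_
  rw [twist, if_pos (lt_of_lt_of_le hs hx)]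

lemma setIntegral_twist_of_subset_Ioi {l : ℝ} {u v : ℂ} {k : ℝ → ℂ} {V : Set ℝ}
    (hV : MeasurableSet V) (hx : V ⊆ Ioi l) : ∫ s in V, twist l u v k s = v * ∫ s in V, k s := by
  rw [← integral_const_mul]
  refine setIntegral_congr_fun hV fun s hs => ?_
  rw [twist, if_neg (hx hs : l < s).not_gt]

lemma integrable_twist {l : ℝ} {u v : ℂ} {k : ℝ → ℂ} (hk : Integrable k) :
    Integrable (twist l u v k) := by
  refine hk.bdd_mul (c := max ‖u‖ ‖v‖)
    (Measurable.ite measurableSet_Iio measurable_const measurable_const).aestronglyMeasurable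
    (Eventually.of_forall fun x => ?_)
  split_ifs
  · exact le_max_left _ _
  · exact le_max_right _ _

lemma integral_twist {l : ℝ} {u v : ℂ} {k : ℝ → ℂ} (hk : Integrable k) :
    ∫ s, twist l u v k s = u * (∫ s in Iic l, k s) + v * ∫ s in Ioi l, k s := by
  rw [← intervalIntegral.integral_Iic_add_Ioi (b := l) (integrable_twist hk).integrableOn
    (integrable_twist hk).integrableOn, setIntegral_twist_of_subset_Iic le_rfl,
    setIntegral_twist_of_subset_Ioi measurableSet_Ioi subset_rfl]

/-- The jump of the boundary integral across a ray with one branch point. -/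
lemma jump_integral {l : ℝ} {u v u' v' : ℂ} (hu : conj u' * u = u' * conj u)
    (hv : conj v' * v = v' * conj v) {h k : ℝ → ℂ} (hk : Integrable k)
    (h₁ : Integrable fun x => conj (∫ s in Iic x, twist l u' v' k s) * twist l u v h x)
    (h₂ : Integrable fun x => conj (∫ s in Iic x, twist l (conj u') (conj v') k s) *
      twist l (conj u) (conj v) h x) :
    (∫ x, conj (∫ s in Iic x, twist l u' v' k s) * twist l u v h x) -
      (∫ x, conj (∫ s in Iic x, twist l (conj u') (conj v') k s) *
        twist l (conj u) (conj v) h x) =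
    (conj u' * v - u' * conj v) * (conj (∫ s in Iic l, k s) * ∫ x in Ioi l, h x) := by
  have hsplit : ∀ p q : ℂ, ∀ x, l < x → ∫ s in Iic x, twist l p q k s =
      p * (∫ s in Iic l, k s) + q * ∫ s in Ioc l x, k s := by
    intro p q x hx
    rw [← Iic_union_Ioc_eq_Iic hx.le, setIntegral_union (Iic_disjoint_Ioc le_rfl)
      measurableSet_Ioc (integrable_twist hk).integrableOn (integrable_twist hk).integrableOn,
      setIntegral_twist_of_subset_Iic le_rfl,
      setIntegral_twist_of_subset_Ioi measurableSet_Ioc fun s hs => hs.1]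
  rw [← integral_sub h₁ h₂, ← integral_const_mul, ← integral_const_mul,
    ← integral_indicator measurableSet_Ioi]
  refine integral_congr_ae ?_
  filter_upwards [compl_mem_ae_iff.2 (measure_singleton (μ := (volume : Measure ℝ)) l)] with x hx
  rcases lt_or_gt_of_ne (hx : x ≠ l) with hxl | hxl
  -- Before `l` only the phases `u` and `u'` occur, and `hu` makes the two sides equal.
  · rw [indicator_of_notMem (by simpa using hxl.le), setIntegral_twist_of_subset_Iic hxl.le,
      setIntegral_twist_of_subset_Iic hxl.le, twist, twist, if_pos hxl, if_pos hxl]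
    simp only [map_mul, Complex.conj_conj]
    linear_combination (conj (∫ s in Iic x, k s) * h x) * hu
  -- After `l` the primitive splits at `l`. Its part over `(l, x]` cancels by `hv`; its part up to
  -- `l` meets the phase `v` and leaves the jump.
  · rw [indicator_of_mem (by simpa using hxl), hsplit _ _ _ hxl, hsplit _ _ _ hxl, twist, twist,
      if_neg hxl.not_gt, if_neg hxl.not_gt]
    simp only [map_mul, map_add, Complex.conj_conj]
    linear_combination (conj (∫ s in Ioc l x, k s) * h x) * hv

lemma norm_boundary_le {α β x : ℝ} {l : Filter ℝ} [l.NeBot] {k : ℂ → ℂ} {κ : ℝ → ℝ} {w : ℂ}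
    (hb : ∀ y ∈ Ioo α β, ‖k (x + y * Complex.I)‖ ≤ κ x) (hl : ∀ᶠ y in l, y ∈ Ioo α β)
    (hw : Tendsto (fun y : ℝ => k (x + y * Complex.I)) l (𝓝 w)) : ‖w‖ ≤ κ x :=
  le_of_tendsto hw.norm (hl.mono hb)

/-- The bound `Φ` on interior lines survives the passage to the edge, because the primitive
converges there by dominated convergence. -/
lemma integrable_boundary {α β : ℝ} {l : Filter ℝ} [l.NeBot] [l.IsCountablyGenerated]
    {h k : ℂ → ℂ} {κ Φ : ℝ → ℝ} {T : Set ℝ} {h₀ k₀ : ℝ → ℂ} (hT : T.Finite)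
    (hk : DifferentiableOn ℂ k (Complex.im ⁻¹' Ioo α β))
    (hb : ∀ x ∉ T, ∀ y ∈ Ioo α β, ‖k (x + y * Complex.I)‖ ≤ κ x)
    (hκ : Integrable κ) (hΦ : Integrable Φ)
    (hΦb : ∀ x ∉ T, ∀ y ∈ Ioo α β,
      ‖∫ s in Iic x, k (s + y * Complex.I)‖ * ‖h (x + y * Complex.I)‖ ≤ Φ x)
    (hl : ∀ᶠ y in l, y ∈ Ioo α β) (hmeas : Measurable h₀)
    (hk₀ : ∀ x ∉ T, Tendsto (fun y : ℝ => k (x + y * Complex.I)) l (𝓝 (k₀ x)))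
    (hh₀ : ∀ x ∉ T, Tendsto (fun y : ℝ => h (x + y * Complex.I)) l (𝓝 (h₀ x))) (hk₀m : Measurable k₀) :
    Integrable fun x => conj (∫ s in Iic x, k₀ s) * h₀ x := by
  have hae := hT.countable.ae_notMem volume
  refine hΦ.mono' ?_ ?_
  · refine AEStronglyMeasurable.mul ?_ hmeas.aestronglyMeasurable
    refine Complex.continuous_conj.comp_aestronglyMeasurable ?_
    have : (fun x => ∫ s in Iic x, k₀ s) = fun x => ∫ s, (Iic x).indicator k₀ s := by
      ext x; rw [integral_indicator measurableSet_Iic]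
    rw [this]
    refine (StronglyMeasurable.integral_prod_right (f := fun x s => (Iic x).indicator k₀ s)
      ?_).aestronglyMeasurable
    have hm : Measurable fun q : ℝ × ℝ => if q.2 ≤ q.1 then k₀ q.2 else 0 :=
      Measurable.ite (measurableSet_le measurable_snd measurable_fst) (by fun_prop)
        measurable_const
    convert hm.stronglyMeasurable using 2 with q
    simp [Function.uncurry, indicator]
  · filter_upwards [hae] with x hx
    have hlim : Tendsto (fun y : ℝ => ‖∫ s in Iic x, k (s + y * Complex.I)‖ *
        ‖h (x + y * Complex.I)‖) l (𝓝 (‖∫ s in Iic x, k₀ s‖ * ‖h₀ x‖)) :=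
      (tendsto_integral_horizontal hT hk hb hl hκ.integrableOn (hae.mono hk₀)).norm.mul
        (hh₀ x hx).norm
    rw [norm_mul, RCLike.norm_conj]
    exact le_of_tendsto hlim (hl.mono fun y hy => hΦb x hx y hy)

/-- The modulus of the integrand on the ray through the branch point `-1`. -/
noncomputable def rayOne (a b c : ℝ) (z : ℂ) (x : ℝ) : ℂ :=
  Complex.exp ((a + 1 : ℝ) * x) * ((|1 - rexp x| ^ b : ℝ) : ℂ) * (1 - Complex.exp x / z) ^ (c : ℂ)

/-- The integrand on the ray through the branch point `-z`, without the jumping phase. -/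
noncomputable def rayZ (a b c : ℝ) (z : ℂ) (x : ℝ) : ℂ :=
  Complex.exp ((a + 1 : ℝ) * (x + (-z).arg * Complex.I)) *
    (1 + Complex.exp (x + (-z).arg * Complex.I)) ^ (b : ℂ) *
    ((|1 - rexp (x - Real.log ‖z‖)| ^ c : ℝ) : ℂ)

lemma measurable_rayOne (a b c : ℝ) (z : ℂ) : Measurable (rayOne a b c z) := by
  unfold rayOne
  have h1 : Measurable fun x : ℝ => (|1 - rexp x| ^ b : ℝ) := by fun_prop
  have h2 : Measurable fun x : ℝ => 1 - Complex.exp x / z := by fun_prop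
  exact (Measurable.mul (by fun_prop) (Complex.measurable_ofReal.comp h1)).mul (h2.pow_const _)

lemma measurable_rayZ (a b c : ℝ) (z : ℂ) : Measurable (rayZ a b c z) := by
  unfold rayZ
  have h1 : Measurable fun x : ℝ => (|1 - rexp (x - Real.log ‖z‖)| ^ c : ℝ) := by fun_prop
  have h2 : Measurable fun x : ℝ => 1 + Complex.exp (x + (-z).arg * Complex.I) := by fun_prop
  exact (Measurable.mul (by fun_prop) (h2.pow_const _)).mul (Complex.measurable_ofReal.comp h1)

lemma one_sub_exp_div_mem_slitPlane {z : ℂ} (hz : -z ∈ Complex.slitPlane) (x : ℝ) :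
    1 - Complex.exp x / z ∈ Complex.slitPlane := by
  have hz0 : z ≠ 0 := neg_ne_zero.1 (Complex.slitPlane_ne_zero hz)
  have e : 1 - Complex.exp x / z = 1 + Complex.exp (x - Complex.log (-z)) := by
    rw [exp_sub_log_neg hz0]; ring
  rw [e]
  refine one_add_exp_mem_slitPlane ?_
  have h1 := Complex.neg_pi_lt_arg (-z)
  have h2 := Complex.mem_slitPlane_iff_arg.1 hz
  simp only [Complex.sub_im, Complex.ofReal_im, Complex.log_im, zero_sub]
  exact ⟨neg_lt_neg (lt_of_le_of_ne (Complex.arg_le_pi _) h2.1), by linarith⟩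

lemma exp_line_of_exp_pi {θ : ℝ} (hθ : Complex.exp (θ * Complex.I) = -1) (x : ℝ) :
    Complex.exp (x + θ * Complex.I) = -Complex.exp x := by
  rw [Complex.exp_add, hθ]; ring

lemma exp_neg_pi_mul_I : Complex.exp ((-π : ℝ) * Complex.I) = -1 := by
  rw [Complex.ofReal_neg, neg_mul, Complex.exp_neg, Complex.exp_pi_mul_I]; norm_num

/-- On the lines `Im ζ = ±π` only the factor with exponent `b` meets its cut. The exponential gives
a constant phase, and the factor with exponent `c` is continuous. -/
lemma tendsto_logIntegrand_of_edge {a b c x θ : ℝ} {z p : ℂ} {l : Filter ℝ} (hl : l ≤ 𝓝 θ)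
    (hz : -z ∈ Complex.slitPlane) (hθ : Complex.exp (θ * Complex.I) = -1)
    (hb : Tendsto (fun y : ℝ => (1 + Complex.exp (x + y * Complex.I)) ^ (b : ℂ)) l
      (𝓝 (edge b p x))) :
    Tendsto (fun y : ℝ => logIntegrand a b c z (x + y * Complex.I)) l
      (𝓝 (twist 0 (Complex.exp ((a + 1 : ℝ) * (θ * Complex.I)))
        (Complex.exp ((a + 1 : ℝ) * (θ * Complex.I)) * p) (rayOne a b c z) x)) := by
  have c1 : Continuous fun y : ℝ => Complex.exp ((a + 1 : ℝ) * (x + y * Complex.I)) := by fun_prop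
  have c2 : Continuous fun y : ℝ => 1 + Complex.exp (x + y * Complex.I) / z := by fun_prop
  have h2 := (c2.tendsto θ).mono_left hl
  rw [exp_line_of_exp_pi hθ, neg_div, ← sub_eq_add_neg] at h2
  have h3 := (((c1.tendsto θ).mono_left hl).mul hb).mul
    (h2.cpow (tendsto_const_nhds (x := (c : ℂ))) (one_sub_exp_div_mem_slitPlane hz x))
  convert h3 using 2
  · rfl
  · simp only [twist, rayOne, edge, mul_add, Complex.exp_add]
    split_ifs <;> ring

lemma tendsto_logIntegrand_pi {a b c x : ℝ} {z : ℂ} (hz : -z ∈ Complex.slitPlane) (hx : x ≠ 0) :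
    Tendsto (fun y : ℝ => logIntegrand a b c z (x + y * Complex.I)) (𝓝[<] π)
      (𝓝 (twist 0 (Complex.exp ((a + 1 : ℝ) * (π * Complex.I)))
        (Complex.exp ((a + 1 : ℝ) * (π * Complex.I)) * Complex.exp (π * Complex.I * b))
        (rayOne a b c z) x)) :=
  tendsto_logIntegrand_of_edge nhdsWithin_le_nhds hz Complex.exp_pi_mul_I (tendsto_cpow_edge_pi hx b)

lemma tendsto_logIntegrand_neg_pi {a b c x : ℝ} {z : ℂ} (hz : -z ∈ Complex.slitPlane)
    (hx : x ≠ 0) :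
    Tendsto (fun y : ℝ => logIntegrand a b c z (x + y * Complex.I)) (𝓝[>] (-π))
      (𝓝 (twist 0 (conj (Complex.exp ((a + 1 : ℝ) * (π * Complex.I))))
        (conj (Complex.exp ((a + 1 : ℝ) * (π * Complex.I)) * Complex.exp (π * Complex.I * b)))
        (rayOne a b c z) x)) := by
  convert tendsto_logIntegrand_of_edge (a := a) (c := c) nhdsWithin_le_nhds hz exp_neg_pi_mul_I
    (tendsto_cpow_edge_neg_pi hx b) using 4
  · rw [← Complex.exp_conj]; simp
  · rw [map_mul, ← Complex.exp_conj, ← Complex.exp_conj]; simp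

/-- On the line `Im ζ = arg (-z)` only the factor with exponent `c` meets its cut. The phase of the
exponential is kept inside `rayZ`, so the phase before the branch point is `1`. -/
lemma tendsto_logIntegrand_arg {a b c x : ℝ} {z p : ℂ} {l : Filter ℝ}
    (hl : l ≤ 𝓝 (-z).arg) (hz : -z ∈ Complex.slitPlane)
    (hc : Tendsto (fun y : ℝ => (1 + Complex.exp (x + y * Complex.I) / z) ^ (c : ℂ)) l
      (𝓝 (edge c p (x - Real.log ‖z‖)))) :
    Tendsto (fun y : ℝ => logIntegrand a b c z (x + y * Complex.I)) l
      (𝓝 (twist (Real.log ‖z‖) 1 p (rayZ a b c z) x)) := by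
  have c1 : Continuous fun y : ℝ => Complex.exp ((a + 1 : ℝ) * (x + y * Complex.I)) := by fun_prop
  have c2 : Continuous fun y : ℝ => 1 + Complex.exp (x + y * Complex.I) := by fun_prop
  have hm : 1 + Complex.exp (x + (-z).arg * Complex.I) ∈ Complex.slitPlane := by
    refine one_add_exp_mem_slitPlane ?_
    simpa using ⟨Complex.neg_pi_lt_arg (-z),
      lt_of_le_of_ne (Complex.arg_le_pi _) (Complex.mem_slitPlane_iff_arg.1 hz).1⟩
  have h3 := (((c1.tendsto _).mono_left hl).mul
    (((c2.tendsto _).mono_left hl).cpow (tendsto_const_nhds (x := (b : ℂ))) hm)).mul hc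
  convert h3 using 2
  · rfl
  · simp only [twist, rayZ, edge, sub_neg]
    split_ifs <;> ring

lemma tendsto_logIntegrand_arg_left {a b c x : ℝ} {z : ℂ} (hz : -z ∈ Complex.slitPlane)
    (hx : x ≠ Real.log ‖z‖) :
    Tendsto (fun y : ℝ => logIntegrand a b c z (x + y * Complex.I)) (𝓝[<] (-z).arg)
      (𝓝 (twist (Real.log ‖z‖) 1 (Complex.exp (π * Complex.I * c)) (rayZ a b c z) x)) := by
  refine tendsto_logIntegrand_arg nhdsWithin_le_nhds hz ?_
  have hz0 : z ≠ 0 := neg_ne_zero.1 (Complex.slitPlane_ne_zero hz)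
  -- Vertical translation of the line through `-z` to the edge `π` of the basic strip, where the
  -- limit is known.
  have ht : Tendsto (fun y : ℝ => y + (π - (-z).arg)) (𝓝[<] (-z).arg) (𝓝[<] π) := by
    refine tendsto_nhdsWithin_iff.2 ⟨?_, ?_⟩
    · have : Continuous fun y : ℝ => y + (π - (-z).arg) := by fun_prop
      simpa using (this.tendsto (-z).arg).mono_left nhdsWithin_le_nhds
    · filter_upwards [self_mem_nhdsWithin] with y hy
      have : y < (-z).arg := hy
      show y + (π - (-z).arg) < π
      linarith
  refine ((tendsto_cpow_edge_pi (sub_ne_zero.2 hx) c).comp ht).congr fun y => ?_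
  simp only [Function.comp_apply]
  rw [exp_div_eq_add hz0, Complex.log, norm_neg]
  congr 3
  push_cast
  ring

lemma tendsto_logIntegrand_arg_right {a b c x : ℝ} {z : ℂ} (hz : -z ∈ Complex.slitPlane)
    (hx : x ≠ Real.log ‖z‖) :
    Tendsto (fun y : ℝ => logIntegrand a b c z (x + y * Complex.I)) (𝓝[>] (-z).arg)
      (𝓝 (twist (Real.log ‖z‖) (conj 1) (conj (Complex.exp (π * Complex.I * c)))
        (rayZ a b c z) x)) := by
  have e : conj (Complex.exp (π * Complex.I * c)) = Complex.exp (-(π * Complex.I) * c) := by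
    rw [← Complex.exp_conj]; simp
  rw [map_one, e]
  refine tendsto_logIntegrand_arg nhdsWithin_le_nhds hz ?_
  have hz0 : z ≠ 0 := neg_ne_zero.1 (Complex.slitPlane_ne_zero hz)
  have ht : Tendsto (fun y : ℝ => y - (π + (-z).arg)) (𝓝[>] (-z).arg) (𝓝[>] (-π)) := by
    refine tendsto_nhdsWithin_iff.2 ⟨?_, ?_⟩
    · have : Continuous fun y : ℝ => y - (π + (-z).arg) := by fun_prop
      simpa using (this.tendsto (-z).arg).mono_left nhdsWithin_le_nhds
    · filter_upwards [self_mem_nhdsWithin] with y hy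
      have : (-z).arg < y := hy
      show -π < y - (π + (-z).arg)
      linarith
  refine ((tendsto_cpow_edge_neg_pi (sub_ne_zero.2 hx) c).comp ht).congr fun y => ?_
  simp only [Function.comp_apply]
  rw [exp_div_eq_sub hz0, Complex.log, norm_neg]
  congr 3
  push_cast
  ring

lemma ne_zero_of_neg_mem_slitPlane {z : ℂ} (hz : -z ∈ Complex.slitPlane) : z ≠ 0 :=
  neg_ne_zero.1 (Complex.slitPlane_ne_zero hz)

lemma ne_one_of_neg_mem_slitPlane {z : ℂ} (hz : -z ∈ Complex.slitPlane) : z ≠ 1 := by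
  rintro rfl
  simp [Complex.mem_slitPlane_iff] at hz; linarith

lemma neg_arg_mem {z : ℂ} (hz : -z ∈ Complex.slitPlane) : (-z).arg ∈ Ioo (-π) π :=
  ⟨Complex.neg_pi_lt_arg _,
    lt_of_le_of_ne (Complex.arg_le_pi _) (Complex.mem_slitPlane_iff_arg.1 hz).1⟩

lemma finite_branch (z : ℂ) : ({0, Real.log ‖z‖} : Set ℝ).Finite := toFinite _

/-! ### Majorants for the form and its primitive -/

lemma exists_majorant {a b c : ℝ} (ha : -1 < a) (hb : -1 < b) (hc : -1 < c)
    (habc : a + b + c < -1) {z : ℂ} (hz0 : z ≠ 0) (hz1 : z ≠ 1) :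
    ∃ κ : ℝ → ℝ, Integrable κ ∧ Tendsto κ atBot (𝓝 0) ∧ Tendsto κ atTop (𝓝 0) ∧
      ∀ x ∉ ({0, Real.log ‖z‖} : Set ℝ), ∀ y : ℝ,
        ‖logIntegrand a b c z (x + y * Complex.I)‖ ≤ κ x := by
  obtain ⟨ρ, hρ, h1, h2, h3⟩ := exists_radius hz0 hz1
  obtain ⟨C, hC, H⟩ := exists_norm_logIntegrand_le hρ h1 h2 h3 a b c
  refine ⟨fun x => C * logBound ρ ‖z‖ a b c 0 x,
    (integrable_logBound (by linarith) hb hc habc ρ _).const_mul C, ?_, ?_, H⟩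
  · simpa using (tendsto_logBound_atBot le_rfl (by linarith) habc hρ h1 h2).const_mul C
  · simpa using (tendsto_logBound_atTop habc ρ ‖z‖ 0).const_mul C

lemma norm_logIntegrand_shift (a b c σ : ℝ) (z ζ : ℂ) :
    ‖logIntegrand a b c z ζ‖ = rexp ζ.re ^ σ * ‖logIntegrand (a - σ) b c z ζ‖ := by
  simp only [logIntegrand, norm_mul, Complex.norm_exp, Complex.re_ofReal_mul, ← Real.exp_mul]
  rw [← mul_assoc, ← mul_assoc, ← Real.exp_add]
  congr 4
  ring

/-- Only `a + a' > -2` is assumed at `w = 0`, so the form with exponent `a` need not be integrable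
there. The decay of the primitive of the other form at `-∞` compensates. -/
lemma exists_majorant_primitive {a b c a' b' c' : ℝ} (ha' : -1 < a') (haa : -2 < a + a')
    (hb : -1 < b) (hb' : -1 < b') (hc : -1 < c) (hc' : -1 < c')
    (habc : a + b + c < -1) (habc' : a' + b' + c' < -1) {z : ℂ} (hz0 : z ≠ 0) (hz1 : z ≠ 1) :
    ∃ Φ : ℝ → ℝ, Integrable Φ ∧ Tendsto Φ atBot (𝓝 0) ∧ Tendsto Φ atTop (𝓝 0) ∧
      ∀ x ∉ ({0, Real.log ‖z‖} : Set ℝ), ∀ y : ℝ,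
        ‖∫ s in Iic x, logIntegrand a' b' c' z (s + y * Complex.I)‖ *
          ‖logIntegrand a b c z (x + y * Complex.I)‖ ≤ Φ x := by
  obtain ⟨ρ, hρ, h1, h2, h3⟩ := exists_radius hz0 hz1
  obtain ⟨C, hC, H⟩ := exists_norm_logIntegrand_le hρ h1 h2 h3 a b c
  obtain ⟨κ, hκ, -, -, hκb⟩ := exists_majorant ha' hb' hc' habc' hz0 hz1
  -- For `a < a'` this choice makes `a + σ` and `a' - σ` both equal to the mean `(a + a') / 2 > -1`;
  -- for `a ≥ a'` no damping is needed.
  set σ := max 0 ((a' - a) / 2) with hσdef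
  have hσ : 0 ≤ σ := le_max_left _ _
  have hσ1 : -1 < a + σ := by
    rcases le_total ((a' - a) / 2) 0 with h | h
    · rw [hσdef, max_eq_left h]; linarith
    · rw [hσdef, max_eq_right h]; linarith
  have hσ2 : -1 < a' - σ := by
    have : σ < a' + 1 := max_lt (by linarith) (by linarith)
    linarith
  obtain ⟨κ', hκ', -, -, hκb'⟩ := exists_majorant (a := a' - σ) hσ2 hb' hc' (by linarith) hz0 hz1
  have hae := (finite_branch z).countable.ae_notMem volume
  have hκ0 : ∀ᵐ x, 0 ≤ κ x := hae.mono fun x hx => (norm_nonneg _).trans (hκb x hx 0)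
  have hκ0' : ∀ᵐ x, 0 ≤ κ' x := hae.mono fun x hx => (norm_nonneg _).trans (hκb' x hx 0)
  set D := (∫ x, κ x) + ∫ x, κ' x with hD
  have hD1 : 0 ≤ ∫ x, κ x := integral_nonneg_of_ae hκ0
  have hD2 : 0 ≤ ∫ x, κ' x := integral_nonneg_of_ae hκ0'
  -- The primitive is bounded by the total mass, and also by `exp (σ x)` times the mass of the form
  -- with exponent `a' - σ`, since `exp (σ s) ≤ exp (σ x)` for `s ≤ x`.
  have hK : ∀ x y : ℝ, ‖∫ s in Iic x, logIntegrand a' b' c' z (s + y * Complex.I)‖ ≤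
      D * min 1 (rexp x ^ σ) := by
    intro x y
    rw [mul_min_of_nonneg _ _ (by positivity)]
    refine le_min ?_ ?_
    · calc _ ≤ ∫ s in Iic x, κ s := norm_integral_le_of_norm_le hκ.integrableOn
            (ae_restrict_of_ae (hae.mono fun s hs => hκb s hs y))
        _ ≤ ∫ s, κ s := setIntegral_le_integral hκ hκ0
        _ ≤ D * 1 := by rw [mul_one]; exact le_add_of_nonneg_right hD2
    · calc _ ≤ ∫ s in Iic x, rexp x ^ σ * κ' s := by
            refine norm_integral_le_of_norm_le (hκ'.integrableOn.const_mul _) ?_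
            filter_upwards [ae_restrict_of_ae hae, ae_restrict_mem measurableSet_Iic] with s hs hsx
            rw [norm_logIntegrand_shift a' b' c' σ]
            have hre : ((s : ℂ) + y * Complex.I).re = s := by simp
            rw [hre]
            have hsx : s ≤ x := hsx
            gcongr
            exact hκb' s hs y
        _ = rexp x ^ σ * ∫ s in Iic x, κ' s := integral_const_mul _ _
        _ ≤ rexp x ^ σ * D := by
            gcongr
            exact (setIntegral_le_integral hκ' hκ0').trans (le_add_of_nonneg_left hD1)
        _ = D * rexp x ^ σ := mul_comm _ _
  refine ⟨fun x => D * C * logBound ρ ‖z‖ a b c σ x,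
    (integrable_logBound hσ1 hb hc habc ρ _).const_mul _, ?_, ?_, fun x hx y => ?_⟩
  · simpa using (tendsto_logBound_atBot hσ hσ1 habc hρ h1 h2).const_mul (D * C)
  · simpa using (tendsto_logBound_atTop habc ρ ‖z‖ σ).const_mul (D * C)
  · calc _ ≤ (D * min 1 (rexp x ^ σ)) * (C * logBound ρ ‖z‖ a b c 0 x) :=
          mul_le_mul (hK x y) (H x hx y) (norm_nonneg _) (by positivity)
      _ = _ := by simp only [← min_mul_logBound_zero ρ ‖z‖ a b c σ x]; ring

lemma differentiableOn_logIntegrand_lower {a b c : ℝ} {z : ℂ} (hz : -z ∈ Complex.slitPlane) :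
    DifferentiableOn ℂ (logIntegrand a b c z) (Complex.im ⁻¹' Ioo (-π) (-z).arg) := fun _ hζ =>
  (differentiableAt_logIntegrand
    (one_add_exp_mem_slitPlane ⟨hζ.1, hζ.2.trans (neg_arg_mem hz).2⟩)
    (one_add_exp_div_mem_slitPlane (ne_zero_of_neg_mem_slitPlane hz) (Or.inl hζ)
      (neg_arg_mem hz).2)).differentiableWithinAt

lemma differentiableOn_logIntegrand_upper {a b c : ℝ} {z : ℂ} (hz : -z ∈ Complex.slitPlane) :
    DifferentiableOn ℂ (logIntegrand a b c z) (Complex.im ⁻¹' Ioo (-z).arg π) := fun _ hζ =>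
  (differentiableAt_logIntegrand
    (one_add_exp_mem_slitPlane ⟨(neg_arg_mem hz).1.trans hζ.1, hζ.2⟩)
    (one_add_exp_div_mem_slitPlane (ne_zero_of_neg_mem_slitPlane hz) (Or.inr hζ)
      (neg_arg_mem hz).2)).differentiableWithinAt

/-! ### Phases and the contour relations -/

lemma norm_exp_mul_I' (s t : ℝ) : ‖Complex.exp ((s : ℂ) * (t * Complex.I))‖ = 1 := by
  rw [← mul_assoc, ← Complex.ofReal_mul, Complex.norm_exp_ofReal_mul_I]

lemma norm_exp_pi_mul (s : ℝ) : ‖Complex.exp (π * Complex.I * s)‖ = 1 := by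
  rw [mul_right_comm, ← Complex.ofReal_mul, Complex.norm_exp_ofReal_mul_I]

lemma exp_sub_conj_exp (s : ℝ) :
    Complex.exp (π * Complex.I * s) - conj (Complex.exp (π * Complex.I * s)) =
      2 * Complex.I * (sin (π * s) : ℝ) := by
  rw [Complex.sub_conj, mul_right_comm, ← Complex.ofReal_mul, Complex.exp_ofReal_mul_I_im]
  push_cast
  ring

lemma conj_exp_pi_mul (s : ℝ) :
    conj (Complex.exp (π * Complex.I * s)) = Complex.exp (π * Complex.I * ((-s : ℝ) : ℂ)) := by
  rw [← Complex.exp_conj]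
  simp

/-- The product is `exp (iπ(s - t))`, which is a sign and hence equal to its conjugate. This is
where the integrality of the exponent differences enters. -/
lemma conj_exp_mul_exp_of_int {s t : ℝ} (h : ∃ i : ℤ, s - t = i) :
    conj (Complex.exp (π * Complex.I * t)) * Complex.exp (π * Complex.I * s) =
      Complex.exp (π * Complex.I * t) * conj (Complex.exp (π * Complex.I * s)) := by
  obtain ⟨i, hi⟩ := h
  obtain rfl : s = t + i := by linarith
  rw [conj_exp_pi_mul, conj_exp_pi_mul, ← Complex.exp_add, ← Complex.exp_add,
    Complex.exp_eq_exp_iff_exists_int]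
  exact ⟨i, by push_cast; ring⟩

section
variable {a b c : ℝ} {z : ℂ} (ha : -1 < a) (hb : -1 < b) (hc : -1 < c)
  (habc : a + b + c < -1) (hz : -z ∈ Complex.slitPlane)
include ha hb hc habc hz

/-- The phases are unimodular, so the ray integrand has the modulus of a boundary value of
`logIntegrand` and inherits its majorant. -/
lemma integrable_rayOne : Integrable (rayOne a b c z) := by
  obtain ⟨κ, hκ, -, -, hb⟩ := exists_majorant ha hb hc habc (ne_zero_of_neg_mem_slitPlane hz)
    (ne_one_of_neg_mem_slitPlane hz)
  refine hκ.mono' (measurable_rayOne a b c z).aestronglyMeasurable ?_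
  filter_upwards [(finite_branch z).countable.ae_notMem volume] with x hx
  have := norm_boundary_le (α := 0) (β := π) (fun y _ => hb x hx y) (Ioo_mem_nhdsLT Real.pi_pos)
    (tendsto_logIntegrand_pi (a := a) (b := b) (c := c) hz (by simp at hx; tauto))
  rwa [norm_twist (norm_exp_mul_I' _ _)
    (by rw [norm_mul, norm_exp_mul_I', norm_exp_pi_mul, one_mul])] at this

lemma integrable_rayZ : Integrable (rayZ a b c z) := by
  obtain ⟨κ, hκ, -, -, hb⟩ := exists_majorant ha hb hc habc (ne_zero_of_neg_mem_slitPlane hz)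
    (ne_one_of_neg_mem_slitPlane hz)
  refine hκ.mono' (measurable_rayZ a b c z).aestronglyMeasurable ?_
  filter_upwards [(finite_branch z).countable.ae_notMem volume] with x hx
  have := norm_boundary_le (α := -π) (β := (-z).arg) (fun y _ => hb x hx y)
    (Ioo_mem_nhdsLT (neg_arg_mem hz).1)
    (tendsto_logIntegrand_arg_left (a := a) (b := b) (c := c) hz (by simp at hx; tauto))
  rwa [norm_twist norm_one (norm_exp_pi_mul _)] at this

/-- Cauchy's theorem in each substrip equates the integrals over its two edges. These are two
relations between four ray integrals with phases as coefficients; eliminating one integral at a time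
leaves sines. -/
lemma contour_relations :
    sin (π * (a + c)) * (∫ s in Iic 0, rayOne a b c z s) =
      -(sin (π * c) * (∫ s in Iic (Real.log ‖z‖), rayZ a b c z s) +
        sin (π * (a + b + c)) * ∫ s in Ioi 0, rayOne a b c z s) ∧
    sin (π * (a + c)) * (∫ s in Ioi (Real.log ‖z‖), rayZ a b c z s) =
      sin (π * b) * (∫ s in Ioi 0, rayOne a b c z s) -
        sin (π * a) * ∫ s in Iic (Real.log ‖z‖), rayZ a b c z s := by
  have i1 := integrable_rayOne ha hb hc habc hz
  have i2 := integrable_rayZ ha hb hc habc hz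
  obtain ⟨κ, hκ, hκ0, hκ1, hb⟩ := exists_majorant ha hb hc habc (ne_zero_of_neg_mem_slitPlane hz)
    (ne_one_of_neg_mem_slitPlane hz)
  have hT := finite_branch z
  have hae := hT.countable.ae_notMem volume
  have e1 := integral_boundary_eq (neg_arg_mem hz).1 hT
    (differentiableOn_logIntegrand_lower (a := a) (b := b) (c := c) hz)
    (fun x hx y _ => hb x hx y) hκ hκ0 hκ1
    (hae.mono fun x hx => tendsto_logIntegrand_neg_pi hz (by simp at hx; tauto))
    (hae.mono fun x hx => tendsto_logIntegrand_arg_left hz (by simp at hx; tauto))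
  have e2 := integral_boundary_eq (neg_arg_mem hz).2 hT
    (differentiableOn_logIntegrand_upper (a := a) (b := b) (c := c) hz)
    (fun x hx y _ => hb x hx y) hκ hκ0 hκ1
    (hae.mono fun x hx => tendsto_logIntegrand_arg_right hz (by simp at hx; tauto))
    (hae.mono fun x hx => tendsto_logIntegrand_pi hz (by simp at hx; tauto))
  rw [integral_twist i1, integral_twist i2] at e1 e2
  have hU : Complex.exp ((a + 1 : ℝ) * (π * Complex.I)) = -Complex.exp (π * Complex.I * a) := by
    rw [show ((a + 1 : ℝ) : ℂ) * (π * Complex.I) = π * Complex.I * a + π * Complex.I by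
      push_cast; ring, Complex.exp_add, Complex.exp_pi_mul_I]
    ring
  rw [hU] at e1 e2
  have s1 := exp_sub_conj_exp a
  have s2 := exp_sub_conj_exp b
  have s3 := exp_sub_conj_exp c
  have s4 := exp_sub_conj_exp (a + c)
  have s5 := exp_sub_conj_exp (a + b + c)
  have m4 : Complex.exp (π * Complex.I * ((a + c : ℝ) : ℂ)) =
      Complex.exp (π * Complex.I * a) * Complex.exp (π * Complex.I * c) := by
    rw [← Complex.exp_add]; push_cast; ring_nf
  have m5 : Complex.exp (π * Complex.I * ((a + b + c : ℝ) : ℂ)) =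
      Complex.exp (π * Complex.I * a) * Complex.exp (π * Complex.I * b) *
        Complex.exp (π * Complex.I * c) := by
    rw [← Complex.exp_add, ← Complex.exp_add]; push_cast; ring_nf
  rw [m4] at s4
  rw [m5] at s5
  have n1 : ∀ s : ℝ, Complex.exp (π * Complex.I * s) * conj (Complex.exp (π * Complex.I * s)) = 1 := by
    intro s
    rw [Complex.mul_conj', norm_exp_pi_mul]; norm_num
  have ua := n1 a
  simp only [map_mul, map_neg, map_one] at e1 e2 s4 s5
  generalize Complex.exp (π * Complex.I * a) = U at *
  generalize Complex.exp (π * Complex.I * b) = V at *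
  generalize Complex.exp (π * Complex.I * c) = W at *
  have hI : (2 * Complex.I : ℂ) ≠ 0 := by simp
  constructor
  -- The multipliers `W` for the upper and `conj W` for the lower relation eliminate the integral
  -- over the part of the ray beyond `z`.
  · refine mul_left_cancel₀ hI ?_
    linear_combination (-(∫ s in Iic 0, rayOne a b c z s)) * s4 -
      (∫ s in Iic (Real.log ‖z‖), rayZ a b c z s) * s3 -
      (∫ s in Ioi 0, rayOne a b c z s) * s5 + W * e2 + conj W * e1
  -- The multipliers `U` for the lower and `conj U` for the upper relation eliminate the integral
  -- over `(0,1)`; `ua` is `|U| = 1`.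
  · refine mul_left_cancel₀ hI ?_
    linear_combination (-(∫ s in Ioi (Real.log ‖z‖), rayZ a b c z s)) * s4 +
      (∫ s in Ioi 0, rayOne a b c z s) * s2 -
      (∫ s in Iic (Real.log ‖z‖), rayZ a b c z s) * s1 - U * e1 - conj U * e2 +
      (V - conj V) * (∫ s in Ioi 0, rayOne a b c z s) * ua

end

/-! ### The correlator as a sum of products of ray integrals -/

/-- The bilinear relation for the plane cut along the rays through `-1` and `-z`. -/
theorem integral_conj_mul_logIntegrand {a b c a' b' c' : ℝ} {z : ℂ} (ha' : -1 < a')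
    (haa : -2 < a + a') (hb : -1 < b) (hb' : -1 < b') (hc : -1 < c) (hc' : -1 < c')
    (habc : a + b + c < -1) (habc' : a' + b' + c' < -1) (hz : -z ∈ Complex.slitPlane)
    (hia : ∃ i : ℤ, a - a' = i) (hib : ∃ i : ℤ, b - b' = i) (hic : ∃ i : ℤ, c - c' = i)
    (hint : Integrable (fun q : ℝ × ℝ => conj (logIntegrand a' b' c' z (q.1 + q.2 * Complex.I)) *
      logIntegrand a b c z (q.1 + q.2 * Complex.I)) (volume.prod (volume.restrict (Ioo (-π) π)))) :
    ∫ y in Ioo (-π) π, ∫ x : ℝ, conj (logIntegrand a' b' c' z (x + y * Complex.I)) *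
      logIntegrand a b c z (x + y * Complex.I) =
    -(sin (π * (a - a' + b)) * (conj (∫ s in Iic 0, rayOne a' b' c' z s) *
        ∫ s in Ioi 0, rayOne a b c z s) +
      sin (π * c) * (conj (∫ s in Iic (Real.log ‖z‖), rayZ a' b' c' z s) *
        ∫ s in Ioi (Real.log ‖z‖), rayZ a b c z s)) := by
  have hz0 := ne_zero_of_neg_mem_slitPlane hz
  have hz1 := ne_one_of_neg_mem_slitPlane hz
  have hψ := neg_arg_mem hz
  set ψ := (-z).arg with hψdef
  obtain ⟨κ, hκ, hκ0, hκ1, hκb⟩ := exists_majorant ha' hb' hc' habc' hz0 hz1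
  obtain ⟨Φ, hΦ, hΦ0, hΦ1, hΦb⟩ := exists_majorant_primitive ha' haa hb hb' hc hc' habc habc'
    hz0 hz1
  have hT := finite_branch z
  have hae := hT.countable.ae_notMem volume
  have t1 : ∀ a b c : ℝ, ∀ x ∉ ({0, Real.log ‖z‖} : Set ℝ), _ := fun a b c x hx =>
    tendsto_logIntegrand_neg_pi (a := a) (b := b) (c := c) (x := x) hz (by simp at hx; tauto)
  have t2 : ∀ a b c : ℝ, ∀ x ∉ ({0, Real.log ‖z‖} : Set ℝ), _ := fun a b c x hx =>
    tendsto_logIntegrand_arg_left (a := a) (b := b) (c := c) (x := x) hz (by simp at hx; tauto)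
  have t3 : ∀ a b c : ℝ, ∀ x ∉ ({0, Real.log ‖z‖} : Set ℝ), _ := fun a b c x hx =>
    tendsto_logIntegrand_arg_right (a := a) (b := b) (c := c) (x := x) hz (by simp at hx; tauto)
  have t4 : ∀ a b c : ℝ, ∀ x ∉ ({0, Real.log ‖z‖} : Set ℝ), _ := fun a b c x hx =>
    tendsto_logIntegrand_pi (a := a) (b := b) (c := c) (x := x) hz (by simp at hx; tauto)
  have hsub1 : Ioo (-π) ψ ⊆ Ioo (-π) π := Ioo_subset_Ioo_right hψ.2.le
  have hsub2 : Ioo ψ π ⊆ Ioo (-π) π := Ioo_subset_Ioo_left hψ.1.le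
  have hint1 := hint.mono_measure (Measure.prod_mono (le_refl volume)
    (Measure.restrict_mono hsub1 (le_refl volume)))
  have hint2 := hint.mono_measure (Measure.prod_mono (le_refl volume)
    (Measure.restrict_mono hsub2 (le_refl volume)))
  have b1 := strip_bilinear hψ.1 (differentiableOn_logIntegrand_lower hz)
    (differentiableOn_logIntegrand_lower hz) hT (fun x hx y _ => hκb x hx y) hκ hκ0
    (fun x hx y _ => hΦb x hx y) hΦ hΦ0 hΦ1 hint1 (hae.mono (t1 a' b' c')) (hae.mono (t2 a' b' c'))
    (hae.mono (t1 a b c)) (hae.mono (t2 a b c))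
  have b2 := strip_bilinear hψ.2 (differentiableOn_logIntegrand_upper hz)
    (differentiableOn_logIntegrand_upper hz) hT (fun x hx y _ => hκb x hx y) hκ hκ0
    (fun x hx y _ => hΦb x hx y) hΦ hΦ0 hΦ1 hint2 (hae.mono (t3 a' b' c')) (hae.mono (t4 a' b' c'))
    (hae.mono (t3 a b c)) (hae.mono (t4 a b c))
  have i1 := integrable_boundary hT (differentiableOn_logIntegrand_lower hz)
    (fun x hx y _ => hκb x hx y) hκ hΦ (fun x hx y _ => hΦb x hx y) (Ioo_mem_nhdsGT hψ.1)
    (measurable_twist (measurable_rayOne a b c z)) (t1 a' b' c') (t1 a b c)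
    (measurable_twist (measurable_rayOne a' b' c' z))
  have i2 := integrable_boundary hT (differentiableOn_logIntegrand_lower hz)
    (fun x hx y _ => hκb x hx y) hκ hΦ (fun x hx y _ => hΦb x hx y) (Ioo_mem_nhdsLT hψ.1)
    (measurable_twist (measurable_rayZ a b c z)) (t2 a' b' c') (t2 a b c)
    (measurable_twist (measurable_rayZ a' b' c' z))
  have i3 := integrable_boundary hT (differentiableOn_logIntegrand_upper hz)
    (fun x hx y _ => hκb x hx y) hκ hΦ (fun x hx y _ => hΦb x hx y) (Ioo_mem_nhdsGT hψ.2)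
    (measurable_twist (measurable_rayZ a b c z)) (t3 a' b' c') (t3 a b c)
    (measurable_twist (measurable_rayZ a' b' c' z))
  have i4 := integrable_boundary hT (differentiableOn_logIntegrand_upper hz)
    (fun x hx y _ => hκb x hx y) hκ hΦ (fun x hx y _ => hΦb x hx y) (Ioo_mem_nhdsLT hψ.2)
    (measurable_twist (measurable_rayOne a b c z)) (t4 a' b' c') (t4 a b c)
    (measurable_twist (measurable_rayOne a' b' c' z))
  have hU : ∀ a : ℝ, Complex.exp ((a + 1 : ℝ) * (π * Complex.I)) =
      Complex.exp (π * Complex.I * ((a + 1 : ℝ) : ℂ)) := fun a => by rw [mul_comm]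
  have hUV : ∀ a b : ℝ, Complex.exp (π * Complex.I * ((a + 1 : ℝ) : ℂ)) *
      Complex.exp (π * Complex.I * b) = Complex.exp (π * Complex.I * ((a + 1 + b : ℝ) : ℂ)) :=
    fun a b => by rw [← Complex.exp_add]; push_cast; ring_nf
  simp only [hU, hUV] at b1 b2 i1 i4
  have j1 := jump_integral (conj_exp_mul_exp_of_int (s := a + 1) (t := a' + 1) (by simpa using hia))
    (conj_exp_mul_exp_of_int (s := a + 1 + b) (t := a' + 1 + b') (by
      obtain ⟨i, hi⟩ := hia
      obtain ⟨j, hj⟩ := hib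
      exact ⟨i + j, by push_cast; linarith⟩))
    (integrable_rayOne ha' hb' hc' habc' hz) i4 i1
  have j2 := jump_integral (u := 1) (u' := 1) (by simp) (conj_exp_mul_exp_of_int hic)
    (integrable_rayZ ha' hb' hc' habc' hz) i2 i3
  have s1 : conj (Complex.exp (π * Complex.I * ((a' + 1 : ℝ) : ℂ))) *
      Complex.exp (π * Complex.I * ((a + 1 + b : ℝ) : ℂ)) -
      Complex.exp (π * Complex.I * ((a' + 1 : ℝ) : ℂ)) *
        conj (Complex.exp (π * Complex.I * ((a + 1 + b : ℝ) : ℂ))) =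
      2 * Complex.I * (sin (π * (a - a' + b)) : ℝ) := by
    rw [← exp_sub_conj_exp, conj_exp_pi_mul, conj_exp_pi_mul, conj_exp_pi_mul, ← Complex.exp_add,
      ← Complex.exp_add]
    push_cast
    ring_nf
  have s2 := exp_sub_conj_exp c
  rw [s1] at j1
  simp only [map_one, one_mul] at j2 b1 b2
  rw [s2] at j2
  set f : ℝ → ℂ := fun y => ∫ x : ℝ, conj (logIntegrand a' b' c' z (x + y * Complex.I)) *
      logIntegrand a b c z (x + y * Complex.I) with hf
  have hsum : ∫ y in Ioo (-π) π, f y = (∫ y in Ioo (-π) ψ, f y) + ∫ y in Ioo ψ π, f y := by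
    have hfi : IntegrableOn f (Ioo (-π) π) := hint.integral_prod_right
    rw [← integral_Ioc_eq_integral_Ioo, ← integral_Ioc_eq_integral_Ioo,
      ← integral_Ioc_eq_integral_Ioo, ← Ioc_union_Ioc_eq_Ioc hψ.1.le hψ.2.le,
      setIntegral_union (Ioc_disjoint_Ioc_of_le le_rfl) measurableSet_Ioc]
    · exact (integrableOn_Ioc_iff_integrableOn_Ioo (by finiteness)).2 (hfi.mono_set hsub1)
    · exact (integrableOn_Ioc_iff_integrableOn_Ioo (by finiteness)).2 (hfi.mono_set hsub2)
  rw [hsum]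
  refine mul_left_cancel₀ (show (2 * Complex.I : ℂ) ≠ 0 by simp) ?_
  -- The outer edges `±π` are the two sides of the ray through `-1` (`j1`), and the edges at `ψ` are
  -- the two sides of the ray through `-z` (`j2`).
  linear_combination -b1 - b2 - j1 - j2

/-- The Jacobian is `exp ζ * conj (exp ζ)`, one factor for each form; this accounts for the exponent
`a + 1` in `logIntegrand`. Writing `w - z = -z (1 + exp ζ / z)` extracts the single-valued power of
`-z`. -/
lemma correlatorIntegrand_neg_exp {A B C : ℝ} {n n' m m' p p' : ℤ} {z ζ : ℂ} (hz : z ≠ 0)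
    (h1 : 1 + Complex.exp ζ ≠ 0) (h2 : 1 + Complex.exp ζ / z ≠ 0) :
    ((rexp ζ.re ^ 2 : ℝ) : ℂ) * correlatorIntegrand A B C n n' m m' p p' z (-Complex.exp ζ) =
      ((-1) ^ (n - n') * (-1) ^ (m - m') * powPair C p p' (-z)) *
        (conj (logIntegrand (A + n') (B + m') (C + p') z ζ) *
          logIntegrand (A + n) (B + m) (C + p) z ζ) := by
  have e1 : -Complex.exp ζ - 1 = -(1 + Complex.exp ζ) := by ring
  have e2 : -Complex.exp ζ - z = -z * (1 + Complex.exp ζ / z) := by field_simp; ring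
  have e3 : ((rexp ζ.re ^ 2 : ℝ) : ℂ) = Complex.exp ζ * conj (Complex.exp ζ) := by
    rw [Complex.mul_conj', Complex.norm_exp]; push_cast; rfl
  have e4 : ∀ s : ℝ, Complex.exp ((s + 1 : ℝ) * ζ) = Complex.exp (s * ζ) * Complex.exp ζ := by
    intro s
    rw [← Complex.exp_add]; push_cast; ring_nf
  rw [correlatorIntegrand, e1, e2, powPair_mul, powPair_neg, powPair_neg, powPair_exp,
    powPair_eq_cpow h1, powPair_eq_cpow h2, e3, logIntegrand, logIntegrand, e4, e4]
  simp only [map_mul]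
  ring

/-- The correlator in terms of integrals along the rays through the branch points. -/
theorem correlator_eq_rays {A B C : ℝ} {n n' m m' p p' : ℤ} {z : ℂ}
    (ha' : -1 < A + n') (haa : -2 < A + n + (A + n')) (hb : -1 < B + m) (hb' : -1 < B + m')
    (hc : -1 < C + p) (hc' : -1 < C + p') (habc : A + n + (B + m) + (C + p) < -1)
    (habc' : A + n' + (B + m') + (C + p') < -1) (hz : -z ∈ Complex.slitPlane) :
    correlator A B C n n' m m' p p' z =
      ((-1) ^ (n - n') * (-1) ^ (m - m') * powPair C p p' (-z)) *
      -(sin (π * (A + n - (A + n') + (B + m))) *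
          (conj (∫ s in Iic 0, rayOne (A + n') (B + m') (C + p') z s) *
            ∫ s in Ioi 0, rayOne (A + n) (B + m) (C + p) z s) +
        sin (π * (C + p)) *
          (conj (∫ s in Iic (Real.log ‖z‖), rayZ (A + n') (B + m') (C + p') z s) *
            ∫ s in Ioi (Real.log ‖z‖), rayZ (A + n) (B + m) (C + p) z s)) := by
  have hz0 := ne_zero_of_neg_mem_slitPlane hz
  have hψ := neg_arg_mem hz
  set ψ := (-z).arg with hψdef
  set D : ℂ := (-1) ^ (n - n') * (-1) ^ (m - m') * powPair C p p' (-z) with hD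
  have hD0 : D ≠ 0 := by
    refine mul_ne_zero (mul_ne_zero (zpow_ne_zero _ (by norm_num)) (zpow_ne_zero _ (by norm_num))) ?_
    rw [← norm_ne_zero_iff, norm_powPair (neg_ne_zero.2 hz0)]
    exact (Real.rpow_pos_of_pos (norm_pos_iff.2 (neg_ne_zero.2 hz0)) _).ne'
  have hi := integrable_correlatorIntegrand (A := A) (B := B) (C := C) (n := n) (n' := n') (m := m)
    (m' := m') (p := p) (p' := p') hz0 (ne_one_of_neg_mem_slitPlane hz) haa (by linarith)
    (by linarith) (by linarith)
  obtain ⟨hint, heq⟩ := exp_change_of_variables hi.comp_neg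
  -- The line `y = ψ` contains the zero of `1 + exp ζ / z` and is discarded as a null set.
  have hpt : ∀ x y : ℝ, y ∈ Ioo (-π) π → y ≠ ψ → _ := fun x y hy hyψ =>
    correlatorIntegrand_neg_exp (A := A) (B := B) (C := C) (n := n) (n' := n') (m := m)
      (m' := m') (p := p) (p' := p') (ζ := x + y * Complex.I) hz0
      (Complex.slitPlane_ne_zero (one_add_exp_mem_slitPlane (by simpa using hy)))
      (Complex.slitPlane_ne_zero (one_add_exp_div_mem_slitPlane hz0 (by
        rcases hyψ.lt_or_gt with h | h
        · left; simpa using ⟨hy.1, h⟩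
        · right; simpa using ⟨h, hy.2⟩) hψ.2))
  have hre : ∀ x y : ℝ, ((x : ℂ) + y * Complex.I).re = x := by simp
  simp only [hre] at hpt
  have hy : ∀ᵐ y ∂(volume.restrict (Ioo (-π) π)), y ∈ Ioo (-π) π ∧ y ≠ ψ :=
    (ae_restrict_mem measurableSet_Ioo).and (ae_restrict_of_ae
      (compl_mem_ae_iff.2 (measure_singleton (μ := (volume : Measure ℝ)) ψ)))
  have hint' : Integrable (fun q : ℝ × ℝ =>
      conj (logIntegrand (A + n') (B + m') (C + p') z (q.1 + q.2 * Complex.I)) *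
      logIntegrand (A + n) (B + m) (C + p) z (q.1 + q.2 * Complex.I))
      (volume.prod (volume.restrict (Ioo (-π) π))) := by
    refine (hint.const_mul D⁻¹).congr ?_
    filter_upwards [Measure.quasiMeasurePreserving_snd.ae hy] with q hq
    show D⁻¹ * (((rexp q.1 ^ 2 : ℝ) : ℂ) * correlatorIntegrand A B C n n' m m' p p' z
      (-Complex.exp (q.1 + q.2 * Complex.I))) = _
    rw [hpt q.1 q.2 hq.1 hq.2, ← mul_assoc, inv_mul_cancel₀ hD0, one_mul]
  rw [correlator, ← integral_neg_eq_self, heq, ← integral_conj_mul_logIntegrand ha' haa hb hb' hc hc'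
    habc habc' hz ⟨n - n', by push_cast; ring⟩ ⟨m - m', by push_cast; ring⟩
    ⟨p - p', by push_cast; ring⟩ hint', ← integral_const_mul]
  refine integral_congr_ae ?_
  filter_upwards [hy] with y hy
  rw [← integral_const_mul]
  refine integral_congr_ae (Eventually.of_forall fun x => ?_)
  exact hpt x y hy.1 hy.2

/-! ### Ray integrals as Aomoto-Gel'fand integrals -/

lemma cpow_ofReal_mul {t : ℝ} (ht : 0 < t) {w : ℂ} (hw : w ≠ 0) (s : ℂ) :
    ((t : ℂ) * w) ^ s = (t : ℂ) ^ s * w ^ s := by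
  rw [Complex.cpow_def_of_ne_zero (mul_ne_zero (by exact_mod_cast ht.ne') hw),
    Complex.cpow_def_of_ne_zero (by exact_mod_cast ht.ne'), Complex.cpow_def_of_ne_zero hw,
    Complex.log_ofReal_mul ht hw, ← Complex.exp_add, Complex.ofReal_log ht.le, add_mul]

/-- The arguments of `-z` and `1 - r / z` never have the same strict sign, so their sum stays in the
principal range and the logarithms add. -/
lemma sub_cpow_eq {z : ℂ} (hz : -z ∈ Complex.slitPlane) {r : ℝ} (hr : 0 < r) (s : ℂ) :
    ((r : ℂ) - z) ^ s = (-z) ^ s * (1 - r / z) ^ s := by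
  have hz0 := ne_zero_of_neg_mem_slitPlane hz
  have hm : 1 - (r : ℂ) / z ∈ Complex.slitPlane := by
    have := one_sub_exp_div_mem_slitPlane hz (Real.log r)
    rwa [← Complex.ofReal_exp, Real.exp_log hr] at this
  have hm0 := Complex.slitPlane_ne_zero hm
  have hψ := neg_arg_mem hz
  have h1 := Complex.neg_pi_lt_arg (1 - (r : ℂ) / z)
  have h2 := Complex.arg_le_pi (1 - (r : ℂ) / z)
  have him : (1 - (r : ℂ) / z).im = r * z.im / Complex.normSq z := by
    rw [Complex.sub_im, Complex.div_im]; simp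
  have hN : 0 < Complex.normSq z := Complex.normSq_pos.2 hz0
  have harg : (-z).arg + (1 - (r : ℂ) / z).arg ∈ Ioc (-π) π := by
    rcases lt_trichotomy z.im 0 with h | h | h
    · have : (1 - (r : ℂ) / z).arg < 0 := by
        rw [Complex.arg_neg_iff, him]
        exact div_neg_of_neg_of_pos (mul_neg_of_pos_of_neg hr h) hN
      have h3 : 0 ≤ (-z).arg := by
        rw [Complex.arg_nonneg_iff, Complex.neg_im]; linarith
      exact ⟨by linarith, by linarith [hψ.2]⟩
    · have h4 : (1 - (r : ℂ) / z).im = 0 := by rw [him, h]; simp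
      have : (1 - (r : ℂ) / z).arg = 0 := by
        rw [Complex.arg_eq_zero_iff]
        refine ⟨?_, h4⟩
        rcases hm with h5 | h5
        · exact h5.le
        · exact absurd h4 h5
      rw [this, add_zero]
      exact ⟨hψ.1, hψ.2.le⟩
    · have : 0 ≤ (1 - (r : ℂ) / z).arg := by
        rw [Complex.arg_nonneg_iff, him]; positivity
      have h3 : (-z).arg < 0 := by
        rw [Complex.arg_neg_iff, Complex.neg_im]; linarith
      exact ⟨by linarith [hψ.1], by linarith⟩
  have e : (r : ℂ) - z = -z * (1 - r / z) := by field_simp; ring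
  rw [e, Complex.cpow_def_of_ne_zero (mul_ne_zero (neg_ne_zero.2 hz0) hm0),
    (Complex.log_mul_eq_add_log_iff (neg_ne_zero.2 hz0) hm0).2 harg, add_mul, Complex.exp_add,
    Complex.cpow_def_of_ne_zero (neg_ne_zero.2 hz0), Complex.cpow_def_of_ne_zero hm0]

lemma vecI_zero_eq_ray {a b c : ℝ} {z : ℂ} (hz : -z ∈ Complex.slitPlane) :
    vecI a b c z 0 = (-z) ^ (c : ℂ) * ∫ s in Ioi 0, rayOne a b c z s := by
  have key : ∀ x ∈ Ioi (0 : ℝ), (-z) ^ (c : ℂ) * rayOne a b c z x =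
      rexp x • (fun r : ℝ => (r : ℂ) ^ (a : ℂ) * ((r : ℂ) - 1) ^ (b : ℂ) * ((r : ℂ) - z) ^ (c : ℂ))
        (rexp x) := by
    intro x hx
    have h1 : 0 < rexp x - 1 := sub_pos.2 (Real.one_lt_exp_iff.2 hx)
    simp only
    rw [sub_cpow_eq hz (exp_pos x), rayOne, ← Complex.ofReal_cpow (exp_pos x).le,
      ← Complex.ofReal_one, ← Complex.ofReal_sub, ← Complex.ofReal_cpow h1.le,
      abs_sub_comm, abs_of_pos h1, ← Real.exp_mul, Complex.real_smul]
    push_cast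
    rw [show ((a : ℂ) + 1) * x = x + x * a by ring, Complex.exp_add]
    ring
  rw [← integral_const_mul, setIntegral_congr_fun measurableSet_Ioi key]
  refine Eq.trans ?_ (integral_comp_exp_Ioi (fun r : ℝ =>
    (r : ℂ) ^ (a : ℂ) * ((r : ℂ) - 1) ^ (b : ℂ) * ((r : ℂ) - z) ^ (c : ℂ)) 0).symm
  rw [Real.exp_zero]
  rfl

/-- The normalised second Aomoto-Gel'fand integral. -/
noncomputable def unitIntegral (a b c : ℝ) (z : ℂ) : ℂ :=
  ∫ t in (0 : ℝ)..1, ((t ^ a * (1 - t) ^ c : ℝ) : ℂ) * (1 - t * z) ^ (b : ℂ)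

/-- Scaling `w = t z` with `t` and `1 - t` positive, so that the principal powers of the products
split. -/
lemma vecI_one_eq_unitIntegral {a b c : ℝ} {z : ℂ} (hz : z ≠ 0) :
    vecI a b c z 1 = z * z ^ (a : ℂ) * z ^ (c : ℂ) * unitIntegral a b c z := by
  have : vecI a b c z 1 = segmentIntegral
    (fun w => w ^ (a : ℂ) * (1 - w) ^ (b : ℂ) * (z - w) ^ (c : ℂ)) 0 z := rfl
  rw [this, segmentIntegral, unitIntegral, sub_zero, mul_assoc z, mul_assoc z]
  congr 1
  rw [← intervalIntegral.integral_const_mul]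
  rw [intervalIntegral.integral_of_le zero_le_one, intervalIntegral.integral_of_le zero_le_one,
    integral_Ioc_eq_integral_Ioo, integral_Ioc_eq_integral_Ioo]
  refine setIntegral_congr_fun measurableSet_Ioo fun t ht => ?_
  have h1 : 0 < 1 - t := sub_pos.2 ht.2
  have e : z - (t : ℂ) * z = ((1 - t : ℝ) : ℂ) * z := by push_cast; ring
  simp only [zero_add]
  rw [e, cpow_ofReal_mul ht.1 hz, cpow_ofReal_mul h1 hz, Complex.ofReal_mul,
    Complex.ofReal_cpow ht.1.le, Complex.ofReal_cpow h1.le]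
  ring

lemma integral_comp_exp_Iic (g : ℝ → ℂ) (l : ℝ) :
    ∫ x in Iic l, rexp (x - l) • g (rexp (x - l)) = ∫ t in Ioo 0 1, g t := by
  have himage : (fun x => rexp (x - l)) '' Iio l = Ioo 0 1 := by
    ext t
    constructor
    · rintro ⟨x, hx, rfl⟩
      exact ⟨exp_pos _, by simpa using hx⟩
    · rintro ⟨h0, h1⟩
      refine ⟨Real.log t + l, ?_, by simp [Real.exp_log h0]⟩
      simpa using Real.log_neg h0 h1
  have hd : ∀ x ∈ Iio l, HasDerivWithinAt (fun x => rexp (x - l)) (rexp (x - l)) (Iio l) x :=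
    fun x _ => by simpa using (((hasDerivAt_id x).sub_const l).exp).hasDerivWithinAt
  rw [integral_Iic_eq_integral_Iio, ← himage,
    integral_image_eq_integral_abs_deriv_smul measurableSet_Iio hd]
  · simp only [abs_of_pos (exp_pos _)]
  · intro x _ y _ h
    simpa using exp_injective h

/-- The parameter is `t = exp (x - log ‖z‖)` and the point of the ray is `ω = -t z`. The same unit
integral as for `vecI` appears, but with a power of `-z` instead of `z`. -/
lemma integral_rayZ_eq {a b c : ℝ} {z : ℂ} (hz : z ≠ 0) :
    ∫ s in Iic (Real.log ‖z‖), rayZ a b c z s = -z * (-z) ^ (a : ℂ) * unitIntegral a b c z := by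
  set l := Real.log ‖z‖ with hl
  have hnz : -z ≠ 0 := neg_ne_zero.2 hz
  have hlog : Complex.log (-z) = l + (-z).arg * Complex.I := by rw [Complex.log, norm_neg]
  have key : ∀ x ∈ Iio l, rayZ a b c z x = rexp (x - l) • (fun t : ℝ =>
      (-z * (-z) ^ (a : ℂ)) * (((t ^ a * (1 - t) ^ c : ℝ) : ℂ) * (1 - t * z) ^ (b : ℂ)))
        (rexp (x - l)) := by
    intro x hx
    have h1 : 0 < 1 - rexp (x - l) := by simpa using hx
    have e1 : (x : ℂ) + (-z).arg * Complex.I = ((x - l : ℝ) : ℂ) + Complex.log (-z) := by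
      rw [hlog]; push_cast; ring
    have e2 : 1 + Complex.exp (((x - l : ℝ) : ℂ) + Complex.log (-z)) =
        1 - (rexp (x - l) : ℂ) * z := by
      rw [Complex.exp_add, Complex.exp_log hnz]; push_cast; ring
    simp only
    rw [rayZ, e1, e2, abs_of_pos h1, ← Real.exp_mul, Complex.real_smul,
      Complex.cpow_def_of_ne_zero hnz]
    have e3 : Complex.exp (((a + 1 : ℝ) : ℂ) * (((x - l : ℝ) : ℂ) + Complex.log (-z))) =
        Complex.exp ((x - l : ℝ)) * -z * Complex.exp (Complex.log (-z) * a) *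
          Complex.exp (((x - l) * a : ℝ)) := by
      nth_rewrite 2 [← Complex.exp_log hnz]
      rw [← Complex.exp_add, ← Complex.exp_add, ← Complex.exp_add]
      push_cast
      ring_nf
    rw [e3]
    push_cast
    ring
  rw [integral_Iic_eq_integral_Iio, setIntegral_congr_fun measurableSet_Iio key,
    ← integral_Iic_eq_integral_Iio]
  refine (integral_comp_exp_Iic (fun t : ℝ => (-z * (-z) ^ (a : ℂ)) *
    (((t ^ a * (1 - t) ^ c : ℝ) : ℂ) * (1 - t * z) ^ (b : ℂ))) l).trans ?_
  rw [integral_const_mul, unitIntegral, intervalIntegral.integral_of_le zero_le_one,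
    integral_Ioc_eq_integral_Ioo]

/-! ### Signs, and the factorisation off the positive axis -/

lemma sin_pi_mul_add_int (x : ℝ) (k : ℤ) : sin (π * (x + k)) = parity k * sin (π * x) := by
  rw [show π * (x + k) = π * x + k * π by ring, Real.sin_add_int_mul_pi, parity]

lemma parity_mul_self (k : ℤ) : parity k * parity k = 1 := by
  rw [parity, ← mul_zpow]; norm_num

lemma parity_add (k l : ℤ) : parity (k + l) = parity k * parity l :=
  zpow_add₀ (by norm_num) k l

lemma parity_neg (k : ℤ) : parity (-k) = parity k := by
  rw [parity, parity, _root_.zpow_neg, ← _root_.inv_zpow]; norm_num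

lemma parity_sub (k l : ℤ) : parity (k - l) = parity k * parity l := by
  rw [sub_eq_add_neg, parity_add, parity_neg]

lemma ofReal_parity (k : ℤ) : (parity k : ℂ) = (-1) ^ k := by simp [parity]

lemma bilin_smul_diagonal (u v : Fin 2 → ℂ) (r s t : ℝ) :
    bilin u (r • !![s, 0; 0, t]) v = r * (s * (u 0 * v 0) + t * (u 1 * v 1)) := by
  simp [bilin, Matrix.mulVec, dotProduct, Fin.sum_univ_two]
  ring

/-- The integral over `(0,1)` with barred exponents and the one over `(z,∞)` with unbarred exponents
are eliminated by the contour relations. Powers of `-z` and of `z` enter only in single-valued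
combinations, where they differ by a sign. -/
theorem correlator_eq_bilin_vecI_of_neg_mem_slitPlane {A B C : ℝ} {n n' m m' p p' : ℤ} {z : ℂ}
    (h : Convergent (A + n) (B + m) (C + p)) (h' : Convergent (A + n') (B + m') (C + p'))
    (hs : sin (π * (A + C)) ≠ 0) (hz : -z ∈ Complex.slitPlane) :
    correlator A B C n n' m m' p p' z =
      bilin (star (vecI (A + n') (B + m') (C + p') z)) (matG A B C m m' p p')
        (vecI (A + n) (B + m) (C + p) z) := by
  obtain ⟨ha, hb, hc, habc⟩ := h
  obtain ⟨ha', hb', hc', habc'⟩ := h'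
  have hz0 := ne_zero_of_neg_mem_slitPlane hz
  have r1 := congrArg conj (contour_relations ha' hb' hc' habc' hz).1
  have r2 := (contour_relations ha hb hc habc hz).2
  have hs' : ((sin (π * (A + C)) : ℝ) : ℂ) ≠ 0 := by exact_mod_cast hs
  have eC : powPair C p p' (-z) = powPair C p p' z * (parity p * parity p' : ℝ) := by
    rw [powPair_neg, ← ofReal_parity, parity_sub, mul_comm]
  have eA : (-z) ^ ((A + n : ℝ) : ℂ) * conj ((-z) ^ ((A + n' : ℝ) : ℂ)) =
      z ^ ((A + n : ℝ) : ℂ) * conj (z ^ ((A + n' : ℝ) : ℂ)) * (parity n * parity n' : ℝ) := by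
    rw [← powPair_eq_cpow hz0, ← powPair_eq_cpow (neg_ne_zero.2 hz0), powPair_neg,
      ← ofReal_parity, parity_sub, mul_comm]
  have eC1 := powPair_eq_cpow (A := C) (k := p) (k' := p') hz0
  have eC2 := powPair_eq_cpow (A := C) (k := p) (k' := p') (neg_ne_zero.2 hz0)
  rw [correlator_eq_rays ha' (by linarith) hb hb' hc hc' habc habc' hz, matG, bilin_smul_diagonal,
    Pi.star_apply, Pi.star_apply, vecI_zero_eq_ray hz, vecI_zero_eq_ray hz,
    vecI_one_eq_unitIntegral hz0, vecI_one_eq_unitIntegral hz0]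
  have s1 : sin (π * (A + n' + (C + p'))) = parity n' * parity p' * sin (π * (A + C)) := by
    rw [← parity_add, ← sin_pi_mul_add_int]; push_cast; ring_nf
  have s2 : sin (π * (A + n + (C + p))) = parity n * parity p * sin (π * (A + C)) := by
    rw [← parity_add, ← sin_pi_mul_add_int]; push_cast; ring_nf
  have s3 : sin (π * (A + n' + (B + m') + (C + p'))) =
      parity n' * parity m' * parity p' * sin (π * (A + B + C)) := by
    rw [← parity_add, ← parity_add, ← sin_pi_mul_add_int]; push_cast; ring_nf
  have s4 : sin (π * (A + n - (A + n') + (B + m))) =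
      parity n * parity n' * parity m * sin (π * B) := by
    rw [← parity_sub, ← parity_add, ← sin_pi_mul_add_int]; push_cast; ring_nf
  simp only [s1, s2, s3, s4, sin_pi_mul_add_int, integral_rayZ_eq hz0, ← ofReal_parity,
    parity_sub, parity_add, map_mul, map_neg, map_add, Complex.conj_ofReal,
    RCLike.star_def, Complex.ofReal_mul, Complex.ofReal_div, Complex.ofReal_one] at r1 r2 eA eC eC2 ⊢
  generalize (∫ s in Ioi 0, rayOne (A + n) (B + m) (C + p) z s) = x at *
  generalize (conj (∫ s in Ioi 0, rayOne (A + n') (B + m') (C + p') z s)) = x' at *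
  generalize (conj (∫ s in Iic 0, rayOne (A + n') (B + m') (C + p') z s)) = y' at *
  generalize (∫ s in Ioi (Real.log ‖z‖), rayZ (A + n) (B + m) (C + p) z s) = q at *
  generalize unitIntegral (A + n) (B + m) (C + p) z = u at *
  generalize conj (unitIntegral (A + n') (B + m') (C + p') z) = u' at *
  have sq : ∀ k, (parity k : ℂ) * parity k = 1 := fun k => by exact_mod_cast parity_mul_self k
  have n1 := sq n
  have n2 := sq n'
  have m1 := sq m
  have m2 := sq m'
  have p1 := sq p
  have p2 := sq p'
  generalize (parity n : ℂ) = en at *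
  generalize (parity n' : ℂ) = en' at *
  generalize (parity m : ℂ) = em at *
  generalize (parity m' : ℂ) = em' at *
  generalize (parity p : ℂ) = ep at *
  generalize (parity p' : ℂ) = ep' at *
  rw [one_div, eq_inv_mul_iff_mul_eq₀ hs', eC2]
  rw [eC1, eC2] at eC
  clear s1 s2 s3 s4 sq eC1 eC2 hs
  generalize ((sin (π * (A + C)) : ℝ) : ℂ) = SAC at *
  generalize ((sin (π * (A + B + C)) : ℝ) : ℂ) = SABC at *
  generalize ((sin (π * A) : ℝ) : ℂ) = SA at *
  generalize ((sin (π * B) : ℝ) : ℂ) = SB at *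
  generalize ((sin (π * C) : ℝ) : ℂ) = SC at *
  generalize (-z) ^ ((A + n : ℝ) : ℂ) = a₁ at *
  generalize conj ((-z) ^ ((A + n' : ℝ) : ℂ)) = a₁' at *
  generalize z ^ ((A + n : ℝ) : ℂ) = a₀ at *
  generalize conj (z ^ ((A + n' : ℝ) : ℂ)) = a₀' at *
  generalize (-z) ^ ((C + p : ℝ) : ℂ) = c₁ at *
  generalize conj ((-z) ^ ((C + p' : ℝ) : ℂ)) = c₁' at *
  generalize z ^ ((C + p : ℝ) : ℂ) = c₀ at *
  generalize conj (z ^ ((C + p' : ℝ) : ℂ)) = c₀' at *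
  generalize conj z = z' at *
  have hY : SAC * y' = en' * SC * (z' * a₁' * u') - em' * SABC * x' := by
    linear_combination en' * ep' * r1 - (SAC * y' + em' * SABC * x') * (en' * en' * p2 + n2) +
      en' * SC * (z' * a₁' * u') * p2
  have hQ : SAC * q = en * em * ep * SB * x + ep * SA * (z * a₁ * u) := by
    linear_combination en * ep * r2 - SAC * q * (en * en * p1 + n1) + ep * SA * (z * a₁ * u) * n1
  -- The mixed products `u' * x` from `hY` and `hQ` cancel. The products `x * x'` and `u * u'` give
  -- the two diagonal entries; `eA` and `eC` trade `-z` for `z`, and the squares of signs are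
  -- cleared by `n1`, …, `p1`.
  linear_combination
    en * en' * em * em' * (c₁ * c₁') * (ep * SC * (z' * a₁' * u') * hQ - en * en' * em * SB * x * hY) +
    c₁ * c₁' * SC * (z' * a₁' * u') * SB * x * en' * em' * (en * en) * (em * em) * (p1 - n2) +
    c₁ * c₁' * SB * SABC * x * x' * (en' * en' * (em * em) * (em' * em') * n1 +
      em * em * (em' * em') * n2 + em' * em' * m1 + m2) +
    em * em' * SC * SA * z' * z * u * u' * (en * en' * (ep * ep) * (c₁ * c₁') * eA +
      en * en * (en' * en') * (ep * ep) * (a₀ * a₀') * eC +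
      a₀ * a₀' * (c₀ * c₀') * (ep * ep') * (en' * en' * (ep * ep) * n1 + ep * ep * n2 + p1))

/-! ### Continuity of the correlator in `z` -/

lemma continuousAt_powPair {A : ℝ} {k k' : ℤ} {w : ℂ} (hw : w ≠ 0) :
    ContinuousAt (powPair A k k') w := by
  have h1 : ContinuousAt (fun w : ℂ => ‖w‖ ^ (2 * A)) w :=
    continuous_norm.continuousAt.rpow_const (Or.inl (norm_ne_zero_iff.2 hw))
  exact ((Complex.continuous_ofReal.continuousAt.comp h1).mul
    (continuousAt_id.zpow₀ k (Or.inl hw))).mul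
    (Complex.continuous_conj.continuousAt.zpow₀ k' (Or.inl (by simpa using hw)))

/-- Near a point `z₀` away from `0` and `1`, the correlator integrand on the disc around `z`
is dominated after translation to the origin. -/
lemma tendsto_integral_ball {A B C : ℝ} {n n' m m' p p' : ℤ} {z₀ : ℂ} {ρ : ℝ} (hρ : 0 < ρ)
    (h0 : 2 * ρ < ‖z₀‖) (h1 : 2 * ρ < ‖z₀ - 1‖) (hc : -2 < (C + p) + (C + p')) :
    Tendsto (fun z => ∫ w in Metric.ball z ρ, correlatorIntegrand A B C n n' m m' p p' z w)
      (𝓝 z₀) (𝓝 (∫ w in Metric.ball z₀ ρ, correlatorIntegrand A B C n n' m m' p p' z₀ w)) := by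
  -- After translation the singular factor no longer depends on `z`; the other two stay regular,
  -- since the disc keeps away from `0` and `1`.
  have e : ∀ z, ∫ w in Metric.ball z ρ, correlatorIntegrand A B C n n' m m' p p' z w =
      ∫ v in Metric.ball 0 ρ, powPair A n n' (v + z) * powPair B m m' (v + z - 1) *
        powPair C p p' v := by
    intro z
    rw [← integral_indicator measurableSet_ball, ← integral_indicator measurableSet_ball,
      ← integral_add_right_eq_self _ z]
    congr 1 with v
    by_cases hv : ‖v‖ < ρ <;> simp [indicator, correlatorIntegrand, hv]
  simp only [e]
  set a := A + n + (A + n')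
  set b := B + m + (B + m')
  set c := C + p + (C + p')
  refine tendsto_integral_filter_of_dominated_convergence
    (fun v => (ρ ^ a + (ρ + ‖z₀‖ + 1) ^ a) * (ρ ^ b + (ρ + ‖z₀ - 1‖ + 1) ^ b) * near ρ c ‖v - 0‖)
    (Eventually.of_forall fun z => Measurable.aestronglyMeasurable ?_) ?_ ?_ ?_
  · exact (((measurable_powPair _ _ _).comp (by fun_prop)).mul
      ((measurable_powPair _ _ _).comp (by fun_prop))).mul (measurable_powPair _ _ _)
  · have n0 : ∀ᶠ z : ℂ in 𝓝 z₀, 2 * ρ < ‖z‖ ∧ ‖z‖ < ‖z₀‖ + 1 :=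
      (continuous_norm.tendsto z₀).eventually (Ioo_mem_nhds h0 (by linarith))
    have n1 : ∀ᶠ z : ℂ in 𝓝 z₀, 2 * ρ < ‖z - 1‖ ∧ ‖z - 1‖ < ‖z₀ - 1‖ + 1 :=
      ((continuous_norm.comp (continuous_sub_right 1)).tendsto z₀).eventually
        (Ioo_mem_nhds h1 (by simp))
    filter_upwards [n0, n1] with z hz0 hz1
    filter_upwards [ae_restrict_mem measurableSet_ball,
      ae_restrict_of_ae (compl_mem_ae_iff.2 (measure_singleton (μ := (volume : Measure ℂ)) 0))]
      with v hv hv0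
    have hv : ‖v‖ < ρ := by simpa using hv
    have l0 : ρ ≤ ‖v + z‖ := by
      have := norm_sub_le (v + z) v
      simp only [add_sub_cancel_left] at this
      linarith
    have l1 : ρ ≤ ‖v + z - 1‖ := by
      have := norm_sub_le (v + z - 1) v
      rw [show v + z - 1 - v = z - 1 by ring] at this
      linarith
    have u0 := norm_add_le v z
    have u1 := norm_add_le v (z - 1)
    rw [← add_sub_assoc] at u1
    rw [norm_mul, norm_mul, norm_powPair hv0, norm_powPair (norm_pos_iff.1 (hρ.trans_le l0)),
      norm_powPair (norm_pos_iff.1 (hρ.trans_le l1)), sub_zero, near, if_pos hv]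
    gcongr
    · exact rpow_le_add_rpow hρ l0 (by linarith)
    · exact rpow_le_add_rpow hρ l1 (by linarith)
  · exact ((integrable_near (volume : Measure ℂ) (by rw [Complex.finrank_real_complex]; norm_num)
      (by rw [Complex.finrank_real_complex]; exact_mod_cast hc) ρ 0).const_mul _).integrableOn
  · filter_upwards [ae_restrict_mem measurableSet_ball] with v hv
    have hv : ‖v‖ < ρ := by simpa using hv
    have l0 : v + z₀ ≠ 0 := fun h => by
      have := norm_sub_le (v + z₀) v
      rw [add_sub_cancel_left, h, norm_zero] at this
      linarith
    have l1 : v + z₀ - 1 ≠ 0 := fun h => by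
      have := norm_sub_le (v + z₀ - 1) v
      rw [show v + z₀ - 1 - v = z₀ - 1 by ring, h, norm_zero] at this
      linarith
    have c0 : ContinuousAt (fun z => powPair A n n' (v + z)) z₀ :=
      ContinuousAt.comp (f := fun z => v + z) (continuousAt_powPair l0) (by fun_prop)
    have c1 : ContinuousAt (fun z => powPair B m m' (v + z - 1)) z₀ :=
      ContinuousAt.comp (f := fun z => v + z - 1) (continuousAt_powPair l1) (by fun_prop)
    exact ((c0.mul c1).mul continuousAt_const).tendsto

/-- Outside the moving disc the factor at `z` is comparable to a power of `1 + ‖w‖`, uniformly for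
`z` near `z₀`, so `weight` at the fixed point `z₀` dominates. -/
lemma tendsto_integral_compl_ball {A B C : ℝ} {n n' m m' p p' : ℤ} {z₀ : ℂ} {ρ : ℝ} (hρ : 0 < ρ)
    (h : 2 * ρ ≤ 1) (h0 : 2 * ρ ≤ ‖z₀‖) (h1 : 2 * ρ ≤ ‖z₀ - 1‖) (ha : -2 < (A + n) + (A + n'))
    (hb : -2 < (B + m) + (B + m')) (hc : -2 < (C + p) + (C + p'))
    (habc : (A + n) + (A + n') + ((B + m) + (B + m')) + ((C + p) + (C + p')) < -2) :
    Tendsto (fun z => ∫ w in (Metric.ball z ρ)ᶜ, correlatorIntegrand A B C n n' m m' p p' z w)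
      (𝓝 z₀) (𝓝 (∫ w in (Metric.ball z₀ ρ)ᶜ, correlatorIntegrand A B C n n' m m' p p' z₀ w)) := by
  simp only [← integral_indicator measurableSet_ball.compl]
  set a := A + n + (A + n')
  set b := B + m + (B + m')
  set c := C + p + (C + p')
  obtain ⟨C₀, hC₀, H₀⟩ := rpow_norm_sub_le_near hρ le_rfl a
  obtain ⟨C₁, hC₁, H₁⟩ := rpow_norm_sub_le_near hρ zero_le_one b
  obtain ⟨C₂, hC₂, H₂⟩ := rpow_norm_sub_le_of_le hρ (by positivity : 0 ≤ ‖z₀‖ + 1) c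
  have e0 : ∀ᵐ w : ℂ, w ≠ 0 := compl_mem_ae_iff.2 (measure_singleton 0)
  have e1 : ∀ᵐ w : ℂ, w ≠ 1 := compl_mem_ae_iff.2 (measure_singleton 1)
  have e2 : ∀ᵐ w : ℂ, w ∉ Metric.sphere z₀ ρ :=
    compl_mem_ae_iff.2 (Measure.addHaar_sphere volume z₀ ρ)
  have hbound : ∀ z w : ℂ, w ≠ 0 → w ≠ 1 → ‖z‖ ≤ ‖z₀‖ + 1 →
      ‖(Metric.ball z ρ)ᶜ.indicator (correlatorIntegrand A B C n n' m m' p p' z) w‖ ≤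
      C₀ * C₁ * C₂ * weight ρ a b c z₀ w := by
    intro z w hw0 hw1 hz
    have n0 := near_nonneg (ρ := ρ) (s := a) (norm_nonneg w)
    have n1 := near_nonneg (ρ := ρ) (s := b) (norm_nonneg (w - 1))
    have n2 := near_nonneg (ρ := ρ) (s := c) (norm_nonneg (w - z₀))
    have hN : 0 < 1 + ‖w‖ := by positivity
    by_cases hw : ‖w - z‖ < ρ
    · rw [indicator_of_notMem (by simpa [dist_eq_norm] using hw), norm_zero, weight]
      positivity
    · have hw' := not_lt.1 hw
      rw [indicator_of_mem (by simpa [dist_eq_norm] using hw'), correlatorIntegrand, norm_mul,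
        norm_mul, norm_powPair hw0, norm_powPair (sub_ne_zero.2 hw1),
        norm_powPair (norm_pos_iff.1 (hρ.trans_le hw'))]
      have k0 := H₀ 0 w (by simp)
      have k1 := H₁ 1 w (by simp)
      have k2 := H₂ z w hz hw'
      rw [sub_zero] at k0
      calc ‖w‖ ^ a * ‖w - 1‖ ^ b * ‖w - z‖ ^ c
          ≤ (C₀ * ((1 + ‖w‖) ^ a * (1 + near ρ a ‖w‖))) * (C₁ * ((1 + ‖w‖) ^ b *
            (1 + near ρ b ‖w - 1‖))) * (C₂ * (1 + ‖w‖) ^ c) := by gcongr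
        _ ≤ (C₀ * ((1 + ‖w‖) ^ a * (1 + near ρ a ‖w‖))) * (C₁ * ((1 + ‖w‖) ^ b *
            (1 + near ρ b ‖w - 1‖))) * (C₂ * ((1 + ‖w‖) ^ c * (1 + near ρ c ‖w - z₀‖))) := by
            gcongr
            exact le_mul_of_one_le_right (by positivity) (by linarith)
        _ = C₀ * C₁ * C₂ * weight ρ a b c z₀ w := by
            rw [weight, ← prod_one_add_near_le h h0 h1, rpow_add hN (a + b) c, rpow_add hN a b]
            ring
  refine tendsto_integral_filter_of_dominated_convergence (fun w => C₀ * C₁ * C₂ * weight ρ a b c z₀ w)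
    (Eventually.of_forall fun z => ((measurable_correlatorIntegrand ..).indicator
      measurableSet_ball.compl).aestronglyMeasurable) ?_
    ((integrable_weight ha hb hc habc ρ z₀).const_mul _) ?_
  · filter_upwards [(continuous_norm.tendsto z₀).eventually
      (Iio_mem_nhds (lt_add_one ‖z₀‖))] with z hz
    filter_upwards [e0, e1] with w hw0 hw1 using hbound z w hw0 hw1 (le_of_lt hz)
  -- The indicator of the moving complement is eventually constant in `z` unless `w` lies on the
  -- sphere about `z₀`, a null set.
  · filter_upwards [e2] with w hw
    have hd : Tendsto (fun z => dist w z) (𝓝 z₀) (𝓝 (dist w z₀)) :=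
      (continuous_const.dist continuous_id).tendsto z₀
    rcases lt_or_gt_of_ne hw with h3 | h3
    · refine tendsto_const_nhds.congr' ?_ (f₁ := fun _ => 0) |>.trans (le_of_eq ?_)
      · filter_upwards [hd.eventually (Iio_mem_nhds h3)] with z hz
        rw [indicator_of_notMem (by simpa using hz)]
      · rw [indicator_of_notMem (by simpa using h3)]
    · have hne : w - z₀ ≠ 0 := sub_ne_zero.2 (dist_pos.1 (hρ.trans h3))
      have hcont : ContinuousAt (fun z => correlatorIntegrand A B C n n' m m' p p' z w) z₀ :=
        continuousAt_const.mul (ContinuousAt.comp (f := fun z => w - z)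
          (continuousAt_powPair hne) (by fun_prop))
      refine Tendsto.congr' ?_ (hcont.tendsto.trans (le_of_eq ?_))
      · filter_upwards [hd.eventually (Ioi_mem_nhds h3)] with z hz
        rw [indicator_of_mem (by simpa using le_of_lt hz)]
      · rw [indicator_of_mem (by simpa using le_of_lt h3)]

theorem continuousAt_correlator {A B C : ℝ} {n n' m m' p p' : ℤ} {z₀ : ℂ} (h0 : z₀ ≠ 0)
    (h1 : z₀ ≠ 1) (ha : -2 < (A + n) + (A + n')) (hb : -2 < (B + m) + (B + m'))
    (hc : -2 < (C + p) + (C + p'))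
    (habc : (A + n) + (A + n') + ((B + m) + (B + m')) + ((C + p) + (C + p')) < -2) :
    ContinuousAt (correlator A B C n n' m m' p p') z₀ := by
  obtain ⟨ρ', hρ', h2, h3, h4⟩ := exists_radius h0 h1
  -- A strictly smaller radius supplies the strict inequalities that persist for `z` near `z₀`.
  obtain ⟨ρ, hρ, hlt⟩ := exists_between hρ'
  have key := (tendsto_integral_ball (z₀ := z₀) (A := A) (B := B) (n := n) (n' := n') (m := m) (m' := m') hρ
    (by linarith) (by linarith) hc).add
    (tendsto_integral_compl_ball hρ (by linarith) (by linarith) (by linarith) ha hb hc habc)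
  have e : ∀ z : ℂ, z ≠ 0 → z ≠ 1 →
      (∫ w in Metric.ball z ρ, correlatorIntegrand A B C n n' m m' p p' z w) +
      (∫ w in (Metric.ball z ρ)ᶜ, correlatorIntegrand A B C n n' m m' p p' z w) =
        correlator A B C n n' m m' p p' z := fun z hz0 hz1 =>
    integral_add_compl measurableSet_ball
      (integrable_correlatorIntegrand hz0 hz1 ha hb hc habc)
  rw [e z₀ h0 h1] at key
  refine key.congr' ?_
  filter_upwards [isOpen_ne.mem_nhds h0, isOpen_ne.mem_nhds h1] with z hz0 hz1 using e z hz0 hz1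

/-! ### Approach to the positive real axis from below -/

/-- The principal logarithm takes on the negative axis its limit from above. The bases `t - z` and
`1 - t z` have nonnegative imaginary part when `z` lies below the axis and `t > 0`, which fixes the
side of approach. -/
lemma continuousWithinAt_cpow_const {w s : ℂ} (hw : w ≠ 0) :
    ContinuousWithinAt (fun w => w ^ s) {w | 0 ≤ w.im} w := by
  by_cases h : w ∈ Complex.slitPlane
  · exact (continuousAt_id.cpow continuousAt_const h).continuousWithinAt
  · obtain ⟨h1, h2⟩ : w.re ≤ 0 ∧ w.im = 0 := by
      simpa [Complex.mem_slitPlane_iff] using h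
    have h3 : w.re < 0 := lt_of_le_of_ne h1 fun h => hw (Complex.ext h h2)
    have := Complex.continuousWithinAt_log_of_re_neg_of_im_zero h3 h2
    have key : ContinuousWithinAt (fun w => Complex.exp (Complex.log w * s)) {w | 0 ≤ w.im} w :=
      Complex.continuous_exp.continuousAt.comp_continuousWithinAt (this.mul continuousWithinAt_const)
    refine key.congr_of_eventuallyEq ?_ (Complex.cpow_def_of_ne_zero hw s)
    filter_upwards [nhdsWithin_le_nhds (isOpen_ne.mem_nhds hw)] with v hv
    exact Complex.cpow_def_of_ne_zero hv s

lemma integrableOn_abs_prod {a b c x : ℝ} (h : Convergent a b c) (h0 : x ≠ 0) (h1 : x ≠ 1) :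
    IntegrableOn (fun t : ℝ => t ^ a * |t - 1| ^ b * |t - x| ^ c) (Ioi 0) := by
  obtain ⟨ha, hb, hc, habc⟩ := h
  obtain ⟨ρ, hρ, h2, h3, h4⟩ := exists_radius (z := x) (by exact_mod_cast h0) (by exact_mod_cast h1)
  obtain ⟨K, hK, H⟩ := exists_norm_prod_le_weight hρ h2 h3 h4 a b c
  refine ((integrableOn_radial (σ := 0) (by simpa using ha) hb hc habc ρ ‖(x : ℂ)‖).const_mul K).mono'
    (Measurable.aestronglyMeasurable (by fun_prop)) ?_
  filter_upwards [ae_restrict_mem measurableSet_Ioi,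
    ae_restrict_of_ae (compl_mem_ae_iff.2 (measure_singleton (μ := (volume : Measure ℝ)) 1)),
    ae_restrict_of_ae (compl_mem_ae_iff.2 (measure_singleton (μ := (volume : Measure ℝ)) |x|))]
    with t ht ht1 htx
  have ht : 0 < t := ht
  have hn : ‖(t : ℂ)‖ = t := by simp [abs_of_pos ht]
  have e1 : ‖(t : ℂ) - 1‖ = |t - 1| := by
    rw [← Complex.ofReal_one, ← Complex.ofReal_sub, Complex.norm_real, Real.norm_eq_abs]
  have e2 : ‖(t : ℂ) - x‖ = |t - x| := by
    rw [← Complex.ofReal_sub, Complex.norm_real, Real.norm_eq_abs]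
  have k1 := H t
  have k2 := weight_le_radial (a := a) (b := b) (c := c) (ρ := ρ) (z := x) (w := t) (by linarith)
    (by rw [hn]; exact ht1) (by rw [hn]; simpa using htx)
  rw [hn] at k1 k2
  rw [e1, e2] at k1
  rw [Real.norm_of_nonneg (by positivity), rpow_zero, min_self, one_mul]
  exact k1.trans (by gcongr)

/-- Points approaching a positive real number along its circle about the origin from below. -/
noncomputable def arcBelow (r : ℝ) : Filter ℂ := 𝓝[{z | ‖z‖ = r ∧ z.im < 0}] (r : ℂ)

instance (r : ℝ) : (arcBelow r).IsCountablyGenerated := by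
  unfold arcBelow; infer_instance

lemma eventually_arcBelow (r : ℝ) : ∀ᶠ z in arcBelow r, ‖z‖ = r ∧ z.im < 0 :=
  self_mem_nhdsWithin

lemma arcBelow_le_nhds (r : ℝ) : arcBelow r ≤ 𝓝 (r : ℂ) := nhdsWithin_le_nhds

lemma arcBelow_neBot {r : ℝ} (hr : 0 < r) : (arcBelow r).NeBot := by
  have hcont : Continuous fun θ : ℝ => (r : ℂ) * Complex.exp (θ * Complex.I) := by fun_prop
  have ht : Tendsto (fun θ : ℝ => (r : ℂ) * Complex.exp (θ * Complex.I)) (𝓝[<] 0) (arcBelow r) := by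
    refine tendsto_nhdsWithin_iff.2 ⟨?_, ?_⟩
    · have := hcont.tendsto 0
      simp only [Complex.ofReal_zero, zero_mul, Complex.exp_zero, mul_one] at this
      exact this.mono_left nhdsWithin_le_nhds
    · filter_upwards [Ioo_mem_nhdsLT (by linarith [pi_pos] : -π < 0)] with θ hθ
      refine ⟨by simp [abs_of_pos hr, Complex.norm_exp], ?_⟩
      rw [Complex.im_ofReal_mul, Complex.exp_ofReal_mul_I_im]
      exact mul_neg_of_pos_of_neg hr (sin_neg_of_neg_of_neg_pi_lt hθ.2 hθ.1)
  exact ht.neBot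

lemma tendsto_vecI_zero {a b c r : ℝ} (h : Convergent a b c) (hr : 0 < r) (hr1 : r ≠ 1) :
    Tendsto (fun z => vecI a b c z 0) (arcBelow r) (𝓝 (vecI a b c r 0)) := by
  have i1 := integrableOn_abs_prod h hr.ne' hr1
  have i2 := integrableOn_abs_prod h (neg_ne_zero.2 hr.ne') (by linarith : -r ≠ 1)
  have hsub : Ioi (1 : ℝ) ⊆ Ioi 0 := Ioi_subset_Ioi zero_le_one
  have htr : ∀ᵐ t : ℝ ∂(volume.restrict (Ioi 1)), t ≠ r :=
    ae_restrict_of_ae (compl_mem_ae_iff.2 (measure_singleton r))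
  refine tendsto_integral_filter_of_dominated_convergence _
    (Eventually.of_forall fun z => Measurable.aestronglyMeasurable ?_) ?_
    ((i1.add i2).mono_set hsub) ?_
  · have := Complex.measurable_ofReal
    fun_prop
  · filter_upwards [eventually_arcBelow r] with z hz
    filter_upwards [htr, ae_restrict_mem measurableSet_Ioi] with t htr ht
    have ht0 : 0 < t := hsub ht
    have ht1 : 1 < t := ht
    -- On the circle `‖z‖ = r` the distance to `t` lies between `|t - r|` and `t + r`, so the
    -- majorant does not depend on `z`. This is why the approach is along an arc.
    have k1 : |t - r| ≤ ‖(t : ℂ) - z‖ := by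
      have := abs_norm_sub_norm_le (t : ℂ) z
      rwa [Complex.norm_real, Real.norm_of_nonneg ht0.le, hz.1] at this
    have k2 : ‖(t : ℂ) - z‖ ≤ |t - -r| := by
      have := norm_sub_le (t : ℂ) z
      rw [Complex.norm_real, Real.norm_of_nonneg ht0.le, hz.1] at this
      rwa [sub_neg_eq_add, abs_of_pos (by linarith)]
    have k3 := rpow_le_add_rpow (s := c) (abs_pos.2 (sub_ne_zero.2 htr)) k1 k2
    have e1 : ‖(t : ℂ) - 1‖ = |t - 1| := by
      rw [← Complex.ofReal_one, ← Complex.ofReal_sub, Complex.norm_real, Real.norm_eq_abs]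
    rw [norm_mul, norm_mul, Complex.norm_cpow_real, Complex.norm_cpow_real, Complex.norm_cpow_real,
      Complex.norm_real, Real.norm_of_nonneg ht0.le, e1]
    calc t ^ a * |t - 1| ^ b * ‖(t : ℂ) - z‖ ^ c
        ≤ t ^ a * |t - 1| ^ b * (|t - r| ^ c + |t - -r| ^ c) := by gcongr
      _ = _ := by simp only [Pi.add_apply]; ring
  · filter_upwards [htr] with t htr
    refine tendsto_const_nhds.mul ((continuousWithinAt_cpow_const (w := (t : ℂ) - r)
      (s := c) (sub_ne_zero.2 (by exact_mod_cast htr))).tendsto.comp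
      (tendsto_nhdsWithin_iff.2 ⟨?_, ?_⟩))
    · exact tendsto_const_nhds.sub (arcBelow_le_nhds r)
    · filter_upwards [eventually_arcBelow r] with z hz
      simpa using hz.2.le

lemma tendsto_unitIntegral {a b c r : ℝ} (h : Convergent a b c) (hr : 0 < r) (hr1 : r ≠ 1) :
    Tendsto (unitIntegral a b c) (arcBelow r) (𝓝 (unitIntegral a b c r)) := by
  -- In the unit integral the exponent at `1` is `c`, and the other branch point is `r⁻¹` with
  -- exponent `b`; hence the exchange of `b` and `c`.
  have h' : Convergent a c b := ⟨h.1, h.2.2.1, h.2.1, by linarith [h.2.2.2]⟩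
  have hr' : 0 < r⁻¹ := inv_pos.2 hr
  have i1 := integrableOn_abs_prod h' hr'.ne' (inv_ne_one.2 hr1)
  have i2 := integrableOn_abs_prod h' (neg_ne_zero.2 hr'.ne') (by linarith : -r⁻¹ ≠ 1)
  have hsub : Ioc (0 : ℝ) 1 ⊆ Ioi 0 := Ioc_subset_Ioi_self
  have htr : ∀ᵐ t : ℝ ∂(volume.restrict (Ioc 0 1)), t ≠ r⁻¹ :=
    ae_restrict_of_ae (compl_mem_ae_iff.2 (measure_singleton r⁻¹))
  unfold unitIntegral
  simp only [intervalIntegral.integral_of_le zero_le_one]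
  refine tendsto_integral_filter_of_dominated_convergence _
    (Eventually.of_forall fun z => Measurable.aestronglyMeasurable ?_) ?_
    (((i1.mono_set hsub).add (i2.mono_set hsub)).const_mul (r ^ b)) ?_
  · have := Complex.measurable_ofReal
    fun_prop
  · filter_upwards [eventually_arcBelow r] with z hz
    filter_upwards [htr, ae_restrict_mem measurableSet_Ioc] with t htr ht
    have ht0 : 0 < t := ht.1
    have k1 : r * |t - r⁻¹| ≤ ‖1 - t * z‖ := by
      have := abs_norm_sub_norm_le (t * z) 1
      rw [norm_mul, Complex.norm_real, Real.norm_of_nonneg ht0.le, hz.1, norm_one,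
        norm_sub_rev] at this
      rwa [← abs_of_pos hr, ← abs_mul, abs_of_pos hr, mul_sub, mul_inv_cancel₀ hr.ne', mul_comm]
    have k2 : ‖1 - t * z‖ ≤ r * |t - -r⁻¹| := by
      have := norm_sub_le 1 (t * z)
      rw [norm_mul, Complex.norm_real, Real.norm_of_nonneg ht0.le, hz.1, norm_one] at this
      rw [sub_neg_eq_add, abs_of_pos (by linarith), mul_add, mul_inv_cancel₀ hr.ne']
      linarith
    have k3 := rpow_le_add_rpow (s := b)
      (mul_pos hr (abs_pos.2 (sub_ne_zero.2 htr))) k1 k2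
    rw [mul_rpow hr.le (abs_nonneg _), mul_rpow hr.le (abs_nonneg _)] at k3
    rw [norm_mul, Complex.norm_cpow_real, Complex.norm_real, norm_mul,
      Real.norm_of_nonneg (rpow_nonneg ht0.le _),
      Real.norm_of_nonneg (rpow_nonneg (sub_nonneg.2 ht.2) _), ← abs_of_nonneg (sub_nonneg.2 ht.2),
      abs_sub_comm]
    calc t ^ a * |t - 1| ^ c * ‖1 - t * z‖ ^ b
        ≤ t ^ a * |t - 1| ^ c * (r ^ b * |t - r⁻¹| ^ b + r ^ b * |t - -r⁻¹| ^ b) := by gcongr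
      _ = _ := by simp only [Pi.add_apply]; ring
  · filter_upwards [htr, ae_restrict_mem measurableSet_Ioc] with t htr ht
    have hne : (1 : ℂ) - t * r ≠ 0 := by
      intro h0
      have : t * r = 1 := by exact_mod_cast (sub_eq_zero.1 h0).symm
      exact htr (eq_inv_of_mul_eq_one_left this)
    refine tendsto_const_nhds.mul ((continuousWithinAt_cpow_const (s := b) hne).tendsto.comp
      (tendsto_nhdsWithin_iff.2 ⟨?_, ?_⟩))
    · exact tendsto_const_nhds.sub (tendsto_const_nhds.mul (arcBelow_le_nhds r))
    · filter_upwards [eventually_arcBelow r] with z hz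
      simpa using mul_nonpos_of_nonneg_of_nonpos ht.1.le hz.2.le

lemma tendsto_vecI_one {a b c r : ℝ} (h : Convergent a b c) (hr : 0 < r) (hr1 : r ≠ 1) :
    Tendsto (fun z => vecI a b c z 1) (arcBelow r) (𝓝 (vecI a b c r 1)) := by
  have hr0 : (r : ℂ) ≠ 0 := by exact_mod_cast hr.ne'
  have hcpow : ∀ s : ℝ, Tendsto (fun z : ℂ => z ^ (s : ℂ)) (arcBelow r) (𝓝 ((r : ℂ) ^ (s : ℂ))) :=
    fun s => (continuousAt_id.cpow continuousAt_const
      (by simpa [Complex.mem_slitPlane_iff] using hr)).tendsto.mono_left (arcBelow_le_nhds r)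
  rw [vecI_one_eq_unitIntegral hr0]
  have hid : Tendsto (fun z : ℂ => z) (arcBelow r) (𝓝 (r : ℂ)) := arcBelow_le_nhds r
  refine (((hid.mul (hcpow a)).mul (hcpow c)).mul (tendsto_unitIntegral h hr hr1)).congr' ?_
  filter_upwards [arcBelow_le_nhds r (isOpen_ne.mem_nhds hr0)] with z hz
  exact (vecI_one_eq_unitIntegral hz).symm

/-- The holomorphic factorisation of the correlator, in the basis `vecI`. -/
theorem correlator_eq_bilin_star_vecI {A B C : ℝ} {n n' m m' p p' : ℤ} {z : ℂ}
    (h : Convergent (A + n) (B + m) (C + p)) (h' : Convergent (A + n') (B + m') (C + p'))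
    (hs : sin (π * (A + C)) ≠ 0) (hz0 : z ≠ 0) (hz1 : z ≠ 1) :
    correlator A B C n n' m m' p p' z =
      bilin (star (vecI (A + n') (B + m') (C + p') z)) (matG A B C m m' p p')
        (vecI (A + n) (B + m) (C + p) z) := by
  by_cases hz : -z ∈ Complex.slitPlane
  · exact correlator_eq_bilin_vecI_of_neg_mem_slitPlane h h' hs hz
  obtain ⟨r, hr, rfl⟩ : ∃ r : ℝ, 0 < r ∧ z = r := by
    have h1 : 0 ≤ z.re ∧ z.im = 0 := by simpa [Complex.mem_slitPlane_iff] using hz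
    have e : z = (z.re : ℂ) := Complex.ext rfl (by simp [h1.2])
    refine ⟨z.re, lt_of_le_of_ne h1.1 fun h2 => hz0 ?_, e⟩
    rw [e, ← h2, Complex.ofReal_zero]
  have hr1 : r ≠ 1 := fun h => hz1 (by rw [h, Complex.ofReal_one])
  have := arcBelow_neBot hr
  have lhs : Tendsto (correlator A B C n n' m m' p p') (arcBelow r)
      (𝓝 (correlator A B C n n' m m' p p' r)) := by
    obtain ⟨ha, hb, hc, habc⟩ := h
    obtain ⟨ha', hb', hc', habc'⟩ := h'
    exact (continuousAt_correlator hz0 hz1 (by linarith) (by linarith) (by linarith)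
      (by linarith)).tendsto.mono_left (arcBelow_le_nhds r)
  have hconj := Complex.continuous_conj.tendsto
  have rhs := ((((hconj _).comp (tendsto_vecI_zero h' hr hr1)).mul
    (tendsto_vecI_zero h hr hr1)).const_mul
      ((sin (π * (A + B + C)) * sin (π * B) : ℝ) : ℂ)).add
    ((((hconj _).comp (tendsto_vecI_one h' hr hr1)).mul (tendsto_vecI_one h hr hr1)).const_mul
      ((parity (m - m' + (p - p')) * (sin (π * C) * sin (π * A)) : ℝ) : ℂ)) |>.const_mul
      ((1 / sin (π * (A + C)) : ℝ) : ℂ)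
  refine (tendsto_nhds_unique lhs (rhs.congr' ?_)).trans ?_
  · filter_upwards [eventually_arcBelow r] with z hz
    rw [correlator_eq_bilin_vecI_of_neg_mem_slitPlane h h' hs
      (by rw [Complex.mem_slitPlane_iff]; right; simpa using hz.2.ne), matG, bilin_smul_diagonal]
    rfl
  · rw [matG, bilin_smul_diagonal]
    rfl

/-! ### Complex conjugation and the reflection to the `J` basis -/

lemma cutPlane_ne {z : ℂ} (hz : z ∈ cutPlane) : z ≠ 0 ∧ z ≠ 1 := by
  refine ⟨?_, ?_⟩ <;> rintro rfl <;> simp [cutPlane] at hz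

lemma conj_cpow_ofReal {w : ℂ} (hw : w ∈ Complex.slitPlane) (s : ℝ) :
    (conj w) ^ (s : ℂ) = conj (w ^ (s : ℂ)) := by
  rw [Complex.conj_cpow _ _ (Complex.mem_slitPlane_iff_arg.1 hw).1, Complex.conj_ofReal]

/-- On the cut plane all bases along the paths avoid the negative axis, so principal powers commute
with conjugation. -/
lemma vecI_conj {a b c : ℝ} {z : ℂ} (hz : z ∈ cutPlane) :
    vecI a b c (conj z) = star (vecI a b c z) := by
  funext i
  fin_cases i
  · show vecI a b c (conj z) 0 = conj (vecI a b c z 0)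
    simp only [vecI, cons_val_zero]
    rw [← integral_conj]
    refine setIntegral_congr_fun measurableSet_Ioi fun t ht => ?_
    have ht : 1 < t := ht
    have e1 : (t : ℂ) ∈ Complex.slitPlane := by
      simpa [Complex.mem_slitPlane_iff] using (by linarith : 0 < t)
    have e2 : (t : ℂ) - 1 ∈ Complex.slitPlane := by
      simp [Complex.mem_slitPlane_iff, ht]
    have e3 : (t : ℂ) - z ∈ Complex.slitPlane := by
      rw [Complex.mem_slitPlane_iff]
      rcases hz with h | h
      · right; simpa using h
      · left; simp; linarith
    simp only [map_mul, ← conj_cpow_ofReal e1, ← conj_cpow_ofReal e2, ← conj_cpow_ofReal e3,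
      map_sub, map_one, Complex.conj_ofReal]
  · show vecI a b c (conj z) 1 = conj (vecI a b c z 1)
    have hz0 := (cutPlane_ne hz).1
    have e0 : z ∈ Complex.slitPlane := by
      rw [Complex.mem_slitPlane_iff]
      rcases hz with h | h
      · exact Or.inr h
      · exact Or.inl h.1
    rw [vecI_one_eq_unitIntegral hz0, vecI_one_eq_unitIntegral (by simpa using hz0), map_mul,
      map_mul, map_mul, conj_cpow_ofReal e0, conj_cpow_ofReal e0]
    congr 1
    unfold unitIntegral
    rw [intervalIntegral.integral_of_le zero_le_one, intervalIntegral.integral_of_le zero_le_one,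
      integral_Ioc_eq_integral_Ioo, integral_Ioc_eq_integral_Ioo, ← integral_conj]
    refine setIntegral_congr_fun measurableSet_Ioo fun t ht => ?_
    have e1 : (1 : ℂ) - t * z ∈ Complex.slitPlane := by
      rw [Complex.mem_slitPlane_iff]
      rcases hz with h | h
      · right; simpa using ⟨ht.1.ne', h⟩
      · left; simp; nlinarith [ht.1, ht.2]
    simp only [map_mul, ← conj_cpow_ofReal e1, map_sub, map_one, Complex.conj_ofReal]

/-- The reflection exchanges `0` and `1`, hence the data of `A` and `B`; all three factors change
sign, which gives the parity. -/
lemma correlatorIntegrand_one_sub (A B C : ℝ) (n n' m m' p p' : ℤ) (z w : ℂ) :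
    correlatorIntegrand A B C n n' m m' p p' z (1 - w) =
      (parity (n - n' + (m - m') + (p - p')) : ℂ) *
        correlatorIntegrand B A C m m' n n' p p' (1 - z) w := by
  rw [correlatorIntegrand, correlatorIntegrand, show 1 - w = -(w - 1) by ring,
    show -(w - 1) - 1 = -w by ring, show -(w - 1) - z = -(w - (1 - z)) by ring, powPair_neg,
    powPair_neg, powPair_neg, parity_add, parity_add]
  simp only [Complex.ofReal_mul, ofReal_parity]
  ring

lemma correlator_one_sub (A B C : ℝ) (n n' m m' p p' : ℤ) (z : ℂ) :
    correlator A B C n n' m m' p p' z =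
      (parity (n - n' + (m - m') + (p - p')) : ℂ) * correlator B A C m m' n n' p p' (1 - z) := by
  rw [correlator, correlator, ← integral_const_mul, ← integral_sub_left_eq_self _ volume 1]
  simp only [correlatorIntegrand_one_sub]

/-- Under `w ↦ 1 - w` the path `(-∞, 0)` becomes `(1, ∞)`, and the segment from `z` to `1` becomes
the one from `0` to `1 - z`, reversed. -/
lemma vecJ_eq_vecI (a b c : ℝ) (z : ℂ) : vecJ a b c z = vecI b a c (1 - z) := by
  funext i
  fin_cases i
  · simp only [vecI, vecJ, Fin.zero_eta, cons_val_zero]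
    rw [← integral_indicator measurableSet_Iio, ← integral_indicator measurableSet_Ioi,
      ← integral_sub_left_eq_self _ volume (1 : ℝ)]
    congr 1 with t
    by_cases ht : 1 < t
    · rw [indicator_of_mem (by simpa using ht), indicator_of_mem (by simpa using ht)]
      push_cast
      rw [show -(1 - (t : ℂ)) = t - 1 by ring, show 1 - (1 - (t : ℂ)) = t by ring,
        show z - (1 - (t : ℂ)) = t - (1 - z) by ring]
      ring
    · rw [indicator_of_notMem (by simpa using ht), indicator_of_notMem (by simpa using ht)]
  · simp only [vecI, vecJ, Fin.mk_one, cons_val_one, segmentIntegral]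
    rw [sub_zero]
    refine congrArg ((1 - z) * ·) ?_
    have h := intervalIntegral.integral_comp_sub_left (a := 0) (b := 1) (fun t : ℝ =>
      (0 + (t : ℂ) * (1 - z)) ^ (b : ℂ) * (1 - (0 + (t : ℂ) * (1 - z))) ^ (a : ℂ) *
        (1 - z - (0 + (t : ℂ) * (1 - z))) ^ (c : ℂ)) 1
    rw [sub_self, sub_zero] at h
    refine Eq.trans ?_ h
    refine intervalIntegral.integral_congr fun t _ => ?_
    push_cast
    rw [show 0 + (1 - (t : ℂ)) * (1 - z) = 1 - (z + t * (1 - z)) by ring,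
      show 1 - (1 - (z + (t : ℂ) * (1 - z))) = z + t * (1 - z) by ring,
      show 1 - z - (1 - (z + (t : ℂ) * (1 - z))) = z + t * (1 - z) - z by ring]
    ring

/-- In the second diagonal entry the parities of `n - n'` and `p - p'` occur twice, so only that of
`m - m'` remains. -/
lemma bilin_matGhat (A B C : ℝ) (n n' m m' p p' : ℤ) (u v : Fin 2 → ℂ) :
    bilin u (matGhat A B C n n' m m' p p') v =
      (parity (n - n' + (m - m') + (p - p')) : ℂ) * bilin u (matG B A C n n' p p') v := by
  have e1 := congrArg ((↑) : ℝ → ℂ) (parity_mul_self (n - n'))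
  have e2 := congrArg ((↑) : ℝ → ℂ) (parity_mul_self (p - p'))
  rw [matGhat, matG, bilin_smul_diagonal, bilin_smul_diagonal, parity_add, parity_add, parity_add,
    add_comm B A]
  simp only [Complex.ofReal_mul, Complex.ofReal_one] at e1 e2 ⊢
  linear_combination -(((1 / sin (π * (B + C)) : ℝ) : ℂ) * parity (m - m') * sin (π * C) *
    sin (π * B) * (u 1 * v 1)) * (parity (p - p') * parity (p - p') * e1 + e2)

theorem correlator_eq_bilin_star_vecJ {A B C : ℝ} {n n' m m' p p' : ℤ} {z : ℂ}
    (h : Convergent (A + n) (B + m) (C + p)) (h' : Convergent (A + n') (B + m') (C + p'))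
    (hs : sin (π * (B + C)) ≠ 0) (hz0 : z ≠ 0) (hz1 : z ≠ 1) :
    correlator A B C n n' m m' p p' z =
      bilin (star (vecJ (A + n') (B + m') (C + p') z)) (matGhat A B C n n' m m' p p')
        (vecJ (A + n) (B + m) (C + p) z) := by
  obtain ⟨ha, hb, hc, habc⟩ := h
  obtain ⟨ha', hb', hc', habc'⟩ := h'
  rw [correlator_one_sub, bilin_matGhat, vecJ_eq_vecI, vecJ_eq_vecI,
    correlator_eq_bilin_star_vecI ⟨hb, ha, hc, by linarith⟩ ⟨hb', ha', hc', by linarith⟩ hs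
      (sub_ne_zero.2 hz1.symm) (by simpa using hz0)]

lemma one_sub_mem_cutPlane {z : ℂ} (hz : z ∈ cutPlane) : 1 - z ∈ cutPlane := by
  rcases hz with h | h
  · left; simpa using h
  · right; simpa using h.symm

lemma vecJ_conj {a b c : ℝ} {z : ℂ} (hz : z ∈ cutPlane) :
    vecJ a b c (conj z) = star (vecJ a b c z) := by
  rw [vecJ_eq_vecI, vecJ_eq_vecI, ← vecI_conj (one_sub_mem_cutPlane hz), map_sub, map_one]

/-! ### Evaluation at `z = 1` -/

lemma ofReal_openAmplitude2134 (A D : ℝ) (n k : ℤ) :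
    (openAmplitude2134 (2 * A) (2 * D) n k : ℂ) =
      ∫ t in Ioi (1 : ℝ), (t : ℂ) ^ ((D + k : ℝ) : ℂ) * ((t : ℂ) - 1) ^ ((A + n : ℝ) : ℂ) := by
  rw [openAmplitude2134, ← integral_complex_ofReal, ← integral_indicator measurableSet_Iio,
    ← integral_indicator measurableSet_Ioi, ← integral_sub_left_eq_self _ volume (1 : ℝ)]
  congr 1 with t
  by_cases ht : 1 < t
  · rw [indicator_of_mem (by simpa using ht), indicator_of_mem (by simpa using ht),
      mul_div_cancel_left₀ _ two_ne_zero, mul_div_cancel_left₀ _ two_ne_zero, neg_sub,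
      sub_sub_cancel, Complex.ofReal_mul, Complex.ofReal_cpow (sub_nonneg.2 ht.le),
      Complex.ofReal_cpow (by linarith), Complex.ofReal_sub, Complex.ofReal_one, mul_comm]
  · rw [indicator_of_notMem (by simpa using ht), indicator_of_notMem (by simpa using ht)]

lemma neg_neg_one_mem_slitPlane : -(-1 : ℂ) ∈ Complex.slitPlane := by simp

lemma integral_rayOne_neg_one (A D : ℝ) (n k : ℤ) :
    ∫ s in Ioi 0, rayOne (D + k) (A + n) 0 (-1) s = (openAmplitude2134 (2 * A) (2 * D) n k : ℂ) := by
  have h := vecI_zero_eq_ray (a := D + k) (b := A + n) (c := 0) neg_neg_one_mem_slitPlane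
  rw [neg_neg, Complex.one_cpow, one_mul] at h
  rw [← h, ofReal_openAmplitude2134]
  simp [vecI]

lemma conj_powPair (A : ℝ) (k k' : ℤ) (w : ℂ) : conj (powPair A k k' w) = powPair A k' k w := by
  simp only [powPair, map_mul, map_zpow₀, Complex.conj_conj, Complex.conj_ofReal]
  ring

lemma conj_correlator (A B C : ℝ) (n n' m m' p p' : ℤ) (z : ℂ) :
    conj (correlator A B C n n' m m' p p' z) = correlator A B C n' n m' m p' p z := by
  rw [correlator, correlator, ← integral_conj]
  simp only [correlatorIntegrand, map_mul, conj_powPair]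

/-- With `C = 0` the point `-1` is no branch point: `sin πC = 0` removes the ray through it, both
from the bilinear formula and from the first contour relation. Of the unbarred form only the
integral over `(1,∞)` enters, so `D + k > -1` is not required. -/
lemma correlator_neg_one_of_lt {A D : ℝ} {n n' k k' : ℤ} (ha : -1 < A + n) (ha' : -1 < A + n')
    (hd' : -1 < D + k') (hdd : -2 < D + k + (D + k')) (hs : D + k + (A + n) < -1)
    (hs' : D + k' + (A + n') < -1) (h0 : sin (π * D) ≠ 0) :
    correlator D A 0 k k' n n' 0 0 (-1) =
      ((sin (π * A) * sin (π * (A + D)) / sin (π * D) *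
        (openAmplitude2134 (2 * A) (2 * D) n k * openAmplitude2134 (2 * A) (2 * D) n' k') : ℝ) :
          ℂ) := by
  have h := correlator_eq_rays (A := D) (B := A) (C := 0) (n := k) (n' := k') (m := n) (m' := n')
    (p := 0) (p' := 0) hd' hdd ha ha' (by simp) (by simp) (by simpa using hs) (by simpa using hs')
    neg_neg_one_mem_slitPlane
  have r := (contour_relations hd' ha' (by simp : (-1 : ℝ) < 0) (by simpa using hs')
    neg_neg_one_mem_slitPlane).1
  have s1 : sin (π * (D + k' + (A + n'))) = parity k' * parity n' * sin (π * (A + D)) := by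
    rw [← parity_add, ← sin_pi_mul_add_int]; push_cast; ring_nf
  have s2 : sin (π * (D + k - (D + k') + (A + n))) =
      parity k * parity k' * parity n * sin (π * A) := by
    rw [← parity_sub, ← parity_add, ← sin_pi_mul_add_int]; push_cast; ring_nf
  have hp : powPair 0 0 0 (- -1) = 1 := by simp [powPair]
  have h0' : ((sin (π * D) : ℝ) : ℂ) ≠ 0 := by exact_mod_cast h0
  have sq : ∀ j, (parity j : ℂ) * parity j = 1 := fun j => by exact_mod_cast parity_mul_self j
  have hk' : (parity k' : ℂ) ≠ 0 := left_ne_zero_of_mul_eq_one (sq k')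
  simp only [Int.cast_zero, add_zero, mul_zero, Real.sin_zero, Complex.ofReal_zero, zero_mul,
    hp, mul_one, s2, integral_rayOne_neg_one, ← ofReal_parity, parity_sub,
    Complex.ofReal_mul] at h
  simp only [add_zero, mul_zero, Real.sin_zero, Complex.ofReal_zero, zero_mul, zero_add,
    integral_rayOne_neg_one, s1, sin_pi_mul_add_int, Complex.ofReal_mul] at r
  generalize openAmplitude2134 (2 * A) (2 * D) n k = X at *
  generalize openAmplitude2134 (2 * A) (2 * D) n' k' = X' at *
  -- The first contour relation, solved for the integral over `(0,1)`; it is real, so the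
  -- conjugation in the bilinear formula disappears.
  have r' : (∫ s in Iic 0, rayOne (D + k') (A + n') 0 (-1) s) =
      ((-(parity n' * sin (π * (A + D)) / sin (π * D) * X') : ℝ) : ℂ) := by
    push_cast at r h0' ⊢
    field_simp
    refine mul_left_cancel₀ hk' ?_
    linear_combination r
  rw [h, r', Complex.conj_ofReal]
  have k1 := sq k
  have k2 := sq k'
  have n1 := sq n
  have n2 := sq n'
  push_cast at h0' ⊢
  field_simp
  linear_combination (X : ℂ) * X' * Complex.sin (π * A) * Complex.sin (π * (A + D)) *
    ((parity k' : ℂ) * parity k' * (parity n * parity n) * (parity n' * parity n') * k1 +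
      parity n * parity n * (parity n' * parity n') * k2 + parity n' * parity n' * n1 + n2)

/-- The closed-string four-point integral in terms of open-string amplitudes. -/
theorem correlator_neg_one {A D : ℝ} {n n' k k' : ℤ} (ha : -1 < A + n) (ha' : -1 < A + n')
    (hdd : -2 < D + k + (D + k')) (hs : D + k + (A + n) < -1)
    (hs' : D + k' + (A + n') < -1) (h0 : sin (π * D) ≠ 0) :
    correlator D A 0 k k' n n' 0 0 (-1) =
      ((sin (π * A) * sin (π * (A + D)) / sin (π * D) *
        (openAmplitude2134 (2 * A) (2 * D) n k * openAmplitude2134 (2 * A) (2 * D) n' k') : ℝ) :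
          ℂ) := by
  by_cases hd' : -1 < D + k'
  · exact correlator_neg_one_of_lt ha ha' hd' hdd hs hs' h0
  -- The exponents `D + k` and `D + k'` have sum above `-2`, so if the barred one is at most `-1`
  -- the other exceeds `-1`. Conjugation exchanges them, and the right-hand side is real and
  -- symmetric.
  · rw [← conj_correlator, correlator_neg_one_of_lt ha' ha (by linarith) (by linarith) hs' hs h0,
      Complex.conj_ofReal, mul_comm (openAmplitude2134 _ _ n' k')]

lemma powPair_mul_powPair {B C : ℝ} {m m' p p' : ℤ} {w : ℂ} (hw : w ≠ 0) :
    powPair B m m' w * powPair C p p' w = powPair (B + C) (m + p) (m' + p') w := by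
  rw [powPair, powPair, powPair, mul_add, rpow_add (norm_pos_iff.2 hw), zpow_add₀ hw,
    zpow_add₀ (by simpa using hw)]
  push_cast
  ring

lemma correlatorIntegrand_zero_ae (A B C : ℝ) (n n' m m' p p' : ℤ) :
    correlatorIntegrand B A C m m' n n' p p' 0 =ᵐ[volume]
      correlatorIntegrand (B + C) A 0 (m + p) (m' + p') n n' 0 0 (-1) := by
  filter_upwards [compl_mem_ae_iff.2 (measure_singleton (μ := (volume : Measure ℂ)) 0)] with w hw
  rw [correlatorIntegrand, correlatorIntegrand, sub_zero, mul_right_comm, powPair_mul_powPair hw]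
  simp [powPair]

/-- The reflection moves `z = 1` to `0`, where the factors of `B` and `C` combine into one of
exponent `B + C`. The free third slot is filled with exponent zero at `-1`, away from the positive
axis. -/
lemma correlator_one (A B C : ℝ) (n n' m m' p p' : ℤ) :
    correlator A B C n n' m m' p p' 1 = (parity (n - n' + (m - m') + (p - p')) : ℂ) *
      correlator (B + C) A 0 (m + p) (m' + p') n n' 0 0 (-1) := by
  rw [correlator_one_sub, sub_self, correlator, integral_congr_ae (correlatorIntegrand_zero_ae ..),
    correlator]

lemma integrable_correlatorIntegrand_one {A B C : ℝ} {n n' m m' p p' : ℤ}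
    (ha : -2 < (A + n) + (A + n')) (hbc : -2 < (B + m) + (C + p) + ((B + m') + (C + p')))
    (habc : (A + n) + (B + m) + (C + p) + ((A + n') + (B + m') + (C + p')) < -2) :
    Integrable (correlatorIntegrand A B C n n' m m' p p' 1) := by
  have h := integrable_correlatorIntegrand (A := B + C) (B := A) (C := 0) (n := m + p)
    (n' := m' + p') (m := n) (m' := n') (p := 0) (p' := 0) (z := -1) (by simp) (by norm_num)
    (by push_cast; linarith) ha (by simp) (by push_cast; linarith)
  have h2 := ((h.congr (correlatorIntegrand_zero_ae A B C n n' m m' p p').symm).const_mul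
    (parity (n - n' + (m - m') + (p - p')) : ℂ)).comp_sub_left 1
  refine h2.congr (Eventually.of_forall fun w => ?_)
  have := correlatorIntegrand_one_sub A B C n n' m m' p p' 1 (1 - w)
  rw [sub_sub_cancel, sub_self] at this
  exact this.symm

lemma closedAmplitude_eq (A D : ℝ) (n n' k k' : ℤ) :
    closedAmplitude (2 * A) (2 * D) n n' k k' =
      (parity (n - n') : ℂ) * correlator D A 0 k k' n n' 0 0 (-1) := by
  rw [closedAmplitude, correlator, ← integral_const_mul, ← integral_sub_left_eq_self _ volume 1]
  congr 1 with w
  have e : powPair 0 0 0 (w - -1) = 1 := by simp [powPair]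
  have e' : (-1) ^ (n - n') * powPair A n n' (w - 1) = powPair A n n' (1 - w) := by
    rw [← powPair_neg, neg_sub]
  rw [correlatorIntegrand, e, mul_one, ofReal_parity, mul_left_comm ((-1) ^ (n - n')), e', powPair,
    powPair, sub_sub_cancel]
  simp only [map_sub, map_one, sub_sub_cancel]
  push_cast
  ring

/-- The two powers based at `1` merge in the first entry; in the second the path from `z` to `1`
shrinks to a point. -/
lemma vecJ_one (A B C : ℝ) (n m p : ℤ) : vecJ (A + n) (B + m) (C + p) 1 =
    ![((openAmplitude2134 (2 * A) (2 * (B + C)) n (m + p) : ℝ) : ℂ), 0] := by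
  rw [vecJ_eq_vecI, sub_self]
  funext i
  fin_cases i
  · simp only [vecI, Fin.zero_eta, cons_val_zero, ofReal_openAmplitude2134, sub_zero]
    refine setIntegral_congr_fun measurableSet_Ioi fun t ht => ?_
    have ht : (t : ℂ) ≠ 0 := by exact_mod_cast (zero_lt_one.trans ht).ne'
    rw [mul_right_comm, ← Complex.cpow_add _ _ ht]
    push_cast
    ring_nf
  · simp [vecI, segmentIntegral]

end StringCorrelator

theorem mainTheorem10 (A B C : ℝ) (n n' m m' p p' : ℤ) :
    -- holomorphic factorisation
    (Convergent (A + n) (B + m) (C + p) → Convergent (A + n') (B + m') (C + p') →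
      (∀ z : ℂ, z ≠ 0 → z ≠ 1 →
        Integrable (correlatorIntegrand A B C n n' m m' p p' z)) ∧
      -- in the `I` basis
      (sin (π * (A + C)) ≠ 0 →
        (∀ z ∈ cutPlane,
          correlator A B C n n' m m' p p' z =
            bilin (vecI (A + n') (B + m') (C + p') (conj z)) (matG A B C m m' p p')
              (vecI (A + n) (B + m) (C + p) z)) ∧
        (∀ z : ℂ, z ≠ 0 → z ≠ 1 →
          correlator A B C n n' m m' p p' z =
            bilin (star (vecI (A + n') (B + m') (C + p') z)) (matG A B C m m' p p')
              (vecI (A + n) (B + m) (C + p) z))) ∧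
      -- in the `J` basis
      (sin (π * (B + C)) ≠ 0 →
        (∀ z ∈ cutPlane,
          correlator A B C n n' m m' p p' z =
            bilin (vecJ (A + n') (B + m') (C + p') (conj z)) (matGhat A B C n n' m m' p p')
              (vecJ (A + n) (B + m) (C + p) z)) ∧
        (∀ z : ℂ, z ≠ 0 → z ≠ 1 →
          correlator A B C n n' m m' p p' z =
            bilin (star (vecJ (A + n') (B + m') (C + p') z)) (matGhat A B C n n' m m' p p')
              (vecJ (A + n) (B + m) (C + p) z)))) ∧
    -- evaluation at `z = 1`, under convergence of the integrals that occur there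
    (-1 < A + n → -1 < A + n' →
      A + n + (B + m) + (C + p) < -1 → A + n' + (B + m') + (C + p') < -1 →
      -2 < (B + m) + (C + p) + ((B + m') + (C + p')) →
      sin (π * (B + C)) ≠ 0 →
      Integrable (correlatorIntegrand A B C n n' m m' p p' 1) ∧
      vecJ (A + n) (B + m) (C + p) 1 =
        ![((openAmplitude2134 (2 * A) (2 * (B + C)) n (m + p) : ℝ) : ℂ), 0] ∧
      vecJ (A + n') (B + m') (C + p') 1 =
        ![((openAmplitude2134 (2 * A) (2 * (B + C)) n' (m' + p') : ℝ) : ℂ), 0] ∧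
      correlator A B C n n' m m' p p' 1 =
        ((parity (n - n' + (m - m') + (p - p')) *
          (sin (π * A) * sin (π * (A + B + C)) / sin (π * (B + C))) *
          (openAmplitude2134 (2 * A) (2 * (B + C)) n (m + p) *
            openAmplitude2134 (2 * A) (2 * (B + C)) n' (m' + p')) : ℝ) : ℂ) ∧
      closedAmplitude (2 * A) (2 * (B + C)) n n' (m + p) (m' + p') =
        (parity (m + p - (m' + p')) : ℂ) * correlator A B C n n' m m' p p' 1 ∧
      closedAmplitude (2 * A) (2 * (B + C)) n n' (m + p) (m' + p') =
        ((parity (n - n') *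
          (sin (π * A) * sin (π * (A + B + C)) / sin (π * (B + C))) *
          (openAmplitude2134 (2 * A) (2 * (B + C)) n (m + p) *
            openAmplitude2134 (2 * A) (2 * (B + C)) n' (m' + p')) : ℝ) : ℂ)) := by
  refine ⟨fun h h' => ⟨fun z hz0 hz1 => ?_, fun hs => ⟨fun z hz => ?_, fun z hz0 hz1 => ?_⟩,
    fun hs => ⟨fun z hz => ?_, fun z hz0 hz1 => ?_⟩⟩, fun ha ha' habc habc' hbc hs => ?_⟩
  · obtain ⟨ha, hb, hc, habc⟩ := h
    obtain ⟨ha', hb', hc', habc'⟩ := h'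
    exact integrable_correlatorIntegrand hz0 hz1 (by linarith) (by linarith) (by linarith)
      (by linarith)
  · rw [vecI_conj hz]
    exact correlator_eq_bilin_star_vecI h h' hs (cutPlane_ne hz).1 (cutPlane_ne hz).2
  · exact correlator_eq_bilin_star_vecI h h' hs hz0 hz1
  · rw [vecJ_conj hz]
    exact correlator_eq_bilin_star_vecJ h h' hs (cutPlane_ne hz).1 (cutPlane_ne hz).2
  · exact correlator_eq_bilin_star_vecJ h h' hs hz0 hz1
  · have key := correlator_neg_one (A := A) (D := B + C) (n := n) (n' := n') (k := m + p)
      (k' := m' + p') ha ha' (by push_cast; linarith) (by push_cast; linarith)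
      (by push_cast; linarith) hs
    rw [← add_assoc A B C] at key
    have hcl := closedAmplitude_eq A (B + C) n n' (m + p) (m' + p')
    refine ⟨integrable_correlatorIntegrand_one (by linarith) (by linarith) (by linarith),
      vecJ_one A B C n m p, vecJ_one A B C n' m' p', ?_, ?_, ?_⟩
    · rw [correlator_one, key, ← Complex.ofReal_mul, mul_assoc]
    · have e : parity (m + p - (m' + p')) * parity (n - n' + (m - m') + (p - p')) =
          parity (n - n') := by
        rw [show n - n' + (m - m') + (p - p') = n - n' + (m + p - (m' + p')) by ring, parity_add,
          mul_left_comm, parity_mul_self, mul_one]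
      rw [hcl, correlator_one, ← mul_assoc, ← Complex.ofReal_mul, e]
    · rw [hcl, key, ← Complex.ofReal_mul, mul_assoc]
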